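/- **Conventions.** Let $\Bbbk$ be a field. All vector spaces, algebras, modules and categories are over $\Bbbk$ and $\mathbb Z/2\mathbb Z$-graded ("super"); $\bar x\in\mathbb Z/2\mathbb Z$ is the parity of a homogeneous $x$, and formulas involving parities are extended by linearity. A *strict monoidal supercategory* has morphism superspaces and a strictly associative and unital, bilinear, parity preserving tensor product with $(f'\otimes g)\circ(f\otimes g')=(-1)^{\bar f\bar g}(f'\circ f)\otimes(g\circ g')$. For a supercategory $\mathcal C$, $\mathcal End_\Bbbk(\mathcal C)$ is the strict monoidal supercategory of superfunctors $\mathcal C\to\mathcal C$ (tensor product: composition) and supernatural transformations, where a supernatural transformation $\alpha:F\Rightarrow G$ of parity $r$ consists of morphisms $\alpha_X$ of parity $r$ with $G(f)\circ\alpha_X=(-1)^{r\bar f}\alpha_Y\circ F(f)$ for $f:X\to Y$. Let $A$ be a symmetric Frobenius superalgebra: an associative unital superalgebra with an even linear map $\operatorname{tr}:A\to\Bbbk$ such that $\operatorname{tr}(ab)=(-1)^{\bar a\bar b}\operatorname{tr}(ba)$, with a finite homogeneous basis $\mathbf B_A$ and a left dual basis $\{b^\vee\}$, $\operatorname{tr}(b^\vee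 c)=\delta_{b,c}$ for $b,c\in\mathbf B_A$. Let $m,n\ge 0$ be integers, $p(i)=0$ for $1\le i\le m$ and $p(i)=1$ for $m<i\le m+n$. **The Lie superalgebra and its modules.** Let $\mathfrak g=\mathfrak{gl}_{m|n}(A)$ be the space of $(m+n)\times(m+n)$ matrices over $A$, where the matrix $a_{(i,j)}$ with $a$ in position $(i,j)$ and zeros elsewhere has parity $\bar a+p(i)+p(j)$, with $[M,N]=MN-(-1)^{\bar M\bar N}NM$. Let $\mathrm{smod}\text{-}\mathfrak g$ be the supercategory of right $\mathfrak g$-supermodules and all (even, odd and mixed) linear maps $f$ with $f(xM)=f(x)M$. Put $(v\otimes w)M=v\otimes wM+(-1)^{\bar w\bar M}vM\otimes w$ on tensor products of supermodules, and $(1\otimes f)(v\otimes w)=(-1)^{\bar f\bar v}v\otimes f(w)$. Let $V_+$ be the superspace $A^{m+n}$ of row vectors, where the vector $ae_i$ has parity $\bar a+p(i)$, with $\mathfrak g$ acting by right multiplication, and $V_-$ the superspace $A^{m+n}$ of column vectors with $v\cdot M=-(-1)^{\bar v\bar M}Mv$. Let $B(v\otimes w)=(-1)^{\bar v\bar w}\operatorname{tr}(wv)$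 for $v\in V_-$, $w\in V_+$. Let $\mathbf B_+=\{b_{i,+}\}$ be the basis of $V_+$ consisting of the row vectors with $b\in\mathbf B_A$ in position $i$ and zeros elsewhere, and $\{v^\vee:v\in\mathbf B_+\}$ the basis of $V_-$ dual to it, $B(v^\vee\otimes w)=\delta_{v,w}$; explicitly $(b_{i,+})^\vee=(-1)^{p(i)}(b^\vee)_{i,-}$, where $a_{i,-}$ is the column vector with $a$ in position $i$. Let $$\Omega=\sum_{i,j=1}^{m+n}\ \sum_{b\in\mathbf B_A} b_{(i,j)}\otimes(-1)^{p(j)}(b^\vee)_{(j,i)}\in\mathfrak g\otimes\mathfrak g,$$ acting on $V_+\otimes W$ on the right by $(v\otimes w)(M\otimes N)=(-1)^{\bar w\bar M}vM\otimes wN$. **The category.** The affine oriented Frobenius Brauer category $\mathcal{AOB}(A)$ is the strict monoidal supercategory generated by objects $\uparrow,\downarrow$ and morphisms $$s:\uparrow\otimes\uparrow\to\uparrow\otimes\uparrow,\quad t_a:\uparrow\to\uparrow\ (a\in A),\quad \eta:\mathbb 1\to\downarrow\otimes\uparrow,\quad \varepsilon:\uparrow\otimes\downarrow\to\mathbb 1,\quad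 \eta':\mathbb 1\to\uparrow\otimes\downarrow,\quad \varepsilon':\downarrow\otimes\uparrow\to\mathbb 1,\quad x:\uparrow\to\uparrow$$ (crossing, tokens, right cup, right cap, left cup, left cap, dot), where $t_a$ has parity $\bar a$ and the others are even, subject to the following relations for $a,b\in A$, $\lambda,\mu\in\Bbbk$. Here $1$ stands for the identity of $\uparrow$ or of $\downarrow$, and $$r=(1_\downarrow\otimes 1_\uparrow\otimes\varepsilon)(1_\downarrow\otimes s\otimes 1_\downarrow)(\eta\otimes 1_\uparrow\otimes 1_\downarrow):\uparrow\otimes\downarrow\to\downarrow\otimes\uparrow,$$ $$l=(\varepsilon'\otimes 1_\uparrow\otimes 1_\downarrow)(1_\downarrow\otimes s\otimes 1_\downarrow)(1_\downarrow\otimes 1_\uparrow\otimes\eta'):\downarrow\otimes\uparrow\to\uparrow\otimes\downarrow.$$ - $t_1=1$, $t_{\lambda a+\mu b}=\lambda t_a+\mu t_b$, $t_at_b=t_{ab}$; - $s^2=1$, $(s\otimes1)(1\otimes s)(s\otimes1)=(1\otimes s)(s\otimes1)(1\otimes s)$, $s(t_a\otimes1)=(1\otimes t_a)s$; - $l\,r=1$,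 $r\,l=1$, $(\varepsilon'\otimes1)(1\otimes s)(\eta\otimes1)=1_\uparrow=(1\otimes\varepsilon)(s\otimes1)(1\otimes\eta')$; - $(\varepsilon\otimes1)(1\otimes\eta)=1_\uparrow$, $(1\otimes\varepsilon)(\eta\otimes1)=1_\downarrow$; - $(x\otimes1)s-s(1\otimes x)=\sum_{b\in\mathbf B_A}(t_b\otimes1)(1\otimes t_{b^\vee})$, $t_ax=xt_a$. **Theorem.** There is a strict monoidal superfunctor $\Psi:\mathcal{AOB}(A)\to\mathcal End_\Bbbk(\mathrm{smod}\text{-}\mathfrak g)$ given on objects by $\Psi(\uparrow)=V_+\otimes-$ and $\Psi(\downarrow)=V_-\otimes-$, and on the generating morphisms by the following components at every $W\in\mathrm{smod}\text{-}\mathfrak g$, for $y\in W$: - $\Psi(s)_W:\ v\otimes w\otimes y\mapsto(-1)^{\bar v\bar w}\,w\otimes v\otimes y$ on $V_+\otimes V_+\otimes W$; - $\Psi(t_a)_W:\ v\otimes y\mapsto av\otimes y$ on $V_+\otimes W$; - $\Psi(\eta)_W:\ y\mapsto\sum_{v\in\mathbf B_+}(-1)^{\bar v}\,v^\vee\otimes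 v\otimes y\in V_-\otimes V_+\otimes W$; - $\Psi(\eta')_W:\ y\mapsto\sum_{v\in\mathbf B_+}v\otimes v^\vee\otimes y\in V_+\otimes V_-\otimes W$; - $\Psi(\varepsilon)_W:\ v\otimes w\otimes y\mapsto(-1)^{\bar v\bar w}B(w\otimes v)\,y$ on $V_+\otimes V_-\otimes W$; - $\Psi(\varepsilon')_W:\ v\otimes w\otimes y\mapsto B(v\otimes w)\,y$ on $V_-\otimes V_+\otimes W$; - $\Psi(x)_W:\ v\otimes y\mapsto(v\otimes y)\Omega$ on $V_+\otimes W$. -/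

import Mathlib

open CategoryTheory TensorProduct

universe w v u u₁ v₁ u₂ v₂

noncomputable section

namespace FrobeniusBrauer

/-! ## Vector superspaces and superalgebras -/

/-- The sign `(-1)^r` attached to a parity `r ∈ ℤ/2ℤ`. -/
def sgn (k : Type v) [Ring k] (r : ZMod 2) : k := (-1) ^ r.val

/-- A vector superspace: a vector space with a decomposition `V = V₀ ⊕ V₁` indexed by `ℤ/2ℤ`. -/
class SuperSpace (k : Type v) (V : Type u) [Field k] [AddCommGroup V] [Module k V] where
  /-- `part r` is the space of homogeneous vectors of parity `r`. -/
  part : ZMod 2 → Submodule k V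
  isCompl : IsCompl (part 0) (part 1)

/-- A superalgebra: an associative unital algebra with a compatible `ℤ/2ℤ`-grading. -/
class Superalgebra (k : Type v) (A : Type u) [Field k] [Ring A] [Algebra k A] extends
    SuperSpace k A where
  one_mem : (1 : A) ∈ part 0
  mul_mem : ∀ {r s : ZMod 2} {a b : A}, a ∈ part r → b ∈ part s → a * b ∈ part (r + s)

section SuperSpace

variable (k : Type v) [Field k] {V : Type u} [AddCommGroup V] [Module k V] [SuperSpace k V]

/-- `part k V r` is the space of homogeneous vectors of parity `r` of the superspace `V`. -/
abbrev part (V : Type u) [AddCommGroup V] [Module k V] [SuperSpace k V] (r : ZMod 2) :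
    Submodule k V :=
  SuperSpace.part r

/-- The projection of `V = V₀ ⊕ V₁` onto its part of parity `r`. -/
def proj (r : ZMod 2) : V →ₗ[k] V :=
  if r = 0 then (part k V 0).projection (part k V 1) SuperSpace.isCompl
  else (part k V 1).projection (part k V 0) SuperSpace.isCompl.symm

/-- The linear map `V → V` with `v ↦ (-1)^{r v̄} v` for homogeneous `v`
(see `twist_of_mem`). -/
def twist (r : ZMod 2) : V →ₗ[k] V :=
  proj k 0 + sgn k r • proj k 1

end SuperSpace

lemma zmod2_cases (r : ZMod 2) : r = 0 ∨ r = 1 := by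
  fin_cases r
  · exact Or.inl rfl
  · exact Or.inr rfl

@[simp] lemma zmod2_one_add_one : (1 : ZMod 2) + 1 = 0 := rfl

lemma zmod2_add_self (r : ZMod 2) : r + r = 0 := by
  fin_cases r <;> rfl

lemma zmod2_sum {M : Type u} [AddCommMonoid M] (f : ZMod 2 → M) : ∑ r, f r = f 0 + f 1 :=
  Fin.sum_univ_two f

@[simp] lemma sgn_zero (k : Type v) [Ring k] : sgn k 0 = 1 := by simp [sgn]

@[simp] lemma sgn_one (k : Type v) [Ring k] : sgn k 1 = -1 := by
  have : (1 : ZMod 2).val = 1 := rfl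
  simp [sgn, this]

lemma sgn_add (k : Type v) [Ring k] (r s : ZMod 2) : sgn k (r + s) = sgn k r * sgn k s := by
  rcases zmod2_cases r with rfl | rfl <;> rcases zmod2_cases s with rfl | rfl <;> simp

lemma sgn_mul_self (k : Type v) [Ring k] (r : ZMod 2) : sgn k r * sgn k r = 1 := by
  rcases zmod2_cases r with rfl | rfl <;> simp

section SuperSpaceLemmas

variable {k : Type v} [Field k] {V : Type u} [AddCommGroup V] [Module k V] [SuperSpace k V]

lemma proj_mem (r : ZMod 2) (x : V) : proj k r x ∈ part k V r := by
  rcases zmod2_cases r with rfl | rfl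
  · simp [proj]
  · simp [proj]

lemma proj_of_mem {r : ZMod 2} {x : V} (hx : x ∈ part k V r) (s : ZMod 2) :
    proj k s x = if s = r then x else 0 := by
  rcases zmod2_cases r with rfl | rfl <;> rcases zmod2_cases s with rfl | rfl
  · simp [proj, hx]
  · simp [proj, hx]
  · simp [proj, hx]
  · simp [proj, hx]

lemma proj_add_proj (x : V) : proj k 0 x + proj k 1 x = x := by
  have h : x ∈ part k V 0 ⊔ part k V 1 := by
    rw [SuperSpace.isCompl.sup_eq_top]; trivial
  obtain ⟨y, hy, z, hz, rfl⟩ := Submodule.mem_sup.1 h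
  simp [proj_of_mem hy, proj_of_mem hz]

lemma twist_of_mem {s : ZMod 2} {x : V} (hx : x ∈ part k V s) (r : ZMod 2) :
    twist k r x = sgn k (r * s) • x := by
  rcases zmod2_cases s with rfl | rfl <;> simp [twist, proj_of_mem hx]

lemma twist_mem {s : ZMod 2} {x : V} (hx : x ∈ part k V s) (r : ZMod 2) :
    twist k r x ∈ part k V s := by
  rw [twist_of_mem hx]
  exact Submodule.smul_mem _ _ hx

/-- To check an identity between additive maps it suffices to look at homogeneous vectors. -/
lemma hom_induction {P : V → Prop} (hadd : ∀ x y, P x → P y → P (x + y))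
    (hhom : ∀ r x, x ∈ part k V r → P x) (x : V) : P x := by
  rw [← proj_add_proj (k := k) x]
  exact hadd _ _ (hhom 0 _ (proj_mem 0 x)) (hhom 1 _ (proj_mem 1 x))

variable (k V) in
@[simp] lemma twist_zero : (twist k 0 : V →ₗ[k] V) = LinearMap.id := by
  ext x; simp [twist, proj_add_proj]

lemma twist_twist (r : ZMod 2) (x : V) : twist k r (twist k r x) = x := by
  refine hom_induction (k := k) (P := fun x => twist k r (twist k r x) = x) ?_ ?_ x
  · intro x y hx hy
    simp [hx, hy]
  · intro s x hx
    simp [twist_of_mem hx, smul_smul, sgn_mul_self]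

/-- A convenient way to produce a decomposition `V = V₀ ⊕ V₁`. -/
lemma isCompl_of {W : Type u} [AddCommGroup W] [Module k W] {p q : Submodule k W}
    (hdis : ∀ x, x ∈ p → x ∈ q → x = 0) (hsum : ∀ x, ∃ y ∈ p, ∃ z ∈ q, y + z = x) :
    IsCompl p q :=
  ⟨Submodule.disjoint_def.2 hdis,
    codisjoint_iff.2 (eq_top_iff.2 fun x _ => Submodule.mem_sup.2 (hsum x))⟩

end SuperSpaceLemmas

section TensorSuper

variable (k : Type v) [Field k] (V : Type u) [AddCommGroup V] [Module k V] [SuperSpace k V]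
  (W : Type w) [AddCommGroup W] [Module k W] [SuperSpace k W]

/-- The part of parity `r` of `V ⊗ W`: the sum of the `V_s ⊗ W_t` with `s + t = r`. -/
def tensorPart (r : ZMod 2) : Submodule k (V ⊗[k] W) :=
  Submodule.span k {x | ∃ s t : ZMod 2, s + t = r ∧ ∃ a ∈ part k V s, ∃ b ∈ part k W t,
    x = a ⊗ₜ[k] b}

variable {k V W}

lemma tmul_mem_tensorPart {r s t : ZMod 2} {a : V} {b : W} (ha : a ∈ part k V s)
    (hb : b ∈ part k W t) (h : s + t = r) : a ⊗ₜ[k] b ∈ tensorPart k V W r :=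
  Submodule.subset_span ⟨s, t, h, a, ha, b, hb, rfl⟩

variable (k V W) in
/-- The projection of `V ⊗ W` onto its part of parity `r`. -/
def tensorProj (r : ZMod 2) : V ⊗[k] W →ₗ[k] V ⊗[k] W :=
  ∑ s, TensorProduct.map (proj k s) (proj k (s + r))

lemma tensorProj_of_mem {r s : ZMod 2} {x : V ⊗[k] W} (hx : x ∈ tensorPart k V W r) :
    tensorProj k V W s x = if s = r then x else 0 := by
  induction hx using Submodule.span_induction with
  | mem x hx =>
    obtain ⟨a, b, rfl, y, hy, z, hz, rfl⟩ := hx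
    simp only [tensorProj, zmod2_sum, LinearMap.add_apply, TensorProduct.map_tmul,
      proj_of_mem hy, proj_of_mem hz]
    rcases zmod2_cases a with rfl | rfl <;> rcases zmod2_cases b with rfl | rfl <;>
      rcases zmod2_cases s with rfl | rfl <;> simp
  | zero => simp
  | add x y _ _ hx hy => rw [map_add, hx, hy]; split_ifs <;> simp
  | smul c x _ hx => rw [map_smul, hx]; split_ifs <;> simp

instance tensorSuperSpace : SuperSpace k (V ⊗[k] W) where
  part := tensorPart k V W
  isCompl := isCompl_of
    (fun x h0 h1 => by
      have e0 := tensorProj_of_mem (s := 0) h0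
      have e1 := tensorProj_of_mem (s := 0) h1
      simp only [if_true] at e0
      rw [← e0, e1]; simp)
    (fun x => by
      induction x using TensorProduct.induction_on with
      | zero => exact ⟨0, zero_mem _, 0, zero_mem _, by simp⟩
      | tmul a b =>
        refine ⟨proj k 0 a ⊗ₜ proj k 0 b + proj k 1 a ⊗ₜ proj k 1 b, ?_,
          proj k 0 a ⊗ₜ proj k 1 b + proj k 1 a ⊗ₜ proj k 0 b, ?_, ?_⟩
        · exact add_mem (tmul_mem_tensorPart (proj_mem 0 a) (proj_mem 0 b) (by simp))
            (tmul_mem_tensorPart (proj_mem 1 a) (proj_mem 1 b) (by simp))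
        · exact add_mem (tmul_mem_tensorPart (proj_mem 0 a) (proj_mem 1 b) (by simp))
            (tmul_mem_tensorPart (proj_mem 1 a) (proj_mem 0 b) (by simp))
        · conv_rhs => rw [← proj_add_proj (k := k) a, ← proj_add_proj (k := k) b]
          simp only [TensorProduct.add_tmul, TensorProduct.tmul_add]
          abel
      | add x y hx hy =>
        obtain ⟨a, ha, b, hb, rfl⟩ := hx
        obtain ⟨c, hc, d, hd, rfl⟩ := hy
        exact ⟨a + c, add_mem ha hc, b + d, add_mem hb hd, by abel⟩)

lemma tmul_mem {s t : ZMod 2} {a : V} {b : W} (ha : a ∈ part k V s)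
    (hb : b ∈ part k W t) : a ⊗ₜ[k] b ∈ part k (V ⊗[k] W) (s + t) :=
  tmul_mem_tensorPart ha hb rfl

end TensorSuper

/-! ## Supercategories -/

/-- A supercategory: a `k`-linear category whose morphism spaces are superspaces, such that
composition preserves parity. -/
class Supercategory (k : Type w) [Field k] (C : Type u) [Category.{v} C] [Preadditive C]
    [Linear k C] where
  /-- the morphisms `X ⟶ Y` of parity `r` -/
  homPart : ∀ X Y : C, ZMod 2 → Submodule k (X ⟶ Y)
  homPart_isCompl : ∀ X Y : C, IsCompl (homPart X Y 0) (homPart X Y 1)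
  id_mem : ∀ X : C, 𝟙 X ∈ homPart X X 0
  comp_mem : ∀ {X Y Z : C} {f : X ⟶ Y} {g : Y ⟶ Z} {r s : ZMod 2},
    f ∈ homPart X Y r → g ∈ homPart Y Z s → f ≫ g ∈ homPart X Z (r + s)

/-- A strict monoidal supercategory.  The tensor product of morphisms is bilinear, preserves
parity and satisfies the super interchange law
`(f' ⊗ g) ∘ (f ⊗ g') = (-1)^{f̄ ḡ} (f' ∘ f) ⊗ (g ∘ g')`; associativity and unitality hold as
equalities.  Here `f ≫ g` denotes `f` followed by `g`. -/
class StrictMonoidalSupercategory (k : Type w) [Field k] (C : Type u) [Category.{v} C]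
    [Preadditive C] [Linear k C] [Supercategory k C] where
  one : C
  tensorObj : C → C → C
  tensorHom : ∀ {X Y X' Y' : C}, (X ⟶ Y) →ₗ[k] (X' ⟶ Y') →ₗ[k] (tensorObj X X' ⟶ tensorObj Y Y')
  tensorHom_mem : ∀ {X Y X' Y' : C} {f : X ⟶ Y} {g : X' ⟶ Y'} {r s : ZMod 2},
    f ∈ Supercategory.homPart (k := k) X Y r → g ∈ Supercategory.homPart (k := k) X' Y' s →
      tensorHom f g ∈ Supercategory.homPart (k := k) (tensorObj X X') (tensorObj Y Y') (r + s)
  tensorHom_id : ∀ X Y : C, tensorHom (𝟙 X) (𝟙 Y) = 𝟙 (tensorObj X Y)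
  interchange : ∀ {X Y Z X' Y' Z' : C} {f : X ⟶ Y} (f' : Y ⟶ Z) (g' : X' ⟶ Y') {g : Y' ⟶ Z'}
    {r s : ZMod 2}, f ∈ Supercategory.homPart (k := k) X Y r →
    g ∈ Supercategory.homPart (k := k) Y' Z' s →
      tensorHom f g' ≫ tensorHom f' g = sgn k (r * s) • tensorHom (f ≫ f') (g' ≫ g)
  tensor_assoc : ∀ X Y Z : C, tensorObj (tensorObj X Y) Z = tensorObj X (tensorObj Y Z)
  one_tensor : ∀ X : C, tensorObj one X = X
  tensor_one : ∀ X : C, tensorObj X one = X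
  tensorHom_assoc : ∀ {X Y X' Y' X'' Y'' : C} (f : X ⟶ Y) (g : X' ⟶ Y') (h : X'' ⟶ Y''),
    tensorHom (tensorHom f g) h =
      eqToHom (tensor_assoc X X' X'') ≫ tensorHom f (tensorHom g h) ≫
        eqToHom (tensor_assoc Y Y' Y'').symm
  one_tensorHom : ∀ {X Y : C} (f : X ⟶ Y),
    tensorHom (𝟙 one) f = eqToHom (one_tensor X) ≫ f ≫ eqToHom (one_tensor Y).symm
  tensorHom_one : ∀ {X Y : C} (f : X ⟶ Y),
    tensorHom f (𝟙 one) = eqToHom (tensor_one X) ≫ f ≫ eqToHom (tensor_one Y).symm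

section Superfunctors

variable (k : Type w) [Field k]
  (C : Type u₁) [Category.{v₁} C] [Preadditive C] [Linear k C] [Supercategory k C]
  (D : Type u₂) [Category.{v₂} D] [Preadditive D] [Linear k D] [Supercategory k D]

/-- A superfunctor: a functor which is linear and parity preserving on morphism spaces. -/
structure Superfunctor extends C ⥤ D where
  map_add : ∀ {X Y : C} (f g : X ⟶ Y), map (f + g) = map f + map g
  map_smul : ∀ {X Y : C} (c : k) (f : X ⟶ Y), map (c • f) = c • map f
  map_mem : ∀ {X Y : C} {f : X ⟶ Y} {r : ZMod 2}, f ∈ Supercategory.homPart (k := k) X Y r →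
    map f ∈ Supercategory.homPart (k := k) (obj X) (obj Y) r

variable {k C D}

/-- The supernatural transformations `F ⇒ G` of parity `r`: families of morphisms `α_X` of
parity `r` with `G f ∘ α_X = (-1)^{r f̄} α_Y ∘ F f` for homogeneous `f : X ⟶ Y`. -/
def supernat (F G : Superfunctor k C D) (r : ZMod 2) :
    Submodule k (∀ X : C, F.obj X ⟶ G.obj X) where
  carrier := {α | (∀ X, α X ∈ Supercategory.homPart (k := k) (F.obj X) (G.obj X) r) ∧
    ∀ (X Y : C) (f : X ⟶ Y) (s : ZMod 2), f ∈ Supercategory.homPart (k := k) X Y s →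
      α X ≫ G.map f = sgn k (r * s) • (F.map f ≫ α Y)}
  zero_mem' := ⟨fun X => zero_mem _, fun X Y f s _ => by simp⟩
  add_mem' := fun {a b} ha hb => ⟨fun X => add_mem (ha.1 X) (hb.1 X), fun X Y f s hf => by
    simp [ha.2 X Y f s hf, hb.2 X Y f s hf]⟩
  smul_mem' := fun c a ha => ⟨fun X => Submodule.smul_mem _ c (ha.1 X), fun X Y f s hf => by
    simp [ha.2 X Y f s hf, smul_smul, mul_comm]⟩

/-- The superspace of supernatural transformations `F ⇒ G`: the families `α = α₀ + α₁` with
`α_r` supernatural of parity `r`. -/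
def SuperNatTrans (F G : Superfunctor k C D) : Submodule k (∀ X : C, F.obj X ⟶ G.obj X) :=
  supernat F G 0 ⊔ supernat F G 1

lemma supernat_le (F G : Superfunctor k C D) (r : ZMod 2) :
    supernat F G r ≤ SuperNatTrans F G := by
  rcases zmod2_cases r with rfl | rfl
  · exact le_sup_left
  · exact le_sup_right

lemma superNatTrans_induction {F G : Superfunctor k C D}
    {P : (∀ X : C, F.obj X ⟶ G.obj X) → Prop} (hadd : ∀ α β, P α → P β → P (α + β))
    (hhom : ∀ r, ∀ α ∈ supernat F G r, P α) (α : ∀ X : C, F.obj X ⟶ G.obj X)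
    (hα : α ∈ SuperNatTrans F G) : P α := by
  obtain ⟨a, ha, b, hb, rfl⟩ := Submodule.mem_sup.1 hα
  exact hadd _ _ (hhom 0 a ha) (hhom 1 b hb)

lemma supernat_id (F : Superfunctor k C D) : (fun X => 𝟙 (F.obj X)) ∈ supernat F F 0 :=
  ⟨fun X => Supercategory.id_mem _, fun X Y f s _ => by simp⟩

lemma supernat_comp {F G H : Superfunctor k C D} {r s : ZMod 2}
    {α : ∀ X : C, F.obj X ⟶ G.obj X} {β : ∀ X : C, G.obj X ⟶ H.obj X}
    (hα : α ∈ supernat F G r) (hβ : β ∈ supernat G H s) :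
    (fun X => α X ≫ β X) ∈ supernat F H (r + s) :=
  ⟨fun X => Supercategory.comp_mem (hα.1 X) (hβ.1 X), fun X Y f t hf => by
    rw [Category.assoc, hβ.2 X Y f t hf, Linear.comp_smul, ← Category.assoc, hα.2 X Y f t hf,
      Linear.smul_comp, smul_smul, Category.assoc, add_mul, sgn_add, mul_comm]⟩

lemma superNatTrans_comp {F G H : Superfunctor k C D}
    {α : ∀ X : C, F.obj X ⟶ G.obj X} {β : ∀ X : C, G.obj X ⟶ H.obj X}
    (hα : α ∈ SuperNatTrans F G) (hβ : β ∈ SuperNatTrans G H) :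
    (fun X => α X ≫ β X) ∈ SuperNatTrans F H := by
  refine superNatTrans_induction (P := fun α => (fun X => α X ≫ β X) ∈ SuperNatTrans F H)
    ?_ ?_ α hα
  · intro α α' h h'
    convert add_mem h h' using 1
    funext X
    simp
  · intro r α hα
    refine superNatTrans_induction (P := fun β => (fun X => α X ≫ β X) ∈ SuperNatTrans F H)
      ?_ ?_ β hβ
    · intro β β' h h'
      convert add_mem h h' using 1
      funext X
      simp
    · intro s β hβ
      exact supernat_le _ _ _ (supernat_comp hα hβ)

end Superfunctors

section EndCategory

variable (k : Type w) [Field k]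
  (C : Type u₁) [Category.{v₁} C] [Preadditive C] [Linear k C] [Supercategory k C]

/-- The strict monoidal supercategory of superfunctors `C → C` and supernatural
transformations (the structure is given by the instances below). -/
abbrev SEnd : Type _ := Superfunctor k C C

variable {k C}

/-- The identity superfunctor. -/
def superId : Superfunctor k C C where
  toFunctor := 𝟭 C
  map_add := fun _ _ => rfl
  map_smul := fun _ _ => rfl
  map_mem := fun h => h

/-- The composite `F ∘ G` of superfunctors (apply `G` first). -/
def superComp (F G : Superfunctor k C C) : Superfunctor k C C where
  toFunctor := G.toFunctor ⋙ F.toFunctor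
  map_add := fun f g => by simp [G.map_add, F.map_add]
  map_smul := fun c f => by simp [G.map_smul, F.map_smul]
  map_mem := fun h => F.map_mem (G.map_mem h)

instance : Category (SEnd k C) where
  Hom F G := SuperNatTrans F G
  id F := ⟨fun X => 𝟙 (F.obj X), supernat_le _ _ _ (supernat_id F)⟩
  comp α β := ⟨fun X => α.1 X ≫ β.1 X, superNatTrans_comp α.2 β.2⟩
  id_comp _ := Subtype.ext (funext fun _ => Category.id_comp _)
  comp_id _ := Subtype.ext (funext fun _ => Category.comp_id _)
  assoc _ _ _ := Subtype.ext (funext fun _ => Category.assoc _ _ _)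

instance : Preadditive (SEnd k C) where
  homGroup F G := inferInstanceAs (AddCommGroup (SuperNatTrans F G))
  add_comp _ _ _ _ _ _ := Subtype.ext (funext fun _ => Preadditive.add_comp _ _ _ _ _ _)
  comp_add _ _ _ _ _ _ := Subtype.ext (funext fun _ => Preadditive.comp_add _ _ _ _ _ _)

instance : Linear k (SEnd k C) where
  homModule F G := inferInstanceAs (Module k (SuperNatTrans F G))
  smul_comp _ _ _ _ _ _ := Subtype.ext (funext fun _ => Linear.smul_comp _ _ _ _ _ _)
  comp_smul _ _ _ _ _ _ := Subtype.ext (funext fun _ => Linear.comp_smul _ _ _ _ _ _)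

/-- The component at `X` of a supernatural transformation. -/
def SEnd.app {F G : SEnd k C} (α : F ⟶ G) (X : C) : F.obj X ⟶ G.obj X := α.1 X

lemma SEnd.hom_ext {F G : SEnd k C} {α β : F ⟶ G} (h : ∀ X, SEnd.app α X = SEnd.app β X) :
    α = β :=
  Subtype.ext (funext h)

instance : Supercategory k (SEnd k C) where
  homPart F G r := (supernat F G r).comap (SuperNatTrans F G).subtype
  homPart_isCompl F G := isCompl_of
    (fun α h0 h1 => SEnd.hom_ext fun X =>
      Submodule.disjoint_def.1 (Supercategory.homPart_isCompl (k := k) _ _).disjoint _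
        (h0.1 X) (h1.1 X))
    (fun α => by
      obtain ⟨a, ha, b, hb, h⟩ := Submodule.mem_sup.1 α.2
      exact ⟨⟨a, supernat_le _ _ _ ha⟩, ha, ⟨b, supernat_le _ _ _ hb⟩, hb, Subtype.ext h⟩)
  id_mem F := supernat_id F
  comp_mem h h' := supernat_comp h h'

lemma supernat_hcomp {F F' G G' : Superfunctor k C C} {r s : ZMod 2}
    {α : ∀ X : C, F.obj X ⟶ F'.obj X} {β : ∀ X : C, G.obj X ⟶ G'.obj X}
    (hα : α ∈ supernat F F' r) (hβ : β ∈ supernat G G' s) :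
    (fun X => F.map (β X) ≫ α (G'.obj X)) ∈ supernat (superComp F G) (superComp F' G') (r + s) :=
  ⟨fun X => by
    rw [add_comm]
    exact Supercategory.comp_mem (F.map_mem (hβ.1 X)) (hα.1 _), fun X Y f t hf => by
    have h1 := hα.2 _ _ _ t (G'.map_mem hf)
    have h2 := congrArg (fun φ => F.map φ) (hβ.2 X Y f t hf)
    simp only [Functor.map_comp, F.map_smul] at h2
    simp only [superComp, Functor.comp_map, Functor.comp_obj, Category.assoc]
    rw [h1, Linear.comp_smul, ← Category.assoc, h2, Linear.smul_comp, smul_smul, Category.assoc,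
      add_mul, sgn_add]
    rfl⟩

lemma superNatTrans_hcomp {F F' G G' : Superfunctor k C C}
    {α : ∀ X : C, F.obj X ⟶ F'.obj X} {β : ∀ X : C, G.obj X ⟶ G'.obj X}
    (hα : α ∈ SuperNatTrans F F') (hβ : β ∈ SuperNatTrans G G') :
    (fun X => F.map (β X) ≫ α (G'.obj X)) ∈
      SuperNatTrans (superComp F G) (superComp F' G') := by
  refine superNatTrans_induction (P := fun α => (fun X => F.map (β X) ≫ α (G'.obj X)) ∈
    SuperNatTrans (superComp F G) (superComp F' G')) ?_ ?_ α hα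
  · intro α α' h h'
    have e : (fun X => F.map (β X) ≫ (α + α') (G'.obj X)) =
        (fun X => F.map (β X) ≫ α (G'.obj X)) + fun X => F.map (β X) ≫ α' (G'.obj X) :=
      funext fun X => Preadditive.comp_add _ _ _ _ _ _
    rw [e]
    exact add_mem h h'
  · intro r α hα
    refine superNatTrans_induction (P := fun β => (fun X => F.map (β X) ≫ α (G'.obj X)) ∈
      SuperNatTrans (superComp F G) (superComp F' G')) ?_ ?_ β hβ
    · intro β β' h h'
      have e : (fun X => F.map ((β + β') X) ≫ α (G'.obj X)) =
          (fun X => F.map (β X) ≫ α (G'.obj X)) + fun X => F.map (β' X) ≫ α (G'.obj X) :=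
        funext fun X => by simp [F.map_add]
      rw [e]
      exact add_mem h h'
    · intro s β hβ
      exact supernat_le _ _ _ (supernat_hcomp hα hβ)

/-- The horizontal composite `α ⊗ β = (α ⊗ 1) ∘ (1 ⊗ β)` of supernatural transformations
`α : F ⇒ F'` and `β : G ⇒ G'`, with components `α_{G' X} ∘ F (β_X) : F (G X) ⟶ F' (G' X)`. -/
def hcomp {F F' G G' : SEnd k C} : (F ⟶ F') →ₗ[k] (G ⟶ G') →ₗ[k]
    (superComp F G ⟶ superComp F' G') :=
  LinearMap.mk₂ k (fun α β => ⟨fun X => F.map (β.1 X) ≫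
      α.1 (G'.obj X), superNatTrans_hcomp α.2 β.2⟩)
    (fun _ _ _ => Subtype.ext (funext fun _ => Preadditive.comp_add _ _ _ _ _ _))
    (fun _ _ _ => Subtype.ext (funext fun _ => Linear.comp_smul _ _ _ _ _ _))
    (fun α β β' => Subtype.ext (funext fun X =>
      (congrArg (fun φ => φ ≫ α.1 (G'.obj X)) (F.map_add (β.1 X) (β'.1 X))).trans
        (Preadditive.add_comp _ _ _ _ _ _)))
    (fun c α β => Subtype.ext (funext fun X =>
      (congrArg (fun φ => φ ≫ α.1 (G'.obj X)) (F.map_smul c (β.1 X))).trans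
        (Linear.smul_comp _ _ _ _ _ _)))

lemma eq_eqToHom_comp {D : Type u₂} [Category.{v₂} D] {X X' Y Y' : D} (h : X = X') (h' : Y = Y')
    {f : X ⟶ Y} {g : X' ⟶ Y'} (hfg : HEq f g) :
    f = eqToHom h ≫ g ≫ eqToHom h'.symm := by
  subst h h'
  simpa using hfg

instance : StrictMonoidalSupercategory k (SEnd k C) where
  one := superId
  tensorObj F G := superComp F G
  tensorHom := hcomp
  tensorHom_mem hα hβ := supernat_hcomp hα hβ
  tensorHom_id F G := Subtype.ext (funext fun X => by
    change F.map (𝟙 _) ≫ 𝟙 _ = 𝟙 _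
    simp)
  interchange := fun {F F' F'' G G' G''} {α} α' β' {β} {r s} hα hβ =>
    Subtype.ext (funext fun X => by
      change (F.map (β'.1 X) ≫ α.1 _) ≫ (F'.map (β.1 X) ≫ α'.1 _) =
        sgn k (r * s) • (F.map (β'.1 X ≫ β.1 X) ≫ α.1 _ ≫ α'.1 _)
      have h := hα.2 _ _ _ s (hβ.1 X)
      have h' : α.1 _ ≫ F'.map (β.1 X) = sgn k (r * s) • (F.map (β.1 X) ≫ α.1 _) := h
      rw [Category.assoc, ← Category.assoc (α.1 _), h']
      simp)
  tensor_assoc F G H := rfl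
  one_tensor F := rfl
  tensor_one F := rfl
  tensorHom_assoc {F F' G G' H H'} α β γ := eq_eqToHom_comp rfl rfl (heq_of_eq
    (Subtype.ext (funext fun X => by
      change F.map (G.map (γ.1 X)) ≫ F.map (β.1 _) ≫ α.1 _ =
        F.map (G.map (γ.1 X) ≫ β.1 _) ≫ α.1 _
      simp)))
  one_tensorHom {F G} α := eq_eqToHom_comp rfl rfl (heq_of_eq (Subtype.ext (funext fun X => by
    change α.1 X ≫ 𝟙 _ = α.1 X
    simp)))
  tensorHom_one {F G} α := eq_eqToHom_comp rfl rfl (heq_of_eq (Subtype.ext (funext fun X => by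
    change F.map (𝟙 _) ≫ α.1 X = α.1 X
    simp)))

end EndCategory

/-- A strict monoidal superfunctor between strict monoidal supercategories: a monoidal
superfunctor all of whose coherence maps `Ψ(X) ⊗ Ψ(Y) ⟶ Ψ(X ⊗ Y)` and `1 ⟶ Ψ(1)` are
identities. -/
structure StrictMonoidalSuperfunctor (k : Type w) [Field k]
    (C : Type u₁) [Category.{v₁} C] [Preadditive C] [Linear k C] [Supercategory k C]
    [StrictMonoidalSupercategory k C]
    (D : Type u₂) [Category.{v₂} D] [Preadditive D] [Linear k D] [Supercategory k D]
    [StrictMonoidalSupercategory k D] extends Superfunctor k C D where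
  obj_one : obj (StrictMonoidalSupercategory.one k) = StrictMonoidalSupercategory.one k
  obj_tensor : ∀ X Y : C, obj (StrictMonoidalSupercategory.tensorObj k X Y) =
    StrictMonoidalSupercategory.tensorObj k (obj X) (obj Y)
  map_tensor : ∀ {X Y X' Y' : C} (f : X ⟶ Y) (g : X' ⟶ Y'),
    map (StrictMonoidalSupercategory.tensorHom (k := k) f g) =
      eqToHom (obj_tensor X X') ≫
        StrictMonoidalSupercategory.tensorHom (k := k) (map f) (map g) ≫
          eqToHom (obj_tensor Y Y').symm

section Transport

variable {k : Type w} [Field k]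
  {C : Type u₁} [Category.{v₁} C] [Preadditive C] [Linear k C] [Supercategory k C]
  [StrictMonoidalSupercategory k C]
  {D : Type u₂} [Category.{v₂} D] [Preadditive D] [Linear k D] [Supercategory k D]
  [StrictMonoidalSupercategory k D]

lemma StrictMonoidalSuperfunctor.tensor_eq (Ψ : StrictMonoidalSuperfunctor k C D) {X Y : C}
    {P Q : D} (hX : Ψ.obj X = P) (hY : Ψ.obj Y = Q) :
    Ψ.obj (StrictMonoidalSupercategory.tensorObj k X Y) =
      StrictMonoidalSupercategory.tensorObj k P Q := by
  rw [Ψ.obj_tensor, hX, hY]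

/-- The morphism `Ψ(f) : Ψ(X) ⟶ Ψ(Y)`, regarded as a morphism `P ⟶ Q` when the values of `Ψ` on
objects are `Ψ(X) = P` and `Ψ(Y) = Q`. -/
def StrictMonoidalSuperfunctor.mapAs (Ψ : StrictMonoidalSuperfunctor k C D) {X Y : C} {P Q : D}
    (hX : Ψ.obj X = P) (hY : Ψ.obj Y = Q) (f : X ⟶ Y) : P ⟶ Q :=
  eqToHom hX.symm ≫ Ψ.map f ≫ eqToHom hY

end Transport

/-! ## Supermodules over a Lie superalgebra -/

section SMod

/-- The superbracket of a superalgebra, `[M, N] = M N - (-1)^{M̄ N̄} N M` for homogeneous `M`, `N`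
(see `superBracket_of_mem`), extended by linearity. -/
def superBracket (k : Type v) [Field k] (G : Type w) [Ring G] [Algebra k G] [Superalgebra k G] :
    G →ₗ[k] G →ₗ[k] G :=
  LinearMap.mul k G - ∑ r, ((LinearMap.mul k G).compl₁₂ (twist k r) (proj k r)).flip

lemma sum_proj_of_mem {k : Type v} [Field k] {V : Type u} [AddCommGroup V] [Module k V]
    [SuperSpace k V] {M : Type w} [AddCommMonoid M] {r : ZMod 2} {x : V} (hx : x ∈ part k V r)
    (f : ZMod 2 → V → M) (h0 : ∀ s, f s 0 = 0) : ∑ s, f s (proj k s x) = f r x := by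
  rw [Finset.sum_eq_single r]
  · simp [proj_of_mem hx]
  · intro s _ hs
    simp [proj_of_mem hx, hs, h0]
  · simp

lemma superBracket_of_mem {k : Type v} [Field k] {G : Type w} [Ring G] [Algebra k G]
    [Superalgebra k G] {r s : ZMod 2} {M N : G} (hM : M ∈ part k G r) (hN : N ∈ part k G s) :
    superBracket k G M N = M * N - sgn k (r * s) • (N * M) := by
  have h := sum_proj_of_mem hM (fun r' x => twist k r' N * x) (fun s => by simp)
  simp only [superBracket, LinearMap.sub_apply, LinearMap.sum_apply, LinearMap.flip_apply,
    LinearMap.compl₁₂_apply, LinearMap.mul_apply', h]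
  rw [twist_of_mem hN, smul_mul_assoc]

variable (k : Type v) [Field k] (G : Type w) [Ring G] [Algebra k G] [Superalgebra k G]

/-- Right supermodules over the Lie superalgebra `(G, [·, ·])` associated to a superalgebra `G`;
`act w M` is `w · M`. -/
structure SMod where
  carrier : Type u
  [addCommGroup : AddCommGroup carrier]
  [module : Module k carrier]
  [superSpace : SuperSpace k carrier]
  act : carrier →ₗ[k] G →ₗ[k] carrier
  act_mem : ∀ {r s : ZMod 2} {x : carrier} {M : G}, x ∈ part k carrier r → M ∈ part k G s →
    act x M ∈ part k carrier (r + s)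
  act_bracket : ∀ {r s : ZMod 2} (x : carrier) {M N : G}, M ∈ part k G r → N ∈ part k G s →
    act x (superBracket k G M N) = act (act x M) N - sgn k (r * s) • act (act x N) M

attribute [instance] SMod.addCommGroup SMod.module SMod.superSpace

variable {k G}

/-- The space of all morphisms of right supermodules (even, odd and mixed): the linear maps `f`
with `f (x · M) = f x · M`. -/
def SMod.homs (V W : SMod.{w, v, u} k G) : Submodule k (V.carrier →ₗ[k] W.carrier) where
  carrier := {f | ∀ x M, f (V.act x M) = W.act (f x) M}
  zero_mem' := fun x M => by simp
  add_mem' := fun hf hg x M => by simp [hf x M, hg x M]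
  smul_mem' := fun c f hf x M => by simp [hf x M]

instance : Category (SMod.{w, v, u} k G) where
  Hom V W := SMod.homs V W
  id V := ⟨LinearMap.id, fun _ _ => rfl⟩
  comp f g := ⟨g.1 ∘ₗ f.1, fun x M => by simp [f.2 x M, g.2 _ M]⟩

instance : Preadditive (SMod.{w, v, u} k G) where
  homGroup V W := inferInstanceAs (AddCommGroup (SMod.homs V W))
  add_comp _ _ _ _ _ h := Subtype.ext (LinearMap.comp_add _ _ h.1)
  comp_add _ _ _ f _ _ := Subtype.ext (LinearMap.add_comp f.1 _ _)

instance : Linear k (SMod.{w, v, u} k G) where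
  homModule V W := inferInstanceAs (Module k (SMod.homs V W))
  smul_comp _ _ _ _ _ _ := Subtype.ext (LinearMap.comp_smul _ _ _)
  comp_smul _ _ _ _ _ _ := Subtype.ext (LinearMap.smul_comp _ _ _)

/-- The linear map underlying a morphism of supermodules. -/
def SMod.toLin {V W : SMod.{w, v, u} k G} (f : V ⟶ W) : V.carrier →ₗ[k] W.carrier := f.1

/-- The linear maps `V → W` of parity `r`. -/
def linPart (k : Type v) [Field k] (V : Type u) [AddCommGroup V] [Module k V] [SuperSpace k V]
    (W : Type w) [AddCommGroup W] [Module k W] [SuperSpace k W] (r : ZMod 2) :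
    Submodule k (V →ₗ[k] W) where
  carrier := {f | ∀ s, ∀ x ∈ part k V s, f x ∈ part k W (s + r)}
  zero_mem' := fun _ _ _ => zero_mem _
  add_mem' := fun hf hg s x hx => add_mem (hf s x hx) (hg s x hx)
  smul_mem' := fun c _ hf s x hx => Submodule.smul_mem _ c (hf s x hx)

lemma SMod.proj_act (W : SMod.{w, v, u} k G) (c : ZMod 2) (y : W.carrier) {b : ZMod 2} {M : G}
    (hM : M ∈ part k G b) : proj k (c + b) (W.act y M) = W.act (proj k c y) M := by
  refine hom_induction (k := k)
    (P := fun y => proj k (c + b) (W.act y M) = W.act (proj k c y) M) ?_ ?_ y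
  · intro x y hx hy
    simp only [map_add, LinearMap.add_apply, hx, hy]
  · intro d y hy
    rw [proj_of_mem (W.act_mem hy hM), proj_of_mem hy]
    simp only [add_left_inj]
    split_ifs <;> simp

/-- The component of parity `r` of a morphism of supermodules. -/
def SMod.homComp {V W : SMod.{w, v, u} k G} (f : SMod.homs V W) (r : ZMod 2) : SMod.homs V W :=
  ⟨∑ s, proj k (s + r) ∘ₗ f.1 ∘ₗ proj k s, fun x M => by
    set F : V.carrier →ₗ[k] W.carrier := ∑ s, proj k (s + r) ∘ₗ f.1 ∘ₗ proj k s with hF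
    have h1 : ∀ {a : ZMod 2} {x : V.carrier}, x ∈ part k V.carrier a →
        F x = proj k (a + r) (f.1 x) := by
      intro a x hx
      simp only [hF, LinearMap.sum_apply, LinearMap.comp_apply]
      exact sum_proj_of_mem hx (fun s y => proj k (s + r) (f.1 y)) (fun s => by simp)
    refine hom_induction (k := k) (P := fun x => F (V.act x M) = W.act (F x) M) ?_ ?_ x
    · intro x y hx hy
      simp only [map_add, LinearMap.add_apply, hx, hy]
    · intro a x hx
      refine hom_induction (k := k) (P := fun M => F (V.act x M) = W.act (F x) M) ?_ ?_ M
      · intro M N hM hN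
        simp only [map_add, hM, hN]
      · intro b M hM
        rw [h1 hx, h1 (V.act_mem hx hM), f.2, add_right_comm, W.proj_act _ _ hM]⟩

lemma SMod.homComp_mem {V W : SMod.{w, v, u} k G} (f : SMod.homs V W) (r : ZMod 2) :
    (SMod.homComp f r).1 ∈ linPart k V.carrier W.carrier r := by
  intro a x hx
  have : (SMod.homComp f r).1 x = proj k (a + r) (f.1 x) := by
    simp only [SMod.homComp, LinearMap.sum_apply, LinearMap.comp_apply]
    exact sum_proj_of_mem hx (fun s y => proj k (s + r) (f.1 y)) (fun s => by simp)
  rw [this]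
  exact proj_mem _ _

/-- The supercategory of right supermodules; a morphism `f` has parity `r` if it maps
homogeneous vectors of parity `s` to homogeneous vectors of parity `s + r`. -/
instance : Supercategory k (SMod.{w, v, u} k G) where
  homPart V W r := (linPart k V.carrier W.carrier r).comap (SMod.homs V W).subtype
  homPart_isCompl V W := isCompl_of
    (fun f h0 h1 => Subtype.ext (LinearMap.ext fun x => by
      refine hom_induction (k := k) (P := fun x => f.1 x = 0) ?_ ?_ x
      · intro x y hx hy
        rw [map_add, hx, hy, add_zero]
      · intro s x hx
        have e0 := h0 s x hx
        have e1 := h1 s x hx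
        rw [add_zero] at e0
        have := proj_of_mem e0 s
        rw [proj_of_mem e1 s] at this
        rw [if_pos rfl, if_neg (by simp)] at this
        exact this.symm))
    (fun f => ⟨SMod.homComp f 0, SMod.homComp_mem f 0, SMod.homComp f 1, SMod.homComp_mem f 1,
      Subtype.ext (LinearMap.ext fun x => by
        change (SMod.homComp f 0).1 x + (SMod.homComp f 1).1 x = f.1 x
        simp only [SMod.homComp, zmod2_sum, LinearMap.add_apply, LinearMap.comp_apply, add_zero,
          zero_add, zmod2_one_add_one]
        have e := congrArg f.1 (proj_add_proj (k := k) x)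
        have e0 := proj_add_proj (k := k) (f.1 (proj k 0 x))
        have e1 := proj_add_proj (k := k) (f.1 (proj k 1 x))
        rw [map_add] at e
        conv_rhs => rw [← e, ← e0, ← e1]
        abel)⟩)
  id_mem V := fun s x hx => (add_zero s).symm ▸ hx
  comp_mem := fun {U V W} {f} {g} {r} {s} hf hg t x hx => by
    have := hg _ _ (hf t x hx)
    rwa [add_assoc] at this

/-- `f ↦ (x ↦ x · M)`: right multiplication by `M` as an endomorphism of the vector space. -/
def SMod.rmul (V : SMod.{w, v, u} k G) : G →ₗ[k] Module.End k V.carrier := V.act.flip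

/-- The right action of `G` on `V ⊗ W`:
`(x ⊗ y) · M = x ⊗ y M + (-1)^{ȳ M̄} x M ⊗ y` for homogeneous `y`, `M`
(see `SMod.tensorAct_tmul`). -/
def SMod.tensorAct (V W : SMod.{w, v, u} k G) :
    G →ₗ[k] Module.End k (V.carrier ⊗[k] W.carrier) :=
  (TensorProduct.mapBilinear (RingHom.id k) V.carrier W.carrier V.carrier W.carrier
      LinearMap.id) ∘ₗ W.rmul +
    ∑ r, (TensorProduct.mapBilinear (RingHom.id k) V.carrier W.carrier V.carrier W.carrier).flip
      (twist k r) ∘ₗ V.rmul ∘ₗ proj k r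

lemma SMod.tensorAct_tmul (V W : SMod.{w, v, u} k G) {r : ZMod 2} {M : G} (hM : M ∈ part k G r)
    (x : V.carrier) (y : W.carrier) :
    SMod.tensorAct V W M (x ⊗ₜ y) = x ⊗ₜ W.act y M + V.act x M ⊗ₜ twist k r y := by
  have h := sum_proj_of_mem hM
    (fun s N => (V.act x N) ⊗ₜ[k] (twist k s y : W.carrier)) (fun s => by simp)
  simp only [SMod.tensorAct, LinearMap.add_apply, LinearMap.sum_apply, LinearMap.comp_apply,
    LinearMap.flip_apply, TensorProduct.mapBilinear_apply, TensorProduct.map_tmul, SMod.rmul,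
    LinearMap.id_apply]
  rw [h]

lemma twist_act (W : SMod.{w, v, u} k G) (s : ZMod 2) {r : ZMod 2} {M : G}
    (hM : M ∈ part k G r) (y : W.carrier) :
    twist k s (W.act y M) = sgn k (s * r) • W.act (twist k s y) M := by
  refine hom_induction (k := k)
    (P := fun y => twist k s (W.act y M) = sgn k (s * r) • W.act (twist k s y) M) ?_ ?_ y
  · intro x y hx hy
    simp only [map_add, LinearMap.add_apply, hx, hy, smul_add]
  · intro d y hy
    rw [twist_of_mem (W.act_mem hy hM), twist_of_mem hy, mul_add, sgn_add]
    simp [smul_smul, mul_comm]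

lemma twist_add (k : Type v) [Field k] {V : Type u} [AddCommGroup V] [Module k V] [SuperSpace k V]
    (r s : ZMod 2) (x : V) : twist k (r + s) x = twist k r (twist k s x) := by
  refine hom_induction (k := k)
    (P := fun x => twist k (r + s) x = twist k r (twist k s x)) ?_ ?_ x
  · intro x y hx hy
    simp only [map_add, hx, hy]
  · intro d y hy
    rw [twist_of_mem hy, twist_of_mem hy, map_smul, twist_of_mem hy, add_mul, sgn_add, smul_smul,
      mul_comm]

/-- The tensor product `V ⊗ W` of right supermodules. -/
def SMod.tensor (V W : SMod.{w, v, u} k G) : SMod.{w, v, u} k G where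
  carrier := V.carrier ⊗[k] W.carrier
  act := (SMod.tensorAct V W).flip
  act_mem := fun {r s x M} hx hM => by
    change x ∈ tensorPart k V.carrier W.carrier r at hx
    change SMod.tensorAct V W M x ∈ tensorPart k V.carrier W.carrier (r + s)
    induction hx using Submodule.span_induction with
    | mem x hx =>
      obtain ⟨a, b, rfl, y, hy, z, hz, rfl⟩ := hx
      rw [SMod.tensorAct_tmul V W hM]
      exact add_mem (tmul_mem_tensorPart hy (W.act_mem hz hM) (by ring))
        (tmul_mem_tensorPart (V.act_mem hy hM) (twist_mem hz s) (by ring))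
    | zero => simp
    | add x y _ _ hx hy => rw [map_add]; exact add_mem hx hy
    | smul c x _ hx => rw [map_smul]; exact Submodule.smul_mem _ c hx
  act_bracket := fun {r s} x {M N} hM hN => by
    change SMod.tensorAct V W _ x = SMod.tensorAct V W N (SMod.tensorAct V W M x) -
      sgn k (r * s) • SMod.tensorAct V W M (SMod.tensorAct V W N x)
    have hB : superBracket k G M N ∈ part k G (r + s) := by
      rw [superBracket_of_mem hM hN]
      refine sub_mem (Superalgebra.mul_mem hM hN) (Submodule.smul_mem _ _ ?_)
      rw [add_comm]
      exact Superalgebra.mul_mem hN hM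
    induction x using TensorProduct.induction_on with
    | zero => simp
    | tmul x y =>
      rw [SMod.tensorAct_tmul V W hB, SMod.tensorAct_tmul V W hM, SMod.tensorAct_tmul V W hN,
        map_add, map_add, SMod.tensorAct_tmul V W hM, SMod.tensorAct_tmul V W hM,
        SMod.tensorAct_tmul V W hN, SMod.tensorAct_tmul V W hN, V.act_bracket _ hM hN,
        W.act_bracket _ hM hN, twist_act W r hN, twist_act W s hM, twist_add, ← twist_add k s r,
        add_comm s r, twist_add, mul_comm s r]
      simp only [TensorProduct.tmul_sub, TensorProduct.sub_tmul, TensorProduct.tmul_smul,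
        TensorProduct.smul_tmul', smul_add, smul_smul, sgn_mul_self, one_smul]
      abel
    | add x y hx hy => simp only [map_add, hx, hy, smul_add]; abel

/-- The linear map `1 ⊗ f : V ⊗ W → V ⊗ W'`, that is `x ⊗ y ↦ (-1)^{f̄ x̄} x ⊗ f(y)` for
homogeneous `f` and `x` (see `tensorLeftMap_tmul`).  The general formula is
`x ⊗ y ↦ x ⊗ (twist s ∘ f ∘ twist s) (y)` for `x` homogeneous of parity `s`. -/
def tensorLeftMap (V W W' : SMod.{w, v, u} k G) (f : W.carrier →ₗ[k] W'.carrier) :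
    V.carrier ⊗[k] W.carrier →ₗ[k] V.carrier ⊗[k] W'.carrier :=
  ∑ s, TensorProduct.map (proj k s) (twist k s ∘ₗ f ∘ₗ twist k s)

lemma tensorLeftMap_tmul' {V W W' : SMod.{w, v, u} k G} (f : W.carrier →ₗ[k] W'.carrier)
    {s : ZMod 2} {x : V.carrier} (hx : x ∈ part k V.carrier s) (y : W.carrier) :
    tensorLeftMap V W W' f (x ⊗ₜ y) = x ⊗ₜ twist k s (f (twist k s y)) := by
  have h := sum_proj_of_mem hx
    (fun s x => x ⊗ₜ[k] (twist k s (f (twist k s y)) : W'.carrier)) (fun s => by simp)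
  simp only [tensorLeftMap, LinearMap.sum_apply, TensorProduct.map_tmul, LinearMap.comp_apply]
  rw [h]

lemma twist_conj {W W' : SMod.{w, v, u} k G} {f : W.carrier →ₗ[k] W'.carrier} {r : ZMod 2}
    (hf : f ∈ linPart k W.carrier W'.carrier r) (s : ZMod 2) (y : W.carrier) :
    twist k s (f (twist k s y)) = sgn k (r * s) • f y := by
  refine hom_induction (k := k)
    (P := fun y => twist k s (f (twist k s y)) = sgn k (r * s) • f y) ?_ ?_ y
  · intro x y hx hy
    simp only [map_add, hx, hy, smul_add]
  · intro d y hy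
    rw [twist_of_mem hy, map_smul, map_smul, twist_of_mem (hf d y hy), smul_smul, mul_add, sgn_add,
      ← mul_assoc, sgn_mul_self, one_mul, mul_comm s r]

lemma tensorLeftMap_tmul {V W W' : SMod.{w, v, u} k G} {f : W.carrier →ₗ[k] W'.carrier}
    {r s : ZMod 2} (hf : f ∈ linPart k W.carrier W'.carrier r) {x : V.carrier}
    (hx : x ∈ part k V.carrier s) (y : W.carrier) :
    tensorLeftMap V W W' f (x ⊗ₜ y) = sgn k (r * s) • (x ⊗ₜ f y) := by
  rw [tensorLeftMap_tmul' f hx, twist_conj hf, TensorProduct.tmul_smul]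

/-- To compare linear maps on `V ⊗ W`, look at `x ⊗ y` with `x` homogeneous. -/
lemma tensor_hom_ext {V : Type u} {W : Type u₁} {U : Type u₂} [AddCommGroup V] [Module k V]
    [SuperSpace k V] [AddCommGroup W] [Module k W] [AddCommGroup U] [Module k U]
    {f g : V ⊗[k] W →ₗ[k] U}
    (h : ∀ s, ∀ x ∈ part k V s, ∀ y, f (x ⊗ₜ y) = g (x ⊗ₜ y)) : f = g := by
  refine TensorProduct.ext' fun x y => ?_
  refine hom_induction (k := k) (P := fun x => f (x ⊗ₜ y) = g (x ⊗ₜ y)) ?_ ?_ x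
  · intro x x' hx hy
    simp only [TensorProduct.add_tmul, map_add, hx, hy]
  · intro s x hx
    exact h s x hx y

lemma tensorLeftMap_act (V : SMod.{w, v, u} k G) {W W' : SMod.{w, v, u} k G}
    (f : SMod.homs W W') (M : G) :
    tensorLeftMap V W W' f.1 ∘ₗ SMod.tensorAct V W M =
      SMod.tensorAct V W' M ∘ₗ tensorLeftMap V W W' f.1 := by
  refine hom_induction (k := k) (P := fun M => tensorLeftMap V W W' f.1 ∘ₗ SMod.tensorAct V W M =
      SMod.tensorAct V W' M ∘ₗ tensorLeftMap V W W' f.1) ?_ ?_ M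
  · intro M N hM hN
    rw [map_add, map_add, LinearMap.comp_add, LinearMap.add_comp, hM, hN]
  · intro r M hM
    refine tensor_hom_ext fun s x hx y => ?_
    simp only [LinearMap.comp_apply]
    rw [SMod.tensorAct_tmul V W hM, map_add, tensorLeftMap_tmul' f.1 hx,
      tensorLeftMap_tmul' f.1 hx, tensorLeftMap_tmul' f.1 (V.act_mem hx hM),
      SMod.tensorAct_tmul V W' hM, twist_act W s hM, map_smul, f.2, map_smul, twist_act W' s hM,
      smul_smul, sgn_mul_self, one_smul, ← twist_add k (s + r) r, add_assoc, zmod2_add_self,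
      add_zero, add_comm s r, twist_add]

lemma tensorLeftMap_id (V W : SMod.{w, v, u} k G) :
    tensorLeftMap V W W LinearMap.id = LinearMap.id :=
  tensor_hom_ext fun s x hx y => by
    rw [tensorLeftMap_tmul' _ hx, LinearMap.id_apply, twist_twist, LinearMap.id_apply]

lemma tensorLeftMap_comp (V W W' W'' : SMod.{w, v, u} k G) (f : W.carrier →ₗ[k] W'.carrier)
    (g : W'.carrier →ₗ[k] W''.carrier) :
    tensorLeftMap V W W'' (g ∘ₗ f) = tensorLeftMap V W' W'' g ∘ₗ tensorLeftMap V W W' f :=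
  tensor_hom_ext fun s x hx y => by
    rw [LinearMap.comp_apply, tensorLeftMap_tmul' _ hx, tensorLeftMap_tmul' _ hx,
      tensorLeftMap_tmul' _ hx, twist_twist, LinearMap.comp_apply]

lemma tensorLeftMap_add (V W W' : SMod.{w, v, u} k G) (f g : W.carrier →ₗ[k] W'.carrier) :
    tensorLeftMap V W W' (f + g) = tensorLeftMap V W W' f + tensorLeftMap V W W' g :=
  tensor_hom_ext fun s x hx y => by
    simp only [tensorLeftMap_tmul' _ hx, LinearMap.add_apply, map_add, TensorProduct.tmul_add]

lemma tensorLeftMap_smul (V W W' : SMod.{w, v, u} k G) (c : k) (f : W.carrier →ₗ[k] W'.carrier) :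
    tensorLeftMap V W W' (c • f) = c • tensorLeftMap V W W' f :=
  tensor_hom_ext fun s x hx y => by
    simp only [tensorLeftMap_tmul' _ hx, LinearMap.smul_apply, map_smul, TensorProduct.tmul_smul]

lemma tensorLeftMap_mem (V W W' : SMod.{w, v, u} k G) {f : W.carrier →ₗ[k] W'.carrier} {r : ZMod 2}
    (hf : f ∈ linPart k W.carrier W'.carrier r) :
    tensorLeftMap V W W' f ∈
      linPart k (V.carrier ⊗[k] W.carrier) (V.carrier ⊗[k] W'.carrier) r := by
  intro s z hz
  change tensorLeftMap V W W' f z ∈ tensorPart k V.carrier W'.carrier (s + r)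
  change z ∈ tensorPart k V.carrier W.carrier s at hz
  induction hz using Submodule.span_induction with
  | mem z hz =>
    obtain ⟨a, b, rfl, x, hx, y, hy, rfl⟩ := hz
    rw [tensorLeftMap_tmul hf hx]
    exact Submodule.smul_mem _ _ (tmul_mem_tensorPart hx (hf b y hy) (by ring))
  | zero => simp
  | add x y _ _ hx hy => rw [map_add]; exact add_mem hx hy
  | smul c x _ hx => rw [map_smul]; exact Submodule.smul_mem _ c hx

/-- The superfunctor `V ⊗ -`. -/
def tensorLeft (V : SMod.{w, v, u} k G) : SEnd k (SMod.{w, v, u} k G) where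
  obj W := V.tensor W
  map {W W'} f := ⟨tensorLeftMap V W W' f.1, fun z M =>
    LinearMap.congr_fun (tensorLeftMap_act V f M) z⟩
  map_id W := Subtype.ext (tensorLeftMap_id V W)
  map_comp f g := Subtype.ext (tensorLeftMap_comp V _ _ _ f.1 g.1)
  map_add f g := Subtype.ext (tensorLeftMap_add V _ _ f.1 g.1)
  map_smul c f := Subtype.ext (tensorLeftMap_smul V _ _ c f.1)
  map_mem hf := tensorLeftMap_mem V _ _ hf

/-- The right action of `G ⊗ G` on `V ⊗ W`:
`(x ⊗ y) (M ⊗ N) = (-1)^{ȳ M̄} x M ⊗ y N` for homogeneous `y`, `M`. -/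
def rmulTensor (V W : SMod.{w, v, u} k G) :
    G ⊗[k] G →ₗ[k] Module.End k (V.carrier ⊗[k] W.carrier) :=
  TensorProduct.lift (∑ r,
    (TensorProduct.mapBilinear (RingHom.id k) V.carrier W.carrier V.carrier W.carrier).compl₁₂
      (V.rmul ∘ₗ proj k r) (LinearMap.lcomp k W.carrier (twist k r) ∘ₗ W.rmul))

lemma rmulTensor_tmul (V W : SMod.{w, v, u} k G) {r s : ZMod 2} {M : G} (hM : M ∈ part k G r)
    (N : G) (x : V.carrier) {y : W.carrier} (hy : y ∈ part k W.carrier s) :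
    rmulTensor V W (M ⊗ₜ N) (x ⊗ₜ y) = sgn k (s * r) • (V.act x M ⊗ₜ W.act y N) := by
  have h := sum_proj_of_mem hM
    (fun s M => (V.act x M) ⊗ₜ[k] (W.act (twist k s y) N)) (fun s => by simp)
  simp only [rmulTensor, TensorProduct.lift.tmul, LinearMap.sum_apply, LinearMap.compl₁₂_apply,
    LinearMap.comp_apply, TensorProduct.mapBilinear_apply, TensorProduct.map_tmul, SMod.rmul,
    LinearMap.lcomp_apply, LinearMap.flip_apply]
  rw [h, twist_of_mem hy, mul_comm s r]
  simp

end SMod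

/-! ## The general linear Lie superalgebra with entries in a superalgebra -/

/-- The parity `p(i)` of an index: the first `m` indices are even, the last `n` are odd. -/
def idxParity {m n : ℕ} : Fin m ⊕ Fin n → ZMod 2 :=
  Sum.elim (fun _ => 0) (fun _ => 1)

section GeneralLinear

variable {k : Type v} [Field k] {A : Type u} [Ring A] [Algebra k A] [Superalgebra k A] {m n : ℕ}

/-- The superspace `A^{m|n}`: the vector `a e_i` has parity `ā + p(i)`. -/
instance vecSuperSpace : SuperSpace k (Fin m ⊕ Fin n → A) where
  part r :=
    { carrier := {x | ∀ i, x i ∈ part k A (r + idxParity i)}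
      zero_mem' := fun _ => zero_mem _
      add_mem' := fun hx hy i => add_mem (hx i) (hy i)
      smul_mem' := fun c _ hx i => Submodule.smul_mem _ c (hx i) }
  isCompl := isCompl_of
    (fun x h0 h1 => funext fun i => by
      have e0 := proj_of_mem (h0 i) (0 + idxParity i)
      rw [proj_of_mem (h1 i), if_neg (by simp), if_pos rfl] at e0
      exact e0.symm)
    (fun x => ⟨fun i => proj k (0 + idxParity i) (x i), fun _ => proj_mem _ _,
      fun i => proj k (1 + idxParity i) (x i), fun _ => proj_mem _ _, funext fun i => by
        change proj k (0 + idxParity i) (x i) + proj k (1 + idxParity i) (x i) = x i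
        rcases zmod2_cases (idxParity i) with h | h <;> rw [h]
        · simpa using proj_add_proj (x i)
        · rw [add_comm]
          simpa using proj_add_proj (x i)⟩)

/-- The superalgebra `Mat_{m|n}(A)`: the matrix `a_{(i,j)}` with `a` in position `(i, j)` and `0`
elsewhere has parity `ā + p(i) + p(j)`. -/
instance matSuperalgebra : Superalgebra k (Matrix (Fin m ⊕ Fin n) (Fin m ⊕ Fin n) A) where
  part r :=
    { carrier := {M | ∀ i j, M i j ∈ part k A (r + idxParity i + idxParity j)}
      zero_mem' := fun _ _ => zero_mem _
      add_mem' := fun hx hy i j => add_mem (hx i j) (hy i j)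
      smul_mem' := fun c _ hx i j => Submodule.smul_mem _ c (hx i j) }
  isCompl := isCompl_of
    (fun M h0 h1 => Matrix.ext fun i j => by
      have e0 := proj_of_mem (h0 i j) (0 + idxParity i + idxParity j)
      rw [proj_of_mem (h1 i j), if_neg (by simp), if_pos rfl] at e0
      exact e0.symm)
    (fun M => ⟨Matrix.of fun i j => proj k (0 + idxParity i + idxParity j) (M i j),
      fun _ _ => proj_mem _ _,
      Matrix.of fun i j => proj k (1 + idxParity i + idxParity j) (M i j),
      fun _ _ => proj_mem _ _, Matrix.ext fun i j => by
        change proj k (0 + idxParity i + idxParity j) (M i j) +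
          proj k (1 + idxParity i + idxParity j) (M i j) = M i j
        rw [add_assoc, add_assoc]
        rcases zmod2_cases (idxParity i + idxParity j) with h | h <;> rw [h]
        · simpa using proj_add_proj (M i j)
        · rw [add_comm]
          simpa using proj_add_proj (M i j)⟩)
  one_mem := fun i j => by
    by_cases h : i = j
    · subst h
      rw [Matrix.one_apply_eq, add_assoc, zmod2_add_self, add_zero]
      exact Superalgebra.one_mem
    · rw [Matrix.one_apply_ne h]
      exact zero_mem _
  mul_mem := fun {r s M N} hM hN i j => by
    rw [Matrix.mul_apply]
    refine sum_mem fun l _ => ?_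
    have h := Superalgebra.mul_mem (k := k) (hM i l) (hN l j)
    have e : r + idxParity i + idxParity l + (s + idxParity l + idxParity j) =
        r + s + idxParity i + idxParity j := by
      linear_combination zmod2_add_self (idxParity l)
    rwa [e] at h

variable (k A m n) in
/-- Row vectors times matrices. -/
def rowMul : (Fin m ⊕ Fin n → A) →ₗ[k] Matrix (Fin m ⊕ Fin n) (Fin m ⊕ Fin n) A →ₗ[k]
    (Fin m ⊕ Fin n → A) :=
  LinearMap.mk₂ k (fun x M => Matrix.vecMul x M)
    (fun _ _ _ => Matrix.add_vecMul _ _ _) (fun _ _ _ => Matrix.smul_vecMul _ _ _)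
    (fun _ _ _ => Matrix.vecMul_add _ _ _) (fun _ _ _ => Matrix.vecMul_smul _ _ _)

variable (k A m n) in
/-- Matrices times column vectors. -/
def mulCol : Matrix (Fin m ⊕ Fin n) (Fin m ⊕ Fin n) A →ₗ[k] (Fin m ⊕ Fin n → A) →ₗ[k]
    (Fin m ⊕ Fin n → A) :=
  LinearMap.mk₂ k (fun M x => Matrix.mulVec M x)
    (fun _ _ _ => Matrix.add_mulVec _ _ _) (fun _ _ _ => Matrix.smul_mulVec _ _ _)
    (fun _ _ _ => Matrix.mulVec_add _ _ _) (fun _ _ _ => Matrix.mulVec_smul _ _ _)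

lemma rowMul_mem {r s : ZMod 2} {x : Fin m ⊕ Fin n → A}
    {M : Matrix (Fin m ⊕ Fin n) (Fin m ⊕ Fin n) A} (hx : x ∈ part k (Fin m ⊕ Fin n → A) r)
    (hM : M ∈ part k (Matrix (Fin m ⊕ Fin n) (Fin m ⊕ Fin n) A) s) :
    rowMul k A m n x M ∈ part k (Fin m ⊕ Fin n → A) (r + s) := fun j => by
  change ∑ i, x i * M i j ∈ part k A (r + s + idxParity j)
  refine sum_mem fun i _ => ?_
  have h := Superalgebra.mul_mem (k := k) (hx i) (hM i j)
  have e : r + idxParity i + (s + idxParity i + idxParity j) = r + s + idxParity j := by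
    linear_combination zmod2_add_self (idxParity i)
  rwa [e] at h

lemma mulCol_mem {r s : ZMod 2} {x : Fin m ⊕ Fin n → A}
    {M : Matrix (Fin m ⊕ Fin n) (Fin m ⊕ Fin n) A} (hx : x ∈ part k (Fin m ⊕ Fin n → A) r)
    (hM : M ∈ part k (Matrix (Fin m ⊕ Fin n) (Fin m ⊕ Fin n) A) s) :
    mulCol k A m n M x ∈ part k (Fin m ⊕ Fin n → A) (r + s) := fun i => by
  change ∑ j, M i j * x j ∈ part k A (r + s + idxParity i)
  refine sum_mem fun j _ => ?_
  have h := Superalgebra.mul_mem (k := k) (hM i j) (hx j)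
  have e : s + idxParity i + idxParity j + (r + idxParity j) = r + s + idxParity i := by
    linear_combination zmod2_add_self (idxParity j)
  rwa [e] at h

lemma twist_mulCol (t : ZMod 2) {s : ZMod 2} (x : Fin m ⊕ Fin n → A)
    {M : Matrix (Fin m ⊕ Fin n) (Fin m ⊕ Fin n) A}
    (hM : M ∈ part k (Matrix (Fin m ⊕ Fin n) (Fin m ⊕ Fin n) A) s) :
    twist k t (mulCol k A m n M x) = sgn k (t * s) • mulCol k A m n M (twist k t x) := by
  refine hom_induction (k := k) (P := fun x => twist k t (mulCol k A m n M x) =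
    sgn k (t * s) • mulCol k A m n M (twist k t x)) ?_ ?_ x
  · intro x y hx hy
    simp only [map_add, hx, hy, smul_add]
  · intro d y hy
    rw [twist_of_mem (mulCol_mem hy hM), twist_of_mem hy, map_smul, smul_smul, mul_add, sgn_add,
      mul_comm]

variable (k A m n)

/-- The module `V₊ = A^{m|n}` of row vectors, on which matrices act by right multiplication. -/
def Vplus : SMod.{u, v, u} k (Matrix (Fin m ⊕ Fin n) (Fin m ⊕ Fin n) A) where
  carrier := Fin m ⊕ Fin n → A
  act := rowMul k A m n
  act_mem := rowMul_mem
  act_bracket := fun {r s} x {M N} hM hN => by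
    rw [superBracket_of_mem hM hN, map_sub, map_smul]
    simp [rowMul, Matrix.vecMul_vecMul]

/-- The action of matrices on column vectors, `x · M = -(-1)^{x̄ M̄} M x` for homogeneous `x`, `M`
(see `colAct_apply`). -/
def colAct : (Fin m ⊕ Fin n → A) →ₗ[k] Matrix (Fin m ⊕ Fin n) (Fin m ⊕ Fin n) A →ₗ[k]
    (Fin m ⊕ Fin n → A) :=
  -∑ r, ((mulCol k A m n).compl₁₂ (proj k r) (twist k r)).flip

variable {k A m n} in
lemma colAct_of_mem {s : ZMod 2} (x : Fin m ⊕ Fin n → A)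
    {M : Matrix (Fin m ⊕ Fin n) (Fin m ⊕ Fin n) A}
    (hM : M ∈ part k (Matrix (Fin m ⊕ Fin n) (Fin m ⊕ Fin n) A) s) :
    colAct k A m n x M = -mulCol k A m n M (twist k s x) := by
  have h := sum_proj_of_mem hM (fun r N => mulCol k A m n N (twist k r x)) (fun r => by simp)
  simp only [colAct, LinearMap.neg_apply, LinearMap.sum_apply, LinearMap.flip_apply,
    LinearMap.compl₁₂_apply]
  rw [h]

variable {k A m n} in
lemma colAct_apply {r s : ZMod 2} {x : Fin m ⊕ Fin n → A}
    {M : Matrix (Fin m ⊕ Fin n) (Fin m ⊕ Fin n) A} (hx : x ∈ part k (Fin m ⊕ Fin n → A) r)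
    (hM : M ∈ part k (Matrix (Fin m ⊕ Fin n) (Fin m ⊕ Fin n) A) s) :
    colAct k A m n x M = -(sgn k (r * s) • Matrix.mulVec M x) := by
  rw [colAct_of_mem x hM, twist_of_mem hx, map_smul, mul_comm]
  rfl

/-- The module `V₋ = A^{m|n}` of column vectors, with action `x · M = -(-1)^{x̄ M̄} M x`. -/
def Vminus : SMod.{u, v, u} k (Matrix (Fin m ⊕ Fin n) (Fin m ⊕ Fin n) A) where
  carrier := Fin m ⊕ Fin n → A
  act := colAct k A m n
  act_mem := fun {r s x M} hx hM => by
    rw [colAct_of_mem x hM]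
    exact neg_mem (mulCol_mem (twist_mem hx s) hM)
  act_bracket := fun {r s} x {M N} hM hN => by
    have hB : superBracket k _ M N ∈
        part k (Matrix (Fin m ⊕ Fin n) (Fin m ⊕ Fin n) A) (r + s) := by
      rw [superBracket_of_mem hM hN]
      refine sub_mem (Superalgebra.mul_mem hM hN) (Submodule.smul_mem _ _ ?_)
      rw [add_comm]
      exact Superalgebra.mul_mem hN hM
    rw [colAct_of_mem x hB, colAct_of_mem _ hN, colAct_of_mem _ hM, colAct_of_mem _ hN,
      colAct_of_mem _ hM, map_neg (twist k s), map_neg (twist k r), twist_mulCol s _ hM,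
      twist_mulCol r _ hN,
      superBracket_of_mem hM hN, ← twist_add, ← twist_add, add_comm s r, mul_comm s r]
    have e : ∀ (P Q : Matrix (Fin m ⊕ Fin n) (Fin m ⊕ Fin n) A) (y : Fin m ⊕ Fin n → A),
        mulCol k A m n P (mulCol k A m n Q y) = mulCol k A m n (P * Q) y := fun P Q y => by
      simp [mulCol, Matrix.mulVec_mulVec]
    simp only [map_neg, neg_neg, map_smul, e, map_sub, LinearMap.sub_apply, LinearMap.smul_apply,
      smul_smul, sgn_mul_self, one_smul]
    abel

/-- A symmetric Frobenius superalgebra structure on `A` together with a chosen basis `B_A`: an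
even trace map `tr` with `tr(ab) = (-1)^{ā b̄} tr(ba)`, and a finite homogeneous basis `B_A` with a
left dual basis `b ↦ b^∨`, i.e. `tr(b^∨ c) = δ_{b,c}`. -/
structure SymmetricFrobenius where
  tr : A →ₗ[k] k
  tr_odd : ∀ a ∈ part k A 1, tr a = 0
  tr_symm : ∀ {r s : ZMod 2} {a b : A}, a ∈ part k A r → b ∈ part k A s →
    tr (a * b) = sgn k (r * s) * tr (b * a)
  ι : Type
  [fintype : Fintype ι]
  [decidableEq : DecidableEq ι]
  basis : Module.Basis ι k A
  parity : ι → ZMod 2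
  basis_mem : ∀ b, basis b ∈ part k A (parity b)
  dual : ι → A
  tr_dual_mul : ∀ b c, tr (dual b * basis c) = if b = c then 1 else 0

attribute [instance] SymmetricFrobenius.fintype SymmetricFrobenius.decidableEq

variable {k A} (F : SymmetricFrobenius k A)

/-- The element `Ω = ∑ M ⊗ M^∨` of `𝔤 ⊗ 𝔤`, summed over the basis of matrices `M = b_{(i,j)}`,
`b ∈ B_A`, with dual basis `(b_{(i,j)})^∨ = (-1)^{p(j)} (b^∨)_{(j,i)}`. -/
def SymmetricFrobenius.Omega : Matrix (Fin m ⊕ Fin n) (Fin m ⊕ Fin n) A ⊗[k]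
    Matrix (Fin m ⊕ Fin n) (Fin m ⊕ Fin n) A :=
  ∑ i, ∑ j, ∑ b, Matrix.single i j (F.basis b) ⊗ₜ[k]
    (sgn k (idxParity j) • Matrix.single j i (F.dual b))

/-- The bilinear form `B(x ⊗ y) = (-1)^{x̄ ȳ} tr(y x)` for homogeneous `x ∈ V₋`, `y ∈ V₊`
(see `formB_of_mem`). -/
def SymmetricFrobenius.formB : (Fin m ⊕ Fin n → A) →ₗ[k] (Fin m ⊕ Fin n → A) →ₗ[k] k :=
  LinearMap.mk₂ k (fun x y => ∑ r, F.tr (twist k r y ⬝ᵥ proj k r x))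
    (fun _ _ _ => by simp [dotProduct_add, Finset.sum_add_distrib])
    (fun _ _ _ => by simp [dotProduct_smul, Finset.mul_sum])
    (fun _ _ _ => by simp [add_dotProduct, Finset.sum_add_distrib])
    (fun _ _ _ => by simp [smul_dotProduct, Finset.mul_sum])

/-- The basis vector `b_{i,+}` of `V₊`. -/
def SymmetricFrobenius.vec (p : (Fin m ⊕ Fin n) × F.ι) : Fin m ⊕ Fin n → A :=
  Pi.single p.1 (F.basis p.2)

/-- The parity of the basis vector `b_{i,+}`. -/
def SymmetricFrobenius.vecParity (p : (Fin m ⊕ Fin n) × F.ι) : ZMod 2 :=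
  F.parity p.2 + idxParity p.1

/-- The basis of `V₋` dual to the basis `b_{i,+}` of `V₊`, characterized by
`B(v^∨ ⊗ w) = δ_{v,w}` (see `formB_dualVec_vec`). -/
def SymmetricFrobenius.dualVec (p : (Fin m ⊕ Fin n) × F.ι) : Fin m ⊕ Fin n → A :=
  sgn k (idxParity p.1) • Pi.single p.1 (F.dual p.2)

variable {F m n}

lemma formB_of_mem {r s : ZMod 2} {x y : Fin m ⊕ Fin n → A}
    (hx : x ∈ part k (Fin m ⊕ Fin n → A) r) (hy : y ∈ part k (Fin m ⊕ Fin n → A) s) :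
    F.formB m n x y = sgn k (r * s) * F.tr (y ⬝ᵥ x) := by
  have h := sum_proj_of_mem hx (fun r z => F.tr (twist k r y ⬝ᵥ z)) (fun r => by simp)
  change ∑ r, F.tr (twist k r y ⬝ᵥ proj k r x) = _
  rw [h, twist_of_mem hy, smul_dotProduct, map_smul, smul_eq_mul]

lemma single_mem {r : ZMod 2} {a : A} (ha : a ∈ part k A r) (i : Fin m ⊕ Fin n) :
    (Pi.single i a : Fin m ⊕ Fin n → A) ∈ part k (Fin m ⊕ Fin n → A) (r + idxParity i) := by
  intro j
  by_cases h : j = i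
  · subst h
    rw [Pi.single_eq_same, add_assoc, zmod2_add_self, add_zero]
    exact ha
  · rw [Pi.single_eq_of_ne h]
    exact zero_mem _

/-- The dual basis is homogeneous, of the same parities as the basis. -/
lemma SymmetricFrobenius.dual_mem (F : SymmetricFrobenius k A) (b : F.ι) :
    F.dual b ∈ part k A (F.parity b) := by
  have hfin : Module.Finite k A := Module.Finite.of_basis F.basis
  let Φ : A →ₗ[k] (F.ι → k) := LinearMap.pi fun c => F.tr ∘ₗ LinearMap.mulRight k (F.basis c)
  have hΦ : ∀ a c, Φ a c = F.tr (a * F.basis c) := fun _ _ => rfl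
  have hsurj : Function.Surjective Φ := by
    intro g
    refine ⟨∑ c, g c • F.dual c, ?_⟩
    funext d
    rw [hΦ, Finset.sum_mul, map_sum]
    simp [F.tr_dual_mul]
  have hinj : Function.Injective Φ :=
    (LinearMap.injective_iff_surjective_of_finrank_eq_finrank
      (by rw [Module.finrank_eq_card_basis F.basis]; simp)).2 hsurj
  have h0 : proj k (F.parity b + 1) (F.dual b) = 0 := by
    apply hinj
    rw [map_zero]
    funext c
    rw [hΦ, Pi.zero_apply]
    have hx := proj_mem (k := k) (F.parity b + 1) (F.dual b)
    by_cases hc : F.parity c = F.parity b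
    · refine F.tr_odd _ ?_
      have := Superalgebra.mul_mem hx (F.basis_mem c)
      rwa [hc, add_right_comm, zmod2_add_self, zero_add] at this
    · have hne : F.parity c = F.parity b + 1 := by
        rcases zmod2_cases (F.parity c) with h | h <;>
          rcases zmod2_cases (F.parity b) with h' | h' <;> simp [h, h'] at hc ⊢
      have hbc : b ≠ c := fun h => hc (by rw [h])
      have hsum : F.dual b = proj k (F.parity b) (F.dual b) +
          proj k (F.parity b + 1) (F.dual b) := by
        rcases zmod2_cases (F.parity b) with h | h <;> rw [h]
        · simpa using (proj_add_proj (k := k) (F.dual b)).symm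
        · rw [add_comm]
          simpa using (proj_add_proj (k := k) (F.dual b)).symm
      have h1 : F.tr (proj k (F.parity b) (F.dual b) * F.basis c) = 0 := by
        refine F.tr_odd _ ?_
        have := Superalgebra.mul_mem (proj_mem (k := k) (F.parity b) (F.dual b)) (F.basis_mem c)
        rwa [hne, ← add_assoc, zmod2_add_self, zero_add] at this
      have h2 := F.tr_dual_mul b c
      rw [if_neg hbc, hsum, add_mul, map_add, h1, zero_add] at h2
      exact h2
  have hsum : F.dual b = proj k (F.parity b) (F.dual b) +
      proj k (F.parity b + 1) (F.dual b) := by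
    rcases zmod2_cases (F.parity b) with h | h <;> rw [h]
    · simpa using (proj_add_proj (k := k) (F.dual b)).symm
    · rw [add_comm]
      simpa using (proj_add_proj (k := k) (F.dual b)).symm
  rw [hsum, h0, add_zero]
  exact proj_mem _ _

lemma formB_dualVec_vec (p q : (Fin m ⊕ Fin n) × F.ι) :
    F.formB m n (F.dualVec m n p) (F.vec m n q) = if p = q then 1 else 0 := by
  obtain ⟨i, b⟩ := p
  obtain ⟨j, c⟩ := q
  simp only [SymmetricFrobenius.dualVec, SymmetricFrobenius.vec, map_smul, LinearMap.smul_apply,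
    smul_eq_mul]
  rw [formB_of_mem (single_mem (F.dual_mem b) i) (single_mem (F.basis_mem c) j)]
  by_cases hij : i = j
  · subst hij
    rw [dotProduct_single, Pi.single_eq_same, F.tr_symm (F.basis_mem c) (F.dual_mem b),
      F.tr_dual_mul]
    by_cases hbc : b = c
    · subst hbc
      rcases zmod2_cases (F.parity b) with h | h <;>
        rcases zmod2_cases (idxParity i) with h' | h' <;> simp [h, h']
    · simp [hbc]
  · rw [dotProduct_single, Pi.single_eq_of_ne hij]
    simp [hij]

end GeneralLinear

/-! ## The affine oriented Frobenius Brauer category -/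

/-- The two generating objects `↑` and `↓`. -/
inductive Orient where
  | up
  | down

open Orient

/-- Formal expressions for morphisms of a strict monoidal category whose objects are the words in
`↑` and `↓`, built from identities, composition (`comp f g` is `f` followed by `g`, i.e. `g ∘ f`),
tensor product, linear combinations, and the generators. -/
inductive Pre (k : Type v) (A : Type u) : List Orient → List Orient → Type (max u v)
  | id (X : List Orient) : Pre k A X X
  | comp {X Y Z : List Orient} (f : Pre k A X Y) (g : Pre k A Y Z) : Pre k A X Z
  | tensor {X Y X' Y' : List Orient} (f : Pre k A X Y) (g : Pre k A X' Y') :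
      Pre k A (X ++ X') (Y ++ Y')
  | zero (X Y : List Orient) : Pre k A X Y
  | add {X Y : List Orient} (f g : Pre k A X Y) : Pre k A X Y
  | smul {X Y : List Orient} (c : k) (f : Pre k A X Y) : Pre k A X Y
  /-- the upward crossing `↑ ⊗ ↑ → ↑ ⊗ ↑` -/
  | cross : Pre k A [up, up] [up, up]
  /-- the token labelled `a ∈ A` on an upward strand -/
  | token (a : A) : Pre k A [up] [up]
  /-- the right cup `1 → ↓ ⊗ ↑` -/
  | rcup : Pre k A [] [down, up]
  /-- the right cap `↑ ⊗ ↓ → 1` -/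
  | rcap : Pre k A [up, down] []
  /-- the left cup `1 → ↑ ⊗ ↓` -/
  | lcup : Pre k A [] [up, down]
  /-- the left cap `↓ ⊗ ↑ → 1` -/
  | lcap : Pre k A [down, up] []
  /-- the dot on an upward strand -/
  | dot : Pre k A [up] [up]

namespace Pre

variable {k : Type v} {A : Type u}

/-- The identity, viewed as a morphism between two equal words. -/
def ofEq {X Y : List Orient} (h : X = Y) : Pre k A X Y := h ▸ Pre.id X

/-- The right crossing `↑ ⊗ ↓ → ↓ ⊗ ↑`. -/
def rightCross : Pre k A [up, down] [down, up] :=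
  comp (tensor rcup (id [up, down]) : Pre k A [up, down] [down, up, up, down])
    (comp (tensor (tensor (id [down]) cross) (id [down]) :
        Pre k A [down, up, up, down] [down, up, up, down])
      (tensor (id [down, up]) rcap : Pre k A [down, up, up, down] [down, up]))

/-- The left crossing `↓ ⊗ ↑ → ↑ ⊗ ↓`. -/
def leftCross : Pre k A [down, up] [up, down] :=
  comp (tensor (id [down, up]) lcup : Pre k A [down, up] [down, up, up, down])
    (comp (tensor (tensor (id [down]) cross) (id [down]) :
        Pre k A [down, up, up, down] [down, up, up, down])
      (tensor lcap (id [up, down]) : Pre k A [down, up, up, down] [up, down]))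

/-- The upward crossing of the first two among three upward strands. -/
def crossLeft : Pre k A [up, up, up] [up, up, up] := tensor cross (id [up])

/-- The upward crossing of the last two among three upward strands. -/
def crossRight : Pre k A [up, up, up] [up, up, up] := tensor (id [up]) cross

/-- The sum of a list of expressions. -/
def sum {X Y : List Orient} : List (Pre k A X Y) → Pre k A X Y
  | [] => zero X Y
  | f :: l => add f (sum l)

end Pre

section Presentation

open Pre

variable {k : Type v} [Field k] {A : Type u} [Ring A] [Algebra k A] [Superalgebra k A]

/-- `HasParity f r`: the expression `f` is homogeneous of parity `r`.  The token labelled by a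
homogeneous `a` has parity `ā`; all other generators are even. -/
inductive HasParity : ∀ {X Y : List Orient}, Pre k A X Y → ZMod 2 → Prop
  | id (X : List Orient) : HasParity (Pre.id X) 0
  | comp {X Y Z : List Orient} {f : Pre k A X Y} {g : Pre k A Y Z} {r s : ZMod 2} :
      HasParity f r → HasParity g s → HasParity (Pre.comp f g) (r + s)
  | tensor {X Y X' Y' : List Orient} {f : Pre k A X Y} {g : Pre k A X' Y'} {r s : ZMod 2} :
      HasParity f r → HasParity g s → HasParity (Pre.tensor f g) (r + s)
  | zero (X Y : List Orient) (r : ZMod 2) : HasParity (Pre.zero X Y) r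
  | add {X Y : List Orient} {f g : Pre k A X Y} {r : ZMod 2} :
      HasParity f r → HasParity g r → HasParity (Pre.add f g) r
  | smul {X Y : List Orient} (c : k) {f : Pre k A X Y} {r : ZMod 2} :
      HasParity f r → HasParity (Pre.smul c f) r
  | cross : HasParity Pre.cross 0
  | token {a : A} {r : ZMod 2} : a ∈ part k A r → HasParity (Pre.token a) r
  | rcup : HasParity Pre.rcup 0
  | rcap : HasParity Pre.rcap 0
  | lcup : HasParity Pre.lcup 0
  | lcap : HasParity Pre.lcap 0
  | dot : HasParity Pre.dot 0

/-- The relations of the affine oriented Frobenius Brauer category: the smallest equivalence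
relation on expressions which is compatible with all operations, contains the axioms of a strict
monoidal supercategory, and contains the defining relations. -/
inductive Rel (F : SymmetricFrobenius k A) :
    ∀ {X Y : List Orient}, Pre k A X Y → Pre k A X Y → Prop
  -- equivalence relation, compatible with the operations
  | refl {X Y : List Orient} (f : Pre k A X Y) : Rel F f f
  | symm {X Y : List Orient} {f g : Pre k A X Y} : Rel F f g → Rel F g f
  | trans {X Y : List Orient} {f g h : Pre k A X Y} : Rel F f g → Rel F g h → Rel F f h
  | congr_comp {X Y Z : List Orient} {f f' : Pre k A X Y} {g g' : Pre k A Y Z} :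
      Rel F f f' → Rel F g g' → Rel F (comp f g) (comp f' g')
  | congr_tensor {X Y X' Y' : List Orient} {f f' : Pre k A X Y} {g g' : Pre k A X' Y'} :
      Rel F f f' → Rel F g g' → Rel F (tensor f g) (tensor f' g')
  | congr_add {X Y : List Orient} {f f' g g' : Pre k A X Y} :
      Rel F f f' → Rel F g g' → Rel F (add f g) (add f' g')
  | congr_smul {X Y : List Orient} (c : k) {f f' : Pre k A X Y} :
      Rel F f f' → Rel F (smul c f) (smul c f')
  -- morphism spaces are vector spaces
  | add_comm {X Y : List Orient} (f g : Pre k A X Y) : Rel F (add f g) (add g f)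
  | add_assoc {X Y : List Orient} (f g h : Pre k A X Y) :
      Rel F (add (add f g) h) (add f (add g h))
  | zero_add {X Y : List Orient} (f : Pre k A X Y) : Rel F (add (zero X Y) f) f
  | one_smul {X Y : List Orient} (f : Pre k A X Y) : Rel F (smul 1 f) f
  | mul_smul {X Y : List Orient} (c d : k) (f : Pre k A X Y) :
      Rel F (smul (c * d) f) (smul c (smul d f))
  | smul_add {X Y : List Orient} (c : k) (f g : Pre k A X Y) :
      Rel F (smul c (add f g)) (add (smul c f) (smul c g))
  | add_smul {X Y : List Orient} (c d : k) (f : Pre k A X Y) :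
      Rel F (smul (c + d) f) (add (smul c f) (smul d f))
  | zero_smul {X Y : List Orient} (f : Pre k A X Y) : Rel F (smul 0 f) (zero X Y)
  -- composition is bilinear, associative and unital
  | add_comp {X Y Z : List Orient} (f f' : Pre k A X Y) (g : Pre k A Y Z) :
      Rel F (comp (add f f') g) (add (comp f g) (comp f' g))
  | comp_add {X Y Z : List Orient} (f : Pre k A X Y) (g g' : Pre k A Y Z) :
      Rel F (comp f (add g g')) (add (comp f g) (comp f g'))
  | smul_comp {X Y Z : List Orient} (c : k) (f : Pre k A X Y) (g : Pre k A Y Z) :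
      Rel F (comp (smul c f) g) (smul c (comp f g))
  | comp_smul {X Y Z : List Orient} (c : k) (f : Pre k A X Y) (g : Pre k A Y Z) :
      Rel F (comp f (smul c g)) (smul c (comp f g))
  | id_comp {X Y : List Orient} (f : Pre k A X Y) : Rel F (comp (id X) f) f
  | comp_id {X Y : List Orient} (f : Pre k A X Y) : Rel F (comp f (id Y)) f
  | comp_assoc {X Y Z W : List Orient} (f : Pre k A X Y) (g : Pre k A Y Z) (h : Pre k A Z W) :
      Rel F (comp (comp f g) h) (comp f (comp g h))
  -- the tensor product is bilinear, satisfies the super interchange law, and is strictly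
  -- associative and unital
  | add_tensor {X Y X' Y' : List Orient} (f f' : Pre k A X Y) (g : Pre k A X' Y') :
      Rel F (tensor (add f f') g) (add (tensor f g) (tensor f' g))
  | tensor_add {X Y X' Y' : List Orient} (f : Pre k A X Y) (g g' : Pre k A X' Y') :
      Rel F (tensor f (add g g')) (add (tensor f g) (tensor f g'))
  | smul_tensor {X Y X' Y' : List Orient} (c : k) (f : Pre k A X Y) (g : Pre k A X' Y') :
      Rel F (tensor (smul c f) g) (smul c (tensor f g))
  | tensor_smul {X Y X' Y' : List Orient} (c : k) (f : Pre k A X Y) (g : Pre k A X' Y') :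
      Rel F (tensor f (smul c g)) (smul c (tensor f g))
  | tensor_id (X Y : List Orient) : Rel F (tensor (id X) (id Y)) (id (X ++ Y))
  | interchange {X Y Z X' Y' Z' : List Orient} {f : Pre k A X Y} (f' : Pre k A Y Z)
      (g' : Pre k A X' Y') {g : Pre k A Y' Z'} {r s : ZMod 2} :
      HasParity f r → HasParity g s →
      Rel F (comp (tensor f g') (tensor f' g))
        (smul (sgn k (r * s)) (tensor (comp f f') (comp g' g)))
  | tensor_assoc {X Y X' Y' X'' Y'' : List Orient} (f : Pre k A X Y) (g : Pre k A X' Y')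
      (h : Pre k A X'' Y'') :
      Rel F (tensor (tensor f g) h)
        (comp (ofEq (List.append_assoc X X' X''))
          (comp (tensor f (tensor g h)) (ofEq (List.append_assoc Y Y' Y'').symm)))
  | one_tensor {X Y : List Orient} (f : Pre k A X Y) : Rel F (tensor (id []) f) f
  | tensor_one {X Y : List Orient} (f : Pre k A X Y) :
      Rel F (tensor f (id []))
        (comp (ofEq (List.append_nil X)) (comp f (ofEq (List.append_nil Y).symm)))
  -- tokens: `a ↦ token a` is linear, unital and multiplicative
  | token_one : Rel F (token 1) (id [up])
  | token_lin (c d : k) (a b : A) :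
      Rel F (token (c • a + d • b)) (add (smul c (token a)) (smul d (token b)))
  | token_mul (a b : A) : Rel F (comp (token b) (token a)) (token (a * b))
  -- upward crossings: symmetric group relations, and tokens slide through crossings
  | cross_cross : Rel F (comp cross cross) (id [up, up])
  | braid :
      Rel F (comp crossLeft (comp crossRight crossLeft))
        (comp crossRight (comp crossLeft crossRight))
  | token_cross (a : A) :
      Rel F (comp (tensor (token a) (id [up])) cross) (comp cross (tensor (id [up]) (token a)))
  -- the right and left crossings are mutually inverse
  | right_left : Rel F (comp rightCross leftCross) (id [up, down])
  | left_right : Rel F (comp leftCross rightCross) (id [down, up])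
  -- left and right curls
  | left_curl :
      Rel F (comp (tensor rcup (id [up]) : Pre k A [up] [down, up, up])
        (comp (tensor (id [down]) cross : Pre k A [down, up, up] [down, up, up])
          (tensor lcap (id [up]) : Pre k A [down, up, up] [up]))) (id [up])
  | right_curl :
      Rel F (comp (tensor (id [up]) lcup : Pre k A [up] [up, up, down])
        (comp (tensor cross (id [down]) : Pre k A [up, up, down] [up, up, down])
          (tensor (id [up]) rcap : Pre k A [up, up, down] [up]))) (id [up])
  -- `↓` is right dual to `↑`
  | zigzag_up :
      Rel F (comp (tensor (id [up]) rcup : Pre k A [up] [up, down, up])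
        (tensor rcap (id [up]) : Pre k A [up, down, up] [up])) (id [up])
  | zigzag_down :
      Rel F (comp (tensor rcup (id [down]) : Pre k A [down] [down, up, down])
        (tensor (id [down]) rcap : Pre k A [down, up, down] [down])) (id [down])
  -- dots: the affine relation with the teleporter on the right, and dots commute with tokens
  | dot_cross :
      Rel F (add (comp cross (tensor dot (id [up])))
          (smul (-1) (comp (tensor (id [up]) dot) cross)))
        (Pre.sum ((Finset.univ : Finset F.ι).toList.map fun b =>
          comp (tensor (id [up]) (token (F.dual b))) (tensor (token (F.basis b)) (id [up]))))
  | dot_token (a : A) : Rel F (comp dot (token a)) (comp (token a) dot)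

end Presentation

section AOBCategory

variable {k : Type v} [Field k] {A : Type u} [Ring A] [Algebra k A] [Superalgebra k A]

/-- Expressions up to the relations. -/
def relSetoid (F : SymmetricFrobenius k A) (X Y : List Orient) : Setoid (Pre k A X Y) where
  r := Rel F
  iseqv := ⟨Rel.refl, Rel.symm, Rel.trans⟩

/-- The affine oriented Frobenius Brauer category `AOB(A)`: its objects are the words in `↑` and
`↓`, and its morphisms are the expressions in the generators modulo the relations. -/
structure AOB (F : SymmetricFrobenius k A) where
  word : List Orient

/-- The morphism spaces of `AOB(A)`. -/
def AOBHom (F : SymmetricFrobenius k A) (X Y : List Orient) : Type (max u v) :=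
  Quotient (relSetoid F X Y)

namespace AOBHom

variable {F : SymmetricFrobenius k A}

/-- The morphism represented by an expression. -/
def mk (F : SymmetricFrobenius k A) {X Y : List Orient} (f : Pre k A X Y) : AOBHom F X Y :=
  Quotient.mk (relSetoid F X Y) f

lemma sound {X Y : List Orient} {f g : Pre k A X Y} (h : Rel F f g) : mk F f = mk F g :=
  Quotient.sound (s := relSetoid F X Y) h

lemma ind {X Y : List Orient} {P : AOBHom F X Y → Prop} (h : ∀ f, P (mk F f)) (φ : AOBHom F X Y) :
    P φ :=
  Quotient.ind (s := relSetoid F X Y) h φ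

variable {X Y Z X' Y' Z' X'' Y'' : List Orient}

instance : Zero (AOBHom F X Y) := ⟨mk F (Pre.zero X Y)⟩

instance : Add (AOBHom F X Y) :=
  ⟨Quotient.map₂ Pre.add fun _ _ h _ _ h' => Rel.congr_add h h'⟩

instance : SMul k (AOBHom F X Y) :=
  ⟨fun c => Quotient.map (Pre.smul c) fun _ _ h => Rel.congr_smul c h⟩

instance : Neg (AOBHom F X Y) := ⟨fun f => (-1 : k) • f⟩

/-- Composition: `f` followed by `g`. -/
def comp : AOBHom F X Y → AOBHom F Y Z → AOBHom F X Z :=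
  Quotient.map₂ Pre.comp fun _ _ h _ _ h' => Rel.congr_comp h h'

/-- Tensor product of morphisms. -/
def tensor : AOBHom F X Y → AOBHom F X' Y' → AOBHom F (X ++ X') (Y ++ Y') :=
  Quotient.map₂ Pre.tensor fun _ _ h _ _ h' => Rel.congr_tensor h h'

lemma mk_zero : mk F (Pre.zero X Y) = 0 := rfl
lemma mk_add (f g : Pre k A X Y) : mk F (f.add g) = mk F f + mk F g := rfl
lemma mk_smul (c : k) (f : Pre k A X Y) : mk F (f.smul c) = c • mk F f := rfl
lemma mk_comp (f : Pre k A X Y) (g : Pre k A Y Z) :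
    mk F (f.comp g) = (mk F f).comp (mk F g) := rfl
lemma mk_tensor (f : Pre k A X Y) (g : Pre k A X' Y') :
    mk F (f.tensor g) = (mk F f).tensor (mk F g) := rfl

instance : AddCommGroup (AOBHom F X Y) where
  add_assoc := ind fun f => ind fun g => ind fun h => sound (Rel.add_assoc f g h)
  zero_add := ind fun f => sound (Rel.zero_add f)
  add_zero := ind fun f => sound ((Rel.add_comm _ _).trans (Rel.zero_add f))
  add_comm := ind fun f => ind fun g => sound (Rel.add_comm f g)
  neg_add_cancel := ind fun f => sound (by
    refine Rel.trans ?_ (Rel.zero_smul f)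
    refine Rel.trans (Rel.congr_add (Rel.refl _) (Rel.symm (Rel.one_smul f))) ?_
    refine Rel.trans (Rel.symm (Rel.add_smul _ _ _)) ?_
    rw [neg_add_cancel]
    exact Rel.refl _)
  nsmul := nsmulRec
  zsmul := zsmulRec

instance : Module k (AOBHom F X Y) where
  one_smul := ind fun f => sound (Rel.one_smul f)
  mul_smul c d := ind fun f => sound (Rel.mul_smul c d f)
  smul_add c := ind fun f => ind fun g => sound (Rel.smul_add c f g)
  add_smul c d := ind fun f => sound (Rel.add_smul c d f)
  zero_smul := ind fun f => sound (Rel.zero_smul f)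
  smul_zero c := sound (by
    refine Rel.trans (Rel.congr_smul c (Rel.symm (Rel.zero_smul (Pre.zero X Y)))) ?_
    refine Rel.trans (Rel.symm (Rel.mul_smul _ _ _)) ?_
    rw [mul_zero]
    exact Rel.zero_smul _)

end AOBHom

variable {F : SymmetricFrobenius k A}

instance : Category (AOB F) where
  Hom X Y := AOBHom F X.word Y.word
  id X := AOBHom.mk F (Pre.id X.word)
  comp f g := AOBHom.comp f g
  id_comp := AOBHom.ind fun f => AOBHom.sound (Rel.id_comp f)
  comp_id := AOBHom.ind fun f => AOBHom.sound (Rel.comp_id f)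
  assoc := AOBHom.ind fun f => AOBHom.ind fun g => AOBHom.ind fun h =>
    AOBHom.sound (Rel.comp_assoc f g h)

instance : Preadditive (AOB F) where
  homGroup X Y := inferInstanceAs (AddCommGroup (AOBHom F X.word Y.word))
  add_comp _ _ _ := AOBHom.ind fun f => AOBHom.ind fun f' => AOBHom.ind fun g =>
    AOBHom.sound (Rel.add_comp f f' g)
  comp_add _ _ _ := AOBHom.ind fun f => AOBHom.ind fun g => AOBHom.ind fun g' =>
    AOBHom.sound (Rel.comp_add f g g')

instance : Linear k (AOB F) where
  homModule X Y := inferInstanceAs (Module k (AOBHom F X.word Y.word))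
  smul_comp _ _ _ c := AOBHom.ind fun f => AOBHom.ind fun g =>
    AOBHom.sound (Rel.smul_comp c f g)
  comp_smul _ _ _ := AOBHom.ind fun f c => AOBHom.ind fun g =>
    AOBHom.sound (Rel.comp_smul c f g)

namespace AOBHom

variable {X Y Z X' Y' Z' X'' Y'' : List Orient}

/-- The tensor product as a bilinear map. -/
def tensorₗ : AOBHom F X Y →ₗ[k] AOBHom F X' Y' →ₗ[k] AOBHom F (X ++ X') (Y ++ Y') :=
  LinearMap.mk₂ k tensor
    (ind fun f => ind fun f' => ind fun g => sound (Rel.add_tensor f f' g))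
    (fun c => ind fun f => ind fun g => sound (Rel.smul_tensor c f g))
    (ind fun f => ind fun g => ind fun g' => sound (Rel.tensor_add f g g'))
    (fun c => ind fun f => ind fun g => sound (Rel.tensor_smul c f g))

/-- Composition as a bilinear map. -/
def compₗ : AOBHom F X Y →ₗ[k] AOBHom F Y Z →ₗ[k] AOBHom F X Z :=
  LinearMap.mk₂ k comp
    (ind fun f => ind fun f' => ind fun g => sound (Rel.add_comp f f' g))
    (fun c => ind fun f => ind fun g => sound (Rel.smul_comp c f g))
    (ind fun f => ind fun g => ind fun g' => sound (Rel.comp_add f g g'))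
    (fun c => ind fun f => ind fun g => sound (Rel.comp_smul c f g))

/-- The morphisms of parity `r`: those represented by a homogeneous expression of parity `r`. -/
def homPart (F : SymmetricFrobenius k A) (X Y : List Orient) (r : ZMod 2) :
    Submodule k (AOBHom F X Y) where
  carrier := {φ | ∃ f, HasParity f r ∧ mk F f = φ}
  zero_mem' := ⟨Pre.zero X Y, HasParity.zero X Y r, rfl⟩
  add_mem' := by
    rintro _ _ ⟨f, hf, rfl⟩ ⟨g, hg, rfl⟩
    exact ⟨f.add g, HasParity.add hf hg, rfl⟩
  smul_mem' := by
    rintro c _ ⟨f, hf, rfl⟩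
    exact ⟨f.smul c, HasParity.smul c hf, rfl⟩

/-- The even and odd components of an expression. -/
def parts (F : SymmetricFrobenius k A) : ∀ {X Y : List Orient}, Pre k A X Y →
    (ZMod 2 → AOBHom F X Y)
  | _, _, .comp f g => fun r => ∑ s, comp (parts F f s) (parts F g (s + r))
  | _, _, .tensor f g => fun r => ∑ s, tensor (parts F f s) (parts F g (s + r))
  | _, _, .zero _ _ => fun _ => 0
  | _, _, .add f g => fun r => parts F f r + parts F g r
  | _, _, .smul c f => fun r => c • parts F f r
  | _, _, .token a => fun r => mk F (.token (proj k r a))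
  | _, _, .id X => Pi.single 0 (mk F (.id X))
  | _, _, .cross => Pi.single 0 (mk F .cross)
  | _, _, .rcup => Pi.single 0 (mk F .rcup)
  | _, _, .rcap => Pi.single 0 (mk F .rcap)
  | _, _, .lcup => Pi.single 0 (mk F .lcup)
  | _, _, .lcap => Pi.single 0 (mk F .lcap)
  | _, _, .dot => Pi.single 0 (mk F .dot)

lemma mk_token_add (a b : A) :
    mk F (.token (a + b)) = mk F (.token a) + mk F (.token b) := by
  have h := sound (F := F) (Rel.token_lin (1 : k) 1 a b)
  simpa [mk_add, mk_smul] using h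

lemma mk_token_smul (c : k) (a : A) : mk F (.token (c • a)) = c • mk F (.token a) := by
  have h := sound (F := F) (Rel.token_lin c 0 a 0)
  simpa [mk_add, mk_smul] using h

lemma mk_token_zero : mk F (.token (0 : A)) = 0 := by
  simpa using mk_token_smul (F := F) (0 : k) (0 : A)

section LinearAlgebra

variable (φ φ' : AOBHom F X Y) (ψ ψ' : AOBHom F Y Z) (χ χ' : AOBHom F X' Y') (c : k)

lemma add_comp : (φ + φ').comp ψ = φ.comp ψ + φ'.comp ψ := compₗ.map_add₂ φ φ' ψ
lemma comp_add : φ.comp (ψ + ψ') = φ.comp ψ + φ.comp ψ' := (compₗ φ).map_add ψ ψ'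
lemma smul_comp : (c • φ).comp ψ = c • φ.comp ψ := compₗ.map_smul₂ c φ ψ
lemma comp_smul : φ.comp (c • ψ) = c • φ.comp ψ := (compₗ φ).map_smul c ψ
lemma zero_comp : (0 : AOBHom F X Y).comp ψ = 0 := compₗ.map_zero₂ ψ
lemma comp_zero : φ.comp (0 : AOBHom F Y Z) = 0 := (compₗ φ).map_zero
lemma add_tensor : (φ + φ').tensor χ = φ.tensor χ + φ'.tensor χ := tensorₗ.map_add₂ φ φ' χ
lemma tensor_add : φ.tensor (χ + χ') = φ.tensor χ + φ.tensor χ' := (tensorₗ φ).map_add χ χ'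
lemma smul_tensor : (c • φ).tensor χ = c • φ.tensor χ := tensorₗ.map_smul₂ c φ χ
lemma tensor_smul : φ.tensor (c • χ) = c • φ.tensor χ := (tensorₗ φ).map_smul c χ
lemma zero_tensor : (0 : AOBHom F X Y).tensor χ = 0 := tensorₗ.map_zero₂ χ
lemma tensor_zero : φ.tensor (0 : AOBHom F X' Y') = 0 := (tensorₗ φ).map_zero

end LinearAlgebra

lemma parts_add_parts {X Y : List Orient} (f : Pre k A X Y) :
    parts F f 0 + parts F f 1 = mk F f := by
  induction f with
  | comp f g hf hg =>
    simp only [parts, zmod2_sum, mk_comp, ← hf, ← hg, add_comp, comp_add, zero_add, add_zero,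
      zmod2_one_add_one]
    abel
  | tensor f g hf hg =>
    simp only [parts, zmod2_sum, mk_tensor, ← hf, ← hg, add_tensor, tensor_add, zero_add, add_zero,
      zmod2_one_add_one]
    abel
  | zero X Y => simp [parts, mk_zero]
  | add f g hf hg =>
    simp only [parts, mk_add, ← hf, ← hg]
    abel
  | smul c f hf => simp only [parts, mk_smul, ← hf, smul_add]
  | token a => simp only [parts, ← mk_token_add, proj_add_proj]
  | _ => simp [parts]

lemma single_mem_homPart {f : Pre k A X Y} (hf : HasParity f 0) (r : ZMod 2) :
    (Pi.single 0 (mk F f) : ZMod 2 → AOBHom F X Y) r ∈ homPart F X Y r := by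
  by_cases h : r = 0
  · subst h
    rw [Pi.single_eq_same]
    exact ⟨f, hf, rfl⟩
  · rw [Pi.single_eq_of_ne h]
    exact zero_mem _

lemma comp_mem_homPart {φ : AOBHom F X Y} {ψ : AOBHom F Y Z} {r s : ZMod 2}
    (hφ : φ ∈ homPart F X Y r) (hψ : ψ ∈ homPart F Y Z s) :
    φ.comp ψ ∈ homPart F X Z (r + s) := by
  obtain ⟨f, hf, rfl⟩ := hφ
  obtain ⟨g, hg, rfl⟩ := hψ
  exact ⟨f.comp g, HasParity.comp hf hg, rfl⟩

lemma tensor_mem_homPart {φ : AOBHom F X Y} {ψ : AOBHom F X' Y'} {r s : ZMod 2}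
    (hφ : φ ∈ homPart F X Y r) (hψ : ψ ∈ homPart F X' Y' s) :
    φ.tensor ψ ∈ homPart F (X ++ X') (Y ++ Y') (r + s) := by
  obtain ⟨f, hf, rfl⟩ := hφ
  obtain ⟨g, hg, rfl⟩ := hψ
  exact ⟨f.tensor g, HasParity.tensor hf hg, rfl⟩

lemma parts_mem {X Y : List Orient} (f : Pre k A X Y) (r : ZMod 2) :
    parts F f r ∈ homPart F X Y r := by
  induction f generalizing r with
  | comp f g hf hg =>
    refine sum_mem fun s _ => ?_
    have h := comp_mem_homPart (hf s) (hg (s + r))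
    rwa [← add_assoc, zmod2_add_self, zero_add] at h
  | tensor f g hf hg =>
    refine sum_mem fun s _ => ?_
    have h := tensor_mem_homPart (hf s) (hg (s + r))
    rwa [← add_assoc, zmod2_add_self, zero_add] at h
  | zero X Y => exact zero_mem _
  | add f g hf hg => exact add_mem (hf r) (hg r)
  | smul c f hf => exact Submodule.smul_mem _ c (hf r)
  | token a => exact ⟨_, HasParity.token (proj_mem r a), rfl⟩
  | id X => exact single_mem_homPart (HasParity.id X) r
  | cross => exact single_mem_homPart HasParity.cross r
  | rcup => exact single_mem_homPart HasParity.rcup r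
  | rcap => exact single_mem_homPart HasParity.rcap r
  | lcup => exact single_mem_homPart HasParity.lcup r
  | lcap => exact single_mem_homPart HasParity.lcap r
  | dot => exact single_mem_homPart HasParity.dot r

lemma parts_comp (f : Pre k A X Y) (g : Pre k A Y Z) : parts F (f.comp g) 0 =
      (parts F f 0).comp (parts F g 0) + (parts F f 1).comp (parts F g 1) ∧
    parts F (f.comp g) 1 =
      (parts F f 0).comp (parts F g 1) + (parts F f 1).comp (parts F g 0) :=
  ⟨by simp [parts, zmod2_sum], by simp [parts, zmod2_sum]⟩

lemma parts_tensor (f : Pre k A X Y) (g : Pre k A X' Y') : parts F (f.tensor g) 0 =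
      (parts F f 0).tensor (parts F g 0) + (parts F f 1).tensor (parts F g 1) ∧
    parts F (f.tensor g) 1 =
      (parts F f 0).tensor (parts F g 1) + (parts F f 1).tensor (parts F g 0) :=
  ⟨by simp [parts, zmod2_sum], by simp [parts, zmod2_sum]⟩

lemma parts_smul (c : k) (f : Pre k A X Y) (r : ZMod 2) :
    parts F (f.smul c) r = c • parts F f r := rfl

lemma parts_ext {p q : ZMod 2 → AOBHom F X Y} (h0 : p 0 = q 0) (h1 : p 1 = q 1) : p = q := by
  funext r
  rcases zmod2_cases r with rfl | rfl
  · exact h0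
  · exact h1

lemma parts_of_hasParity {X Y : List Orient} {f : Pre k A X Y} {r : ZMod 2} (h : HasParity f r) :
    parts F f = Pi.single r (mk F f) := by
  induction h with
  | @comp X Y Z f g r s _ _ hf hg =>
    refine parts_ext ?_ ?_
    · rw [(parts_comp f g).1, hf, hg]
      rcases zmod2_cases r with rfl | rfl <;> rcases zmod2_cases s with rfl | rfl <;>
        simp [mk_comp, comp_zero, zero_comp]
    · rw [(parts_comp f g).2, hf, hg]
      rcases zmod2_cases r with rfl | rfl <;> rcases zmod2_cases s with rfl | rfl <;>
        simp [mk_comp, comp_zero, zero_comp]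
  | @tensor X Y X' Y' f g r s _ _ hf hg =>
    refine parts_ext ?_ ?_
    · rw [(parts_tensor f g).1, hf, hg]
      rcases zmod2_cases r with rfl | rfl <;> rcases zmod2_cases s with rfl | rfl <;>
        simp [mk_tensor, tensor_zero, zero_tensor]
    · rw [(parts_tensor f g).2, hf, hg]
      rcases zmod2_cases r with rfl | rfl <;> rcases zmod2_cases s with rfl | rfl <;>
        simp [mk_tensor, tensor_zero, zero_tensor]
  | zero X Y r => rw [mk_zero, Pi.single_zero]; rfl
  | add _ _ hf hg => rw [mk_add, Pi.single_add, ← hf, ← hg]; rfl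
  | smul c _ hf => rw [mk_smul, Pi.single_smul, ← hf]; rfl
  | @token a r ha =>
    funext s
    change mk F (.token (proj k s a)) = _
    rw [proj_of_mem ha]
    by_cases h : s = r
    · subst h
      rw [if_pos rfl, Pi.single_eq_same]
    · rw [if_neg h, Pi.single_eq_of_ne h, mk_token_zero]
  | _ => rfl

lemma parts_of_rel_of_hasParity {X Y : List Orient} {f g : Pre k A X Y} {r : ZMod 2}
    (hf : HasParity f r) (hg : HasParity g r) (h : Rel F f g) : parts F f = parts F g := by
  rw [parts_of_hasParity hf, parts_of_hasParity hg, sound h]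

lemma hasParity_ofEq {X Y : List Orient} (h : X = Y) : HasParity (Pre.ofEq h : Pre k A X Y) 0 := by
  subst h
  exact HasParity.id X

lemma hasParity_sum {X Y : List Orient} {r : ZMod 2} {ι : Type} (e : ι → Pre k A X Y)
    (he : ∀ i, HasParity (e i) r) (l : List ι) : HasParity (Pre.sum (l.map e)) r := by
  induction l with
  | nil => exact HasParity.zero X Y r
  | cons i l ih => exact HasParity.add (he i) ih

lemma hom_id_comp (φ : AOBHom F X Y) : (mk F (.id X)).comp φ = φ :=
  ind (P := fun φ => (mk F (.id X)).comp φ = φ) (fun f => sound (Rel.id_comp f)) φ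

lemma hom_comp_id (φ : AOBHom F X Y) : φ.comp (mk F (.id Y)) = φ :=
  ind (P := fun φ => φ.comp (mk F (.id Y)) = φ) (fun f => sound (Rel.comp_id f)) φ

lemma hom_assoc {W : List Orient} : ∀ (φ : AOBHom F X Y) (ψ : AOBHom F Y Z) (χ : AOBHom F Z W),
    (φ.comp ψ).comp χ = φ.comp (ψ.comp χ) :=
  ind fun f => ind fun g => ind fun h => sound (Rel.comp_assoc f g h)

lemma hom_interchange {r s : ZMod 2} {φ : AOBHom F X Y} (hφ : φ ∈ homPart F X Y r)
    (φ' : AOBHom F Y Z) (χ : AOBHom F X' Y') {χ' : AOBHom F Y' Z'}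
    (hχ' : χ' ∈ homPart F Y' Z' s) :
    (φ.tensor χ).comp (φ'.tensor χ') = sgn k (r * s) • (φ.comp φ').tensor (χ.comp χ') := by
  obtain ⟨f, hf, rfl⟩ := hφ
  obtain ⟨g, hg, rfl⟩ := hχ'
  revert χ
  refine ind fun g' => ?_
  revert φ'
  exact ind fun f' => sound (Rel.interchange f' g' hf hg)

lemma hom_tensor_assoc : ∀ (φ : AOBHom F X Y) (ψ : AOBHom F X' Y') (χ : AOBHom F X'' Y''),
    (φ.tensor ψ).tensor χ =
      (mk F (.ofEq (List.append_assoc X X' X''))).comp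
        ((φ.tensor (ψ.tensor χ)).comp (mk F (.ofEq (List.append_assoc Y Y' Y'').symm))) :=
  ind fun f => ind fun g => ind fun h => sound (Rel.tensor_assoc f g h)

lemma hom_one_tensor : ∀ (φ : AOBHom F X Y), (mk F (.id [])).tensor φ = φ :=
  ind fun f => sound (Rel.one_tensor f)

lemma hom_tensor_one : ∀ (φ : AOBHom F X Y), φ.tensor (mk F (.id [])) =
    (mk F (.ofEq (List.append_nil X))).comp
      (φ.comp (mk F (.ofEq (List.append_nil Y).symm))) :=
  ind fun f => sound (Rel.tensor_one f)

lemma parts_sandwich {h : X = X'} {h' : Y = Y'} (f : Pre k A X' Y') (r : ZMod 2) :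
    parts F (.comp (.ofEq h) (.comp f (.ofEq h'.symm))) r =
      (mk F (.ofEq h)).comp ((parts F f r).comp (mk F (.ofEq h'.symm))) := by
  rcases zmod2_cases r with rfl | rfl <;>
    simp [parts_comp, parts_of_hasParity (hasParity_ofEq _), zero_comp, comp_zero]

lemma parts_token_add (a b : A) :
    parts F (.token (a + b)) = parts F (.token a) + parts F (.token b) := by
  funext r
  simp only [parts, map_add, mk_token_add, Pi.add_apply]

lemma even_comp {f : Pre k A X Y} {g : Pre k A Y Z} (hf : HasParity f 0) (hg : HasParity g 0) :
    HasParity (.comp f g) 0 := by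
  simpa using HasParity.comp hf hg

lemma even_tensor {f : Pre k A X Y} {g : Pre k A X' Y'} (hf : HasParity f 0)
    (hg : HasParity g 0) : HasParity (.tensor f g) 0 := by
  simpa using HasParity.tensor hf hg

lemma even_rightCross : HasParity (Pre.rightCross : Pre k A _ _) 0 :=
  even_comp (even_tensor .rcup (.id _)) (even_comp (even_tensor (even_tensor (.id _) .cross)
    (.id _)) (even_tensor (.id _) .rcap))

lemma even_leftCross : HasParity (Pre.leftCross : Pre k A _ _) 0 :=
  even_comp (even_tensor (.id _) .lcup) (even_comp (even_tensor (even_tensor (.id _) .cross)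
    (.id _)) (even_tensor .lcap (.id _)))

lemma parts_of_rel {X Y : List Orient} {f g : Pre k A X Y} (h : Rel F f g) :
    parts F f = parts F g := by
  induction h with
  | refl f => rfl
  | symm _ h => exact h.symm
  | trans _ _ h h' => exact h.trans h'
  | congr_comp _ _ h h' => simp only [parts, h, h']
  | congr_tensor _ _ h h' => simp only [parts, h, h']
  | congr_add _ _ h h' => simp only [parts, h, h']
  | congr_smul c _ h => simp only [parts, h]
  | add_comm f g => funext r; exact _root_.add_comm _ _
  | add_assoc f g h => funext r; exact _root_.add_assoc _ _ _
  | zero_add f => funext r; exact _root_.zero_add _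
  | one_smul f => funext r; exact _root_.one_smul _ _
  | mul_smul c d f => funext r; exact SemigroupAction.mul_smul _ _ _
  | smul_add c f g => funext r; exact _root_.smul_add _ _ _
  | add_smul c d f => funext r; exact _root_.add_smul _ _ _
  | zero_smul f => funext r; exact _root_.zero_smul _ _
  | add_comp f f' g =>
    funext r; simp only [parts, add_comp, Finset.sum_add_distrib]
  | comp_add f g g' =>
    funext r; simp only [parts, comp_add, Finset.sum_add_distrib]
  | smul_comp c f g => funext r; simp only [parts, smul_comp, Finset.smul_sum]
  | comp_smul c f g => funext r; simp only [parts, comp_smul, Finset.smul_sum]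
  | add_tensor f f' g =>
    funext r; simp only [parts, add_tensor, Finset.sum_add_distrib]
  | tensor_add f g g' =>
    funext r; simp only [parts, tensor_add, Finset.sum_add_distrib]
  | smul_tensor c f g => funext r; simp only [parts, smul_tensor, Finset.smul_sum]
  | tensor_smul c f g => funext r; simp only [parts, tensor_smul, Finset.smul_sum]
  | id_comp f =>
    refine parts_ext ?_ ?_ <;>
      simp [parts_comp, parts_of_hasParity (HasParity.id _), hom_id_comp, zero_comp]
  | comp_id f =>
    refine parts_ext ?_ ?_ <;>
      simp [parts_comp, parts_of_hasParity (HasParity.id _), hom_comp_id, comp_zero]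
  | comp_assoc f g h =>
    refine parts_ext ?_ ?_ <;>
    · simp only [parts_comp, add_comp, comp_add, hom_assoc]
      abel
  | tensor_id X Y =>
    exact parts_of_rel_of_hasParity (HasParity.tensor (HasParity.id X) (HasParity.id Y))
      (HasParity.id _) (Rel.tensor_id X Y)
  | @interchange X Y Z X' Y' Z' f f' g' g r s hf hg =>
    have ef := parts_of_hasParity (F := F) hf
    have eg := parts_of_hasParity (F := F) hg
    have hi := fun (φ : AOBHom F Y Z) (χ : AOBHom F X' Y') =>
      hom_interchange (r := r) (s := s) ⟨f, hf, rfl⟩ φ χ ⟨g, hg, rfl⟩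
    refine parts_ext ?_ ?_ <;>
    · simp only [parts_smul, parts_comp, parts_tensor, ef, eg]
      rcases zmod2_cases r with rfl | rfl <;> rcases zmod2_cases s with rfl | rfl <;>
        simp [zero_comp, comp_zero, zero_tensor, tensor_zero] at hi ⊢ <;>
        simp only [hi]
      all_goals exact _root_.add_comm _ _
  | tensor_assoc f g h =>
    refine parts_ext ?_ ?_ <;> rw [parts_sandwich (h' := List.append_assoc _ _ _)] <;>
      simp only [parts_tensor, add_tensor, tensor_add, hom_tensor_assoc, add_comp, comp_add] <;>
      abel
  | one_tensor f =>
    have hp := parts_of_hasParity (F := F) (HasParity.id (k := k) (A := A) [])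
    refine parts_ext ((parts_tensor (.id []) f).1.trans ?_) ((parts_tensor (.id []) f).2.trans ?_)
    · rw [hp, Pi.single_eq_same, Pi.single_eq_of_ne one_ne_zero, hom_one_tensor, zero_tensor, _root_.add_zero]
    · rw [hp, Pi.single_eq_same, Pi.single_eq_of_ne one_ne_zero, hom_one_tensor, zero_tensor, _root_.add_zero]
  | tensor_one f =>
    refine parts_ext ?_ ?_ <;> rw [parts_sandwich (h' := List.append_nil _)] <;>
      simp [parts_tensor, parts_of_hasParity (HasParity.id _), hom_tensor_one, tensor_zero]
  | token_one =>
    exact parts_of_rel_of_hasParity (HasParity.token Superalgebra.one_mem) (HasParity.id _)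
      Rel.token_one
  | token_lin c d a b =>
    funext r
    simp only [parts, map_add, map_smul, mk_token_add, mk_token_smul]
  | token_mul a b =>
    refine hom_induction (k := k) (P := fun a => parts F (.comp (.token b) (.token a)) =
      parts F (.token (a * b))) ?_ ?_ a
    · intro a a' h h'
      rw [add_mul, parts_token_add, ← h, ← h']
      funext r
      simp only [parts, map_add, mk_token_add, comp_add, Finset.sum_add_distrib, Pi.add_apply]
    · intro r a ha
      refine hom_induction (k := k) (P := fun b => parts F (.comp (.token b) (.token a)) =
        parts F (.token (a * b))) ?_ ?_ b
      · intro b b' h h'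
        rw [mul_add, parts_token_add, ← h, ← h']
        funext r
        simp only [parts, map_add, mk_token_add, add_comp, Finset.sum_add_distrib, Pi.add_apply]
      · intro s b hb
        exact parts_of_rel_of_hasParity (HasParity.comp (HasParity.token hb) (HasParity.token ha))
          (HasParity.token (by rw [_root_.add_comm]; exact Superalgebra.mul_mem ha hb))
          (Rel.token_mul a b)
  | cross_cross =>
    exact parts_of_rel_of_hasParity (even_comp .cross .cross) (.id _) Rel.cross_cross
  | braid =>
    have h1 : HasParity (Pre.crossLeft : Pre k A _ _) 0 := even_tensor .cross (.id _)
    have h2 : HasParity (Pre.crossRight : Pre k A _ _) 0 := even_tensor (.id _) .cross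
    exact parts_of_rel_of_hasParity (even_comp h1 (even_comp h2 h1))
      (even_comp h2 (even_comp h1 h2)) Rel.braid
  | token_cross a =>
    refine hom_induction (k := k) (P := fun a =>
      parts F (.comp (.tensor (.token a) (.id [up])) .cross) =
        parts F (.comp .cross (.tensor (.id [up]) (.token a)))) ?_ ?_ a
    · intro a a' h h'
      have e1 : parts F (.comp (.tensor (.token (a + a')) (.id [up])) .cross) =
          parts F (.comp (.tensor (.token a) (.id [up])) .cross) +
            parts F (.comp (.tensor (.token a') (.id [up])) .cross) := by
        funext r
        simp only [parts, map_add, mk_token_add, add_comp, add_tensor, Finset.sum_add_distrib,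
          Pi.add_apply]
      have e2 : parts F (.comp .cross (.tensor (.id [up]) (.token (a + a')))) =
          parts F (.comp .cross (.tensor (.id [up]) (.token a))) +
            parts F (.comp .cross (.tensor (.id [up]) (.token a'))) := by
        funext r
        simp only [parts, map_add, mk_token_add, comp_add, tensor_add, Finset.sum_add_distrib,
          Pi.add_apply]
      rw [e1, e2, h, h']
    · intro r a ha
      have h1 : HasParity (.comp (.tensor (.token a) (.id [up])) .cross : Pre k A _ _) r := by
        simpa using HasParity.comp (HasParity.tensor (HasParity.token ha) (HasParity.id [up]))
          HasParity.cross
      have h2 : HasParity (.comp .cross (.tensor (.id [up]) (.token a)) : Pre k A _ _) r := by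
        simpa using HasParity.comp HasParity.cross
          (HasParity.tensor (HasParity.id [up]) (HasParity.token ha))
      exact parts_of_rel_of_hasParity h1 h2 (Rel.token_cross a)
  | right_left =>
    exact parts_of_rel_of_hasParity (even_comp even_rightCross even_leftCross) (.id _)
      Rel.right_left
  | left_right =>
    exact parts_of_rel_of_hasParity (even_comp even_leftCross even_rightCross) (.id _)
      Rel.left_right
  | left_curl =>
    exact parts_of_rel_of_hasParity (even_comp (even_tensor .rcup (.id _))
      (even_comp (even_tensor (.id _) .cross) (even_tensor .lcap (.id _)))) (.id _) Rel.left_curl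
  | right_curl =>
    exact parts_of_rel_of_hasParity (even_comp (even_tensor (.id _) .lcup)
      (even_comp (even_tensor .cross (.id _)) (even_tensor (.id _) .rcap))) (.id _) Rel.right_curl
  | zigzag_up =>
    exact parts_of_rel_of_hasParity (even_comp (even_tensor (.id _) .rcup)
      (even_tensor .rcap (.id _))) (.id _) Rel.zigzag_up
  | zigzag_down =>
    exact parts_of_rel_of_hasParity (even_comp (even_tensor .rcup (.id _))
      (even_tensor (.id _) .rcap)) (.id _) Rel.zigzag_down
  | dot_cross =>
    refine parts_of_rel_of_hasParity (r := 0) (.add (even_comp .cross (even_tensor .dot (.id _)))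
      (.smul _ (even_comp (even_tensor (.id _) .dot) .cross))) (hasParity_sum _ (fun b => ?_) _)
      Rel.dot_cross
    have h := HasParity.comp
      (HasParity.tensor (HasParity.id [up]) (HasParity.token (F.dual_mem b)))
      (HasParity.tensor (HasParity.token (F.basis_mem b)) (HasParity.id [up]))
    simpa [zmod2_add_self] using h
  | dot_token a =>
    refine hom_induction (k := k) (P := fun a =>
      parts F (.comp .dot (.token a)) = parts F (.comp (.token a) .dot)) ?_ ?_ a
    · intro a a' h h'
      have e1 : parts F (.comp .dot (.token (a + a'))) =
          parts F (.comp .dot (.token a)) + parts F (.comp .dot (.token a')) := by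
        funext r
        simp only [parts, map_add, mk_token_add, comp_add, Finset.sum_add_distrib, Pi.add_apply]
      have e2 : parts F (.comp (.token (a + a')) .dot) =
          parts F (.comp (.token a) .dot) + parts F (.comp (.token a') .dot) := by
        funext r
        simp only [parts, map_add, mk_token_add, add_comp, Finset.sum_add_distrib, Pi.add_apply]
      rw [e1, e2, h, h']
    · intro r a ha
      have h1 : HasParity (.comp .dot (.token a) : Pre k A _ _) r := by
        simpa using HasParity.comp HasParity.dot (HasParity.token ha)
      have h2 : HasParity (.comp (.token a) .dot : Pre k A _ _) r := by
        simpa using HasParity.comp (HasParity.token ha) HasParity.dot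
      exact parts_of_rel_of_hasParity h1 h2 (Rel.dot_token a)

lemma homPart_isCompl (X Y : List Orient) : IsCompl (homPart F X Y 0) (homPart F X Y 1) :=
  isCompl_of
    (fun φ h0 h1 => by
      obtain ⟨f, hf, rfl⟩ := h0
      obtain ⟨g, hg, h⟩ := h1
      have hp := parts_of_rel (F := F) (Quotient.exact (s := relSetoid F X Y) h)
      have h0 := congrFun hp 0
      rw [parts_of_hasParity hf, parts_of_hasParity hg] at h0
      simpa using h0.symm)
    (ind fun f => ⟨parts F f 0, parts_mem f 0, parts F f 1, parts_mem f 1, parts_add_parts f⟩)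

lemma eqToHom_eq {X Y : AOB F} (h : X = Y) :
    (eqToHom h : X ⟶ Y) = mk F (.ofEq (congrArg AOB.word h)) := by
  subst h
  rfl

end AOBHom

instance : Supercategory k (AOB F) where
  homPart X Y r := AOBHom.homPart F X.word Y.word r
  homPart_isCompl X Y := AOBHom.homPart_isCompl X.word Y.word
  id_mem X := ⟨_, HasParity.id X.word, rfl⟩
  comp_mem := AOBHom.comp_mem_homPart

instance : StrictMonoidalSupercategory k (AOB F) where
  one := ⟨[]⟩
  tensorObj X Y := ⟨X.word ++ Y.word⟩
  tensorHom := AOBHom.tensorₗ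
  tensorHom_mem := AOBHom.tensor_mem_homPart
  tensorHom_id X Y := AOBHom.sound (Rel.tensor_id X.word Y.word)
  interchange := fun {_ _ _ _ _ _ _} f' g' {_ _ _} hf hg => AOBHom.hom_interchange hf f' g' hg
  tensor_assoc X Y Z := congrArg AOB.mk (List.append_assoc _ _ _)
  one_tensor X := rfl
  tensor_one X := congrArg AOB.mk (List.append_nil X.word)
  tensorHom_assoc f g h := by
    rw [AOBHom.eqToHom_eq, AOBHom.eqToHom_eq]
    exact AOBHom.hom_tensor_assoc f g h
  one_tensorHom f := by
    rw [eqToHom_refl, eqToHom_refl, Category.id_comp, Category.comp_id]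
    exact AOBHom.hom_one_tensor f
  tensorHom_one f := by
    rw [AOBHom.eqToHom_eq, AOBHom.eqToHom_eq]
    exact AOBHom.hom_tensor_one f

namespace AOB

variable (F)

/-- The generating object `↑`. -/
def up : AOB F := ⟨[Orient.up]⟩

/-- The generating object `↓`. -/
def down : AOB F := ⟨[Orient.down]⟩

open StrictMonoidalSupercategory (tensorObj)

/-- The upward crossing. -/
def cross : tensorObj k (up F) (up F) ⟶ tensorObj k (up F) (up F) := AOBHom.mk F Pre.cross

/-- The token labelled by `a`. -/
def token (a : A) : up F ⟶ up F := AOBHom.mk F (Pre.token a)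

/-- The right cup. -/
def rcup : StrictMonoidalSupercategory.one k ⟶ tensorObj k (down F) (up F) :=
  AOBHom.mk F Pre.rcup

/-- The right cap. -/
def rcap : tensorObj k (up F) (down F) ⟶ StrictMonoidalSupercategory.one k :=
  AOBHom.mk F Pre.rcap

/-- The left cup. -/
def lcup : StrictMonoidalSupercategory.one k ⟶ tensorObj k (up F) (down F) :=
  AOBHom.mk F Pre.lcup

/-- The left cap. -/
def lcap : tensorObj k (down F) (up F) ⟶ StrictMonoidalSupercategory.one k :=
  AOBHom.mk F Pre.lcap

/-- The dot. -/
def dot : up F ⟶ up F := AOBHom.mk F Pre.dot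

end AOB

end AOBCategory


section Components

variable {k : Type v} [Field k] {G : Type w} [Ring G] [Algebra k G] [Superalgebra k G]

/-- The linear map underlying the component at `W` of a supernatural transformation between
superfunctors on supermodules. -/
def SEnd.appLin {P Q : SEnd k (SMod.{w, v, u} k G)} (α : P ⟶ Q) (W : SMod.{w, v, u} k G) :
    (P.obj W).carrier →ₗ[k] (Q.obj W).carrier :=
  SMod.toLin (SEnd.app α W)

end Components

end FrobeniusBrauer

end

/-!
The monoidal supercategory `AOB(A)` is given by generators and relations, so that a strict monoidal
superfunctor to the endosuperfunctors of a supercategory is the same as a choice of images of the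
generators which satisfies the relations (`AOBRep`, `AOBRep.functor`).  Morphisms of `AOB(A)` are
equivalence classes of expressions; an expression is evaluated recursively, and words are sent to
iterated composites of two superfunctors.

The images of the generators come from a pair of supermodules `V`, `V'` of a Lie superalgebra with
an even invariant bilinear form `V' × V → k` and dual families of vectors (`DualFamilies`,
`InvariantForm`).  The crossing is the superflip, the caps are the form and its superflip, and the
cups are the canonical tensors, which are invariant because the form is (`DualFamilies.sum_act`,
`DualFamilies.sum_act'`).  The relations without dots are identities of superlinear algebra: the
zigzag and curl relations expand a vector in dual families, and the sideways crossings built from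
cups, caps and the crossing are again superflips (`DualFamilies.right_cross`,
`DualFamilies.left_cross`), so that they are mutually inverse.

The dot is the action of a tensor `∑ M ⊗ N` on `V ⊗ W`.  It commutes with the Lie superalgebra when
the tensor is invariant (`omegaLin_act`).  On `V ⊗ (V ⊗ W)` it is the sum of the action on the two
outer factors and of the action on `V ⊗ V`; the former is the conjugate of a dot by the superflip,
so that the relation between dots and crossings says that on `V ⊗ V` the tensor acts as the superflip
followed by the teleporter `∑ b ⊗ b^∨` (`omegaLin_comp_flipLin_sub`).

For `𝔤𝔩_{m|n}(A)` both properties of `Ω` are instances of the two Casimir identities of a symmetric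
Frobenius superalgebra, which move a homogeneous element through `∑ b ⊗ b^∨`
(`SymmetricFrobenius.sum_mul_basis_tmul_dual`, `SymmetricFrobenius.sum_basis_mul_tmul_dual`).
Matrices over `A` form a symmetric Frobenius superalgebra with the supertrace, and `Ω` is its Casimir
element (`SymmetricFrobenius.matrix`, `SymmetricFrobenius.Omega_eq`), whence the invariance; the
identities for `A` itself give the action on `V₊ ⊗ V₊` (`sum_rowMul_tmul_rowMul`).
-/

noncomputable section

namespace FrobeniusBrauer

/-! ### Representations of the affine oriented Frobenius Brauer category by superfunctors -/

section Representation

variable {k : Type v} [Field k] {A : Type u} [Ring A] [Algebra k A] [Superalgebra k A]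
  {C : Type u₁} [Category.{v₁} C] [Preadditive C] [Linear k C] [Supercategory k C]

/-- Horizontal composition respects heterogeneous equality, which is used to remove the `eqToHom`s
between the superfunctors attached to differently bracketed words. -/
lemma hcomp_heq {F₁ F₁' G₁ G₁' F₂ F₂' G₂ G₂' : SEnd k C} (hF : F₁ = F₂) (hF' : F₁' = F₂')
    (hG : G₁ = G₂) (hG' : G₁' = G₂') {α₁ : F₁ ⟶ F₁'} {α₂ : F₂ ⟶ F₂'} {β₁ : G₁ ⟶ G₁'}
    {β₂ : G₂ ⟶ G₂'} (hα : HEq α₁ α₂) (hβ : HEq β₁ β₂) : HEq (hcomp α₁ β₁) (hcomp α₂ β₂) := by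
  subst hF hF' hG hG'
  rw [eq_of_heq hα, eq_of_heq hβ]

lemma eqToHom_comp_heq_self {D : Type u₂} [Category.{v₂} D] {X X' Y Y' : D} (h : X = X')
    (h' : Y' = Y) (f : X' ⟶ Y') : HEq (eqToHom h ≫ f ≫ eqToHom h') f := by
  subst h h'
  simp

lemma hcomp_heq_assoc {F F' G G' H H' : SEnd k C} (α : F ⟶ F') (β : G ⟶ G') (γ : H ⟶ H') :
    HEq (hcomp (hcomp α β) γ) (hcomp α (hcomp β γ)) := by
  have h := StrictMonoidalSupercategory.tensorHom_assoc (k := k) α β γ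
  exact (heq_of_eq h).trans (eqToHom_comp_heq_self _ _ _)

/-- The right crossing built from an upward crossing, a right cup and a right cap. -/
def rightCrossing {P Q : SEnd k C} (cross : superComp P P ⟶ superComp P P)
    (rcup : superId ⟶ superComp Q P) (rcap : superComp P Q ⟶ superId) :
    superComp P Q ⟶ superComp Q P :=
  (hcomp rcup (𝟙 (superComp P Q)) :
      superComp P Q ⟶ superComp (superComp Q (superComp P P)) Q) ≫
    hcomp (hcomp (𝟙 Q) cross) (𝟙 Q) ≫
      (hcomp (𝟙 (superComp Q P)) rcap :
        superComp (superComp Q (superComp P P)) Q ⟶ superComp Q P)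

/-- The left crossing built from an upward crossing, a left cup and a left cap. -/
def leftCrossing {P Q : SEnd k C} (cross : superComp P P ⟶ superComp P P)
    (lcup : superId ⟶ superComp P Q) (lcap : superComp Q P ⟶ superId) :
    superComp Q P ⟶ superComp P Q :=
  (hcomp (𝟙 (superComp Q P)) lcup :
      superComp Q P ⟶ superComp (superComp Q (superComp P P)) Q) ≫
    hcomp (hcomp (𝟙 Q) cross) (𝟙 Q) ≫
      (hcomp lcap (𝟙 (superComp P Q)) :
        superComp (superComp Q (superComp P P)) Q ⟶ superComp P Q)

lemma mapAs_heq {C : Type u₁} [Category.{v₁} C] [Preadditive C] [Linear k C]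
    [Supercategory k C] [StrictMonoidalSupercategory k C] {D : Type u₂} [Category.{v₂} D]
    [Preadditive D] [Linear k D] [Supercategory k D] [StrictMonoidalSupercategory k D]
    (Ψ : StrictMonoidalSuperfunctor k C D) {X Y : C} {P Q : D} (hX : Ψ.obj X = P)
    (hY : Ψ.obj Y = Q) (f : X ⟶ Y) : HEq (Ψ.mapAs hX hY f) (Ψ.map f) :=
  eqToHom_comp_heq_self _ _ _

/-- A representation of the generators and relations of `AOB(A)` in the strict monoidal
supercategory of endosuperfunctors of `C`, with `↑` acting by `P` and `↓` by `Q`.  The relations are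
stated on components: `α ⊗ 1` has the component `α_{G W}` and `1 ⊗ β` the component `F (β_W)`.  As
composition of superfunctors is associative and unital up to definitional equality, no coherence
morphisms occur. -/
structure AOBRep (F : SymmetricFrobenius k A) (P Q : SEnd k C) where
  cross : superComp P P ⟶ superComp P P
  token : A →ₗ[k] (P ⟶ P)
  rcup : superId ⟶ superComp Q P
  rcap : superComp P Q ⟶ superId
  lcup : superId ⟶ superComp P Q
  lcap : superComp Q P ⟶ superId
  dot : P ⟶ P
  cross_mem : cross ∈ Supercategory.homPart (k := k) (superComp P P) (superComp P P) 0
  token_mem : ∀ {r : ZMod 2} {a : A}, a ∈ part k A r →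
    token a ∈ Supercategory.homPart (k := k) P P r
  rcup_mem : rcup ∈ Supercategory.homPart (k := k) superId (superComp Q P) 0
  rcap_mem : rcap ∈ Supercategory.homPart (k := k) (superComp P Q) superId 0
  lcup_mem : lcup ∈ Supercategory.homPart (k := k) superId (superComp P Q) 0
  lcap_mem : lcap ∈ Supercategory.homPart (k := k) (superComp Q P) superId 0
  dot_mem : dot ∈ Supercategory.homPart (k := k) P P 0
  token_one : ∀ W, SEnd.app (token 1) W = 𝟙 (P.obj W)
  token_mul : ∀ a b W, SEnd.app (token b) W ≫ SEnd.app (token a) W = SEnd.app (token (a * b)) W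
  cross_cross : ∀ W, SEnd.app cross W ≫ SEnd.app cross W = 𝟙 (P.obj (P.obj W))
  braid : ∀ W, SEnd.app cross (P.obj W) ≫ P.map (SEnd.app cross W) ≫ SEnd.app cross (P.obj W) =
    P.map (SEnd.app cross W) ≫ SEnd.app cross (P.obj W) ≫ P.map (SEnd.app cross W)
  token_cross : ∀ a W, SEnd.app (token a) (P.obj W) ≫ SEnd.app cross W =
    SEnd.app cross W ≫ P.map (SEnd.app (token a) W)
  right_left : ∀ W, (SEnd.app rcup (P.obj (Q.obj W)) ≫ Q.map (SEnd.app cross (Q.obj W)) ≫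
      Q.map (P.map (SEnd.app rcap W))) ≫ Q.map (P.map (SEnd.app lcup W)) ≫
        Q.map (SEnd.app cross (Q.obj W)) ≫ SEnd.app lcap (P.obj (Q.obj W)) = 𝟙 (P.obj (Q.obj W))
  left_right : ∀ W, (Q.map (P.map (SEnd.app lcup W)) ≫
      Q.map (SEnd.app cross (Q.obj W)) ≫ SEnd.app lcap (P.obj (Q.obj W))) ≫
        SEnd.app rcup (P.obj (Q.obj W)) ≫ Q.map (SEnd.app cross (Q.obj W)) ≫
          Q.map (P.map (SEnd.app rcap W)) = 𝟙 (Q.obj (P.obj W))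
  left_curl : ∀ W, SEnd.app rcup (P.obj W) ≫ Q.map (SEnd.app cross W) ≫
    SEnd.app lcap (P.obj W) = 𝟙 (P.obj W)
  right_curl : ∀ W, P.map (SEnd.app lcup W) ≫ SEnd.app cross (Q.obj W) ≫
    P.map (SEnd.app rcap W) = 𝟙 (P.obj W)
  zigzag_up : ∀ W, P.map (SEnd.app rcup W) ≫ SEnd.app rcap (P.obj W) = 𝟙 (P.obj W)
  zigzag_down : ∀ W, SEnd.app rcup (Q.obj W) ≫ Q.map (SEnd.app rcap W) = 𝟙 (Q.obj W)
  dot_cross : ∀ W,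
    (SEnd.app cross W ≫ SEnd.app dot (P.obj W) : P.obj (P.obj W) ⟶ P.obj (P.obj W)) -
      (P.map (SEnd.app dot W) ≫ SEnd.app cross W : P.obj (P.obj W) ⟶ P.obj (P.obj W)) =
    ∑ b, P.map (SEnd.app (token (F.dual b)) W) ≫ SEnd.app (token (F.basis b)) (P.obj W)
  dot_token : ∀ a W, SEnd.app dot W ≫ SEnd.app (token a) W =
    SEnd.app (token a) W ≫ SEnd.app dot W

namespace AOBRep

variable {F : SymmetricFrobenius k A} {P Q : SEnd k C} (R : AOBRep F P Q)

lemma app_hcomp_id {P P' Q : SEnd k C} (α : P ⟶ P') (W : C) :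
    SEnd.app (hcomp α (𝟙 Q)) W = SEnd.app α (Q.obj W) :=
  (congrArg (· ≫ SEnd.app α (Q.obj W)) (P.map_id (Q.obj W))).trans (Category.id_comp _)

lemma app_id_hcomp {P Q Q' : SEnd k C} (β : Q ⟶ Q') (W : C) :
    SEnd.app (hcomp (𝟙 P) β) W = P.map (SEnd.app β W) :=
  Category.comp_id _

lemma app_comp_eq {P Q S : SEnd k C} {α : P ⟶ Q} {β : Q ⟶ S} {W : C} {f : P.obj W ⟶ Q.obj W}
    {g : Q.obj W ⟶ S.obj W} (hf : SEnd.app α W = f) (hg : SEnd.app β W = g) :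
    SEnd.app (α ≫ β) W = f ≫ g :=
  congrArg₂ (· ≫ ·) hf hg

lemma app_rightCrossing {P Q : SEnd k C} (cross : superComp P P ⟶ superComp P P)
    (rcup : superId ⟶ superComp Q P) (rcap : superComp P Q ⟶ superId) (W : C) :
    SEnd.app (rightCrossing cross rcup rcap) W = SEnd.app rcup (P.obj (Q.obj W)) ≫
      Q.map (SEnd.app cross (Q.obj W)) ≫ Q.map (P.map (SEnd.app rcap W)) :=
  app_comp_eq (app_hcomp_id rcup W) (app_comp_eq
    ((app_hcomp_id (hcomp (𝟙 Q) cross) W).trans (app_id_hcomp cross (Q.obj W)))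
    (app_id_hcomp rcap W))

lemma app_leftCrossing {P Q : SEnd k C} (cross : superComp P P ⟶ superComp P P)
    (lcup : superId ⟶ superComp P Q) (lcap : superComp Q P ⟶ superId) (W : C) :
    SEnd.app (leftCrossing cross lcup lcap) W = Q.map (P.map (SEnd.app lcup W)) ≫
      Q.map (SEnd.app cross (Q.obj W)) ≫ SEnd.app lcap (P.obj (Q.obj W)) :=
  app_comp_eq (app_id_hcomp lcup W) (app_comp_eq
    ((app_hcomp_id (hcomp (𝟙 Q) cross) W).trans (app_id_hcomp cross (Q.obj W)))
    (app_hcomp_id lcap W))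

lemma hcomp_token_cross (a : A) :
    hcomp (R.token a) (𝟙 P) ≫ R.cross = R.cross ≫ hcomp (𝟙 P) (R.token a) :=
  SEnd.hom_ext fun W => (app_comp_eq (app_hcomp_id (Q := P) (R.token a) W) rfl).trans
    ((R.token_cross a W).trans (app_comp_eq rfl (app_id_hcomp (P := P) (R.token a) W)).symm)

lemma hcomp_braid :
    (hcomp R.cross (𝟙 P) :
        superComp P (superComp P P) ⟶ superComp P (superComp P P)) ≫
      hcomp (𝟙 P) R.cross ≫ hcomp R.cross (𝟙 P) =
    hcomp (𝟙 P) R.cross ≫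
      (hcomp R.cross (𝟙 P) :
        superComp P (superComp P P) ⟶ superComp P (superComp P P)) ≫
        hcomp (𝟙 P) R.cross :=
  SEnd.hom_ext fun W => by
    have h := app_hcomp_id (Q := P) R.cross W
    have h' := app_id_hcomp (P := P) R.cross W
    exact (app_comp_eq h (app_comp_eq h' h)).trans ((R.braid W).trans
      (app_comp_eq h' (app_comp_eq h h')).symm)

lemma hcomp_left_curl : (hcomp R.rcup (𝟙 P) : P ⟶ superComp Q (superComp P P)) ≫
    hcomp (𝟙 Q) R.cross ≫
      (hcomp R.lcap (𝟙 P) : superComp Q (superComp P P) ⟶ P) = 𝟙 P :=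
  SEnd.hom_ext fun W => (app_comp_eq (app_hcomp_id (Q := P) R.rcup W)
    (app_comp_eq (app_id_hcomp (P := Q) R.cross W) (app_hcomp_id (Q := P) R.lcap W))).trans
      (R.left_curl W)

lemma hcomp_right_curl : (hcomp (𝟙 P) R.lcup : P ⟶ superComp (superComp P P) Q) ≫
    hcomp R.cross (𝟙 Q) ≫
      (hcomp (𝟙 P) R.rcap : superComp (superComp P P) Q ⟶ P) = 𝟙 P :=
  SEnd.hom_ext fun W => (app_comp_eq (app_id_hcomp (P := P) R.lcup W)
    (app_comp_eq (app_hcomp_id (Q := Q) R.cross W) (app_id_hcomp (P := P) R.rcap W))).trans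
      (R.right_curl W)

lemma hcomp_zigzag_up : (hcomp (𝟙 P) R.rcup : P ⟶ superComp P (superComp Q P)) ≫
    (hcomp R.rcap (𝟙 P) : superComp P (superComp Q P) ⟶ P) = 𝟙 P :=
  SEnd.hom_ext fun W => (app_comp_eq (app_id_hcomp (P := P) R.rcup W)
    (app_hcomp_id (Q := P) R.rcap W)).trans (R.zigzag_up W)

lemma hcomp_zigzag_down : (hcomp R.rcup (𝟙 Q) : Q ⟶ superComp Q (superComp P Q)) ≫
    (hcomp (𝟙 Q) R.rcap : superComp Q (superComp P Q) ⟶ Q) = 𝟙 Q :=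
  SEnd.hom_ext fun W => (app_comp_eq (app_hcomp_id (Q := Q) R.rcup W)
    (app_id_hcomp (P := Q) R.rcap W)).trans (R.zigzag_down W)

lemma app_sum {P Q : SEnd k C} {ι : Type} [Fintype ι] (α : ι → (P ⟶ Q)) (W : C) :
    SEnd.app (∑ i, α i) W = ∑ i, SEnd.app (α i) W := by
  let e : (P ⟶ Q) →+ (P.obj W ⟶ Q.obj W) :=
    { toFun := fun α => SEnd.app α W, map_zero' := rfl, map_add' := fun _ _ => rfl }
  exact map_sum e α Finset.univ

lemma hcomp_dot_cross : R.cross ≫ hcomp R.dot (𝟙 P) - hcomp (𝟙 P) R.dot ≫ R.cross =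
    ∑ b, hcomp (𝟙 P) (R.token (F.dual b)) ≫ hcomp (R.token (F.basis b)) (𝟙 P) :=
  SEnd.hom_ext fun W => by
    have h₁ : SEnd.app (R.cross ≫ hcomp R.dot (𝟙 P)) W =
        SEnd.app R.cross W ≫ SEnd.app R.dot (P.obj W) :=
      app_comp_eq rfl (app_hcomp_id (Q := P) R.dot W)
    have h₂ : SEnd.app (hcomp (𝟙 P) R.dot ≫ R.cross) W =
        P.map (SEnd.app R.dot W) ≫ SEnd.app R.cross W :=
      app_comp_eq (app_id_hcomp (P := P) R.dot W) rfl
    refine Eq.trans (congrArg₂ (fun f g : P.obj (P.obj W) ⟶ P.obj (P.obj W) => f - g)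
      h₁ h₂) ((R.dot_cross W).trans (Eq.symm ?_))
    refine (app_sum (P := superComp P P) (Q := superComp P P) (fun b =>
      hcomp (𝟙 P) (R.token (F.dual b)) ≫ hcomp (R.token (F.basis b)) (𝟙 P)) W).trans ?_
    exact Finset.sum_congr rfl fun b _ => app_comp_eq
      (app_id_hcomp (P := P) (R.token (F.dual b)) W)
      (app_hcomp_id (Q := P) (R.token (F.basis b)) W)

variable (P Q) in
/-- The superfunctor attached to a word in `↑` and `↓`. -/
def wordObj : List Orient → SEnd k C
  | [] => superId
  | .up :: X => superComp P (wordObj X)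
  | .down :: X => superComp Q (wordObj X)

variable (P Q) in
lemma wordObj_append : ∀ X Y : List Orient,
    wordObj P Q (X ++ Y) = superComp (wordObj P Q X) (wordObj P Q Y)
  | [], _ => rfl
  | .up :: X, Y => congrArg (superComp P) (wordObj_append X Y)
  | .down :: X, Y => congrArg (superComp Q) (wordObj_append X Y)

/-- The supernatural transformation attached to an expression in the generators. -/
def eval : ∀ {X Y : List Orient}, Pre k A X Y → (wordObj P Q X ⟶ wordObj P Q Y)
  | _, _, .id X => 𝟙 (wordObj P Q X)
  | _, _, .comp f g => eval f ≫ eval g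
  | _, _, .tensor f g =>
      eqToHom (wordObj_append P Q _ _) ≫ hcomp (eval f) (eval g) ≫ eqToHom (wordObj_append P Q _ _).symm
  | _, _, .zero _ _ => 0
  | _, _, .add f g => eval f + eval g
  | _, _, .smul c f => c • eval f
  | _, _, .cross => R.cross
  | _, _, .token a => R.token a
  | _, _, .rcup => R.rcup
  | _, _, .rcap => R.rcap
  | _, _, .lcup => R.lcup
  | _, _, .lcap => R.lcap
  | _, _, .dot => R.dot

variable {X Y Z X' Y' Z' : List Orient}

lemma eval_tensor_heq (f : Pre k A X Y) (g : Pre k A X' Y') :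
    HEq (R.eval (.tensor f g)) (hcomp (R.eval f) (R.eval g)) :=
  eqToHom_comp_heq_self _ _ _

lemma eval_sum {X Y : List Orient} {ι : Type} (e : ι → Pre k A X Y) (l : List ι) :
    R.eval (Pre.sum (l.map e)) = (l.map fun i => R.eval (e i)).sum := by
  induction l with
  | nil => rfl
  | cons i l ih =>
    rw [List.map_cons, List.map_cons, List.sum_cons, ← ih]
    rfl

lemma eqToHom_mem {D : Type u₂} [Category.{v₂} D] [Preadditive D] [Linear k D]
    [Supercategory k D] {X Y : D} (h : X = Y) :
    eqToHom h ∈ Supercategory.homPart (k := k) X Y 0 := by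
  subst h
  exact Supercategory.id_mem X

lemma eval_mem {X Y : List Orient} {f : Pre k A X Y} {r : ZMod 2} (h : HasParity f r) :
    R.eval f ∈ Supercategory.homPart (k := k) (wordObj P Q X) (wordObj P Q Y) r := by
  induction h with
  | id X => exact Supercategory.id_mem _
  | comp _ _ hf hg => exact Supercategory.comp_mem hf hg
  | @tensor X Y X' Y' f g r s _ _ hf hg =>
    have h := Supercategory.comp_mem (eqToHom_mem (k := k) (wordObj_append P Q X X'))
      (Supercategory.comp_mem (StrictMonoidalSupercategory.tensorHom_mem hf hg)
        (eqToHom_mem (k := k) (wordObj_append P Q Y Y').symm))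
    rw [zero_add, add_zero] at h
    exact h
  | zero X Y r => exact zero_mem _
  | add _ _ hf hg => exact add_mem hf hg
  | smul c _ hf => exact Submodule.smul_mem _ c hf
  | cross => exact R.cross_mem
  | token ha => exact R.token_mem ha
  | rcup => exact R.rcup_mem
  | rcap => exact R.rcap_mem
  | lcup => exact R.lcup_mem
  | lcap => exact R.lcap_mem
  | dot => exact R.dot_mem

open Orient

lemma eval_rightCross : R.eval .rightCross = rightCrossing R.cross R.rcup R.rcap :=
  congrArg₂ (· ≫ ·) (eq_of_heq (R.eval_tensor_heq .rcup (.id [up, down])))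
    (congrArg₂ (· ≫ ·) (eq_of_heq ((R.eval_tensor_heq (.tensor (.id [down]) .cross)
      (.id [down])).trans (hcomp_heq rfl rfl rfl rfl (R.eval_tensor_heq (.id [down]) .cross)
        HEq.rfl))) (eq_of_heq (R.eval_tensor_heq (.id [down, up]) .rcap)))

lemma eval_leftCross : R.eval .leftCross = leftCrossing R.cross R.lcup R.lcap :=
  congrArg₂ (· ≫ ·) (eq_of_heq (R.eval_tensor_heq (.id [down, up]) .lcup))
    (congrArg₂ (· ≫ ·) (eq_of_heq ((R.eval_tensor_heq (.tensor (.id [down]) .cross)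
      (.id [down])).trans (hcomp_heq rfl rfl rfl rfl (R.eval_tensor_heq (.id [down]) .cross)
        HEq.rfl))) (eq_of_heq (R.eval_tensor_heq .lcap (.id [up, down]))))

lemma eval_crossLeft : R.eval .crossLeft =
    (hcomp R.cross (𝟙 P) :
      superComp P (superComp P P) ⟶ superComp P (superComp P P)) :=
  eq_of_heq (R.eval_tensor_heq .cross (.id [up]))

lemma eval_crossRight : R.eval .crossRight = hcomp (𝟙 P) R.cross :=
  eq_of_heq (R.eval_tensor_heq (.id [up]) .cross)

lemma eval_sandwich {h : X = X'} {h' : Y' = Y} (f : Pre k A X' Y') :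
    HEq (R.eval (.comp (.ofEq h) (.comp f (.ofEq h')))) (R.eval f) := by
  subst h h'
  exact heq_of_eq ((Category.id_comp _).trans (Category.comp_id _))

lemma eval_dot_cross_terms : R.eval (Pre.sum ((Finset.univ : Finset F.ι).toList.map fun b =>
      .comp (.tensor (.id [up]) (.token (F.dual b))) (.tensor (.token (F.basis b)) (.id [up])))) =
    ∑ b, hcomp (𝟙 P) (R.token (F.dual b)) ≫ hcomp (R.token (F.basis b)) (𝟙 P) := by
  rw [eval_sum, Finset.sum_map_toList]
  exact Finset.sum_congr rfl fun b _ => congrArg₂ (· ≫ ·)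
    (eq_of_heq (R.eval_tensor_heq (.id [up]) (.token (F.dual b))))
    (eq_of_heq (R.eval_tensor_heq (.token (F.basis b)) (.id [up])))

/-- The relations hold in the representation, so that it is well defined on morphisms. -/
lemma eval_rel {X Y : List Orient} {f g : Pre k A X Y} (h : Rel F f g) :
    R.eval f = R.eval g := by
  induction h with
  | refl f => rfl
  | symm _ h => exact h.symm
  | trans _ _ h h' => exact h.trans h'
  | congr_comp _ _ h h' => simp only [eval, h, h']
  | congr_tensor _ _ h h' => simp only [eval, h, h']
  | congr_add _ _ h h' => simp only [eval, h, h']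
  | congr_smul c _ h => simp only [eval, h]
  | add_comm f g => exact add_comm _ _
  | add_assoc f g h => exact add_assoc _ _ _
  | zero_add f => exact zero_add _
  | one_smul f => exact one_smul _ _
  | mul_smul c d f => exact mul_smul _ _ _
  | smul_add c f g => exact smul_add _ _ _
  | add_smul c d f => exact add_smul _ _ _
  | zero_smul f => exact zero_smul _ _
  | add_comp f f' g => exact Preadditive.add_comp _ _ _ _ _ _
  | comp_add f g g' => exact Preadditive.comp_add _ _ _ _ _ _
  | smul_comp c f g => exact Linear.smul_comp _ _ _ _ _ _
  | comp_smul c f g => exact Linear.comp_smul _ _ _ _ _ _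
  | id_comp f => exact Category.id_comp _
  | comp_id f => exact Category.comp_id _
  | comp_assoc f g h => exact Category.assoc _ _ _
  | add_tensor f f' g => simp [eval]
  | tensor_add f g g' => simp [eval]
  | smul_tensor c f g => simp [eval]
  | tensor_smul c f g => simp [eval]
  | tensor_id X Y =>
    have h := StrictMonoidalSupercategory.tensorHom_id (k := k) (wordObj P Q X) (wordObj P Q Y)
    change hcomp (𝟙 (wordObj P Q X)) (𝟙 (wordObj P Q Y)) = 𝟙 _ at h
    simp [eval, h]
  | @interchange X Y Z X' Y' Z' f f' g' g r s hf hg =>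
    have h := StrictMonoidalSupercategory.interchange (k := k) (R.eval f') (R.eval g')
      (R.eval_mem hf) (R.eval_mem hg)
    change hcomp _ _ ≫ hcomp _ _ = sgn k (r * s) • hcomp _ _ at h
    simp only [eval, Category.assoc, eqToHom_trans_assoc, eqToHom_refl, Category.id_comp]
    rw [reassoc_of% h]
    simp
  | @tensor_assoc X Y X' Y' X'' Y'' f g h =>
    refine eq_of_heq ((R.eval_tensor_heq _ _).trans (HEq.trans ?_
      ((R.eval_sandwich _).trans (R.eval_tensor_heq _ _)).symm))
    refine (hcomp_heq (wordObj_append P Q _ _) (wordObj_append P Q _ _) rfl rfl (R.eval_tensor_heq f g)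
      HEq.rfl).trans ((hcomp_heq_assoc _ _ _).trans (HEq.symm ?_))
    exact hcomp_heq rfl rfl (wordObj_append P Q _ _) (wordObj_append P Q _ _) HEq.rfl (R.eval_tensor_heq g h)
  | one_tensor f =>
    have h := StrictMonoidalSupercategory.one_tensorHom (k := k) (R.eval f)
    exact eq_of_heq ((R.eval_tensor_heq _ _).trans ((heq_of_eq h).trans
      (eqToHom_comp_heq_self _ _ _)))
  | tensor_one f =>
    have h := StrictMonoidalSupercategory.tensorHom_one (k := k) (R.eval f)
    exact eq_of_heq ((R.eval_tensor_heq _ _).trans ((heq_of_eq h).trans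
      ((eqToHom_comp_heq_self _ _ _).trans (R.eval_sandwich f).symm)))
  | token_one => exact SEnd.hom_ext R.token_one
  | token_lin c d a b =>
    simp only [eval, map_add, map_smul]
    rfl
  | token_mul a b => exact SEnd.hom_ext (R.token_mul a b)
  | cross_cross => exact SEnd.hom_ext R.cross_cross
  | braid =>
    simp only [eval, eval_crossLeft, eval_crossRight]
    exact R.hcomp_braid
  | token_cross a =>
    exact (congrArg (· ≫ R.cross) (eq_of_heq (R.eval_tensor_heq (.token a) (.id [up])))).trans
      ((R.hcomp_token_cross a).trans (congrArg (R.cross ≫ ·)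
        (eq_of_heq (R.eval_tensor_heq (.id [up]) (.token a))).symm))
  | right_left =>
    simp only [eval, eval_rightCross, eval_leftCross]
    exact SEnd.hom_ext fun W => (app_comp_eq (app_rightCrossing _ _ _ W)
      (app_leftCrossing _ _ _ W)).trans (R.right_left W)
  | left_right =>
    simp only [eval, eval_rightCross, eval_leftCross]
    exact SEnd.hom_ext fun W => (app_comp_eq (app_leftCrossing _ _ _ W)
      (app_rightCrossing _ _ _ W)).trans (R.left_right W)
  | left_curl =>
    exact (congrArg₂ (· ≫ ·) (eq_of_heq (R.eval_tensor_heq .rcup (.id [up])))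
      (congrArg₂ (· ≫ ·) (eq_of_heq (R.eval_tensor_heq (.id [down]) .cross))
        (eq_of_heq (R.eval_tensor_heq .lcap (.id [up]))))).trans R.hcomp_left_curl
  | right_curl =>
    exact (congrArg₂ (· ≫ ·) (eq_of_heq (R.eval_tensor_heq (.id [up]) .lcup))
      (congrArg₂ (· ≫ ·) (eq_of_heq (R.eval_tensor_heq .cross (.id [down])))
        (eq_of_heq (R.eval_tensor_heq (.id [up]) .rcap)))).trans R.hcomp_right_curl
  | zigzag_up =>
    exact (congrArg₂ (· ≫ ·) (eq_of_heq (R.eval_tensor_heq (.id [up]) .rcup))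
      (eq_of_heq (R.eval_tensor_heq .rcap (.id [up])))).trans R.hcomp_zigzag_up
  | zigzag_down =>
    exact (congrArg₂ (· ≫ ·) (eq_of_heq (R.eval_tensor_heq .rcup (.id [down])))
      (eq_of_heq (R.eval_tensor_heq (.id [down]) .rcap))).trans R.hcomp_zigzag_down
  | dot_cross =>
    have h1 : R.eval (.comp .cross (.tensor .dot (.id [up]))) = R.cross ≫ hcomp R.dot (𝟙 P) :=
      congrArg (R.cross ≫ ·) (eq_of_heq (R.eval_tensor_heq .dot (.id [up])))
    have h2 : R.eval (.comp (.tensor (.id [up]) .dot) .cross) = hcomp (𝟙 P) R.dot ≫ R.cross :=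
      congrArg (· ≫ R.cross) (eq_of_heq (R.eval_tensor_heq (.id [up]) .dot))
    refine Eq.trans ?_ (R.hcomp_dot_cross.trans R.eval_dot_cross_terms.symm)
    rw [sub_eq_add_neg, ← neg_one_smul k (hcomp (𝟙 P) R.dot ≫ R.cross)]
    exact congrArg₂ (fun α β : superComp P P ⟶ superComp P P => α + (-1 : k) • β) h1 h2
  | dot_token a => exact SEnd.hom_ext (R.dot_token a)

/-- The strict monoidal superfunctor defined by a representation of the generators and
relations. -/
def functor : StrictMonoidalSuperfunctor k (AOB F) (SEnd k C) where
  obj X := wordObj P Q X.word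
  map {X Y} := Quotient.lift (s := relSetoid F X.word Y.word) R.eval fun _ _ h => R.eval_rel h
  map_id X := rfl
  map_comp {X Y Z} := AOBHom.ind fun f => AOBHom.ind fun g => rfl
  map_add {X Y} := AOBHom.ind fun f => AOBHom.ind fun g => rfl
  map_smul {X Y} c := AOBHom.ind fun f => rfl
  map_mem := by
    rintro X Y _ r ⟨f, hf, rfl⟩
    exact R.eval_mem hf
  obj_one := rfl
  obj_tensor X Y := wordObj_append P Q X.word Y.word
  map_tensor {X Y X' Y'} := AOBHom.ind fun f => AOBHom.ind fun g => rfl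

/-- A representation of the generators and relations extends to a strict monoidal superfunctor. -/
lemma exists_functor :
    ∃ (Ψ : StrictMonoidalSuperfunctor k (AOB F) (SEnd k C)) (hu : Ψ.obj (AOB.up F) = P)
      (hd : Ψ.obj (AOB.down F) = Q),
      Ψ.mapAs (Ψ.tensor_eq hu hu) (Ψ.tensor_eq hu hu) (AOB.cross F) = R.cross ∧
      (∀ a, Ψ.mapAs hu hu (AOB.token F a) = R.token a) ∧
      Ψ.mapAs Ψ.obj_one (Ψ.tensor_eq hd hu) (AOB.rcup F) = R.rcup ∧
      Ψ.mapAs Ψ.obj_one (Ψ.tensor_eq hu hd) (AOB.lcup F) = R.lcup ∧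
      Ψ.mapAs (Ψ.tensor_eq hu hd) Ψ.obj_one (AOB.rcap F) = R.rcap ∧
      Ψ.mapAs (Ψ.tensor_eq hd hu) Ψ.obj_one (AOB.lcap F) = R.lcap ∧
      Ψ.mapAs hu hu (AOB.dot F) = R.dot :=
  ⟨R.functor, rfl, rfl, eq_of_heq (mapAs_heq R.functor _ _ _),
    fun _ => eq_of_heq (mapAs_heq R.functor _ _ _), eq_of_heq (mapAs_heq R.functor _ _ _),
    eq_of_heq (mapAs_heq R.functor _ _ _), eq_of_heq (mapAs_heq R.functor _ _ _),
    eq_of_heq (mapAs_heq R.functor _ _ _), eq_of_heq (mapAs_heq R.functor _ _ _)⟩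
end AOBRep

end Representation

/-! ### Supernatural transformations between superfunctors on supermodules -/

section Components

variable {k : Type v} [Field k] {G : Type w} [Ring G] [Algebra k G] [Superalgebra k G]

/-- A linear map which commutes with the action of homogeneous elements is a morphism of
supermodules. -/
def SMod.homOfHomogeneous {V W : SMod.{w, v, u} k G} (f : V.carrier →ₗ[k] W.carrier)
    (hf : ∀ t, ∀ M ∈ part k G t, f ∘ₗ V.rmul M = W.rmul M ∘ₗ f) : V ⟶ W :=
  ⟨f, fun z M => by
    refine hom_induction (k := k) (P := fun M => f (V.act z M) = W.act (f z) M) ?_ ?_ M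
    · intro M N hM hN
      rw [map_add, map_add, map_add, hM, hN]
    · intro t M hM
      exact LinearMap.congr_fun (hf t M hM) z⟩

/-- An even supernatural transformation, given by a family of even linear maps which commute
with the action of homogeneous elements and with homogeneous morphisms. -/
def evenTrans {P Q : SEnd k (SMod.{w, v, u} k G)}
    (α : ∀ W, (P.obj W).carrier →ₗ[k] (Q.obj W).carrier)
    (hact : ∀ W (t : ZMod 2), ∀ M ∈ part k G t,
      α W ∘ₗ (P.obj W).rmul M = (Q.obj W).rmul M ∘ₗ α W)
    (hmem : ∀ W, α W ∈ linPart k (P.obj W).carrier (Q.obj W).carrier 0)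
    (hnat : ∀ (W W' : SMod.{w, v, u} k G) (f : W ⟶ W') (s : ZMod 2),
      SMod.toLin f ∈ linPart k W.carrier W'.carrier s →
      SMod.toLin (Q.map f) ∘ₗ α W = α W' ∘ₗ SMod.toLin (P.map f)) : P ⟶ Q :=
  ⟨fun W => SMod.homOfHomogeneous (α W) (hact W),
    supernat_le _ _ 0 ⟨hmem, fun W W' f s hf => by
      rw [zero_mul, sgn_zero, one_smul]
      exact Subtype.ext (hnat W W' f s hf)⟩⟩

lemma evenTrans_mem {P Q : SEnd k (SMod.{w, v, u} k G)}
    (α : ∀ W, (P.obj W).carrier →ₗ[k] (Q.obj W).carrier) (hact hmem hnat) :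
    (evenTrans α hact hmem hnat : P ⟶ Q) ∈ Supercategory.homPart (k := k) P Q 0 :=
  ⟨hmem, fun W W' f s hf => by
    rw [zero_mul, sgn_zero, one_smul]
    exact Subtype.ext (hnat W W' f s hf)⟩

end Components

/-! ### Superlinear algebra of twofold and threefold tensor products -/

section SuperAct

variable {k : Type v} [Field k] {V : Type u} {W : Type u₂} [AddCommGroup V] [Module k V]
  [AddCommGroup W] [Module k W] [SuperSpace k W]

/-- The action on `V ⊗ W` of an element of parity `t` of a Lie superalgebra which acts by `ρ` on
`V` and by `σ` on `W`. -/
def superAct (t : ZMod 2) (ρ : V →ₗ[k] V) (σ : W →ₗ[k] W) : V ⊗[k] W →ₗ[k] V ⊗[k] W :=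
  σ.lTensor V + TensorProduct.map ρ (twist k t)

lemma superAct_tmul (t : ZMod 2) (ρ : V →ₗ[k] V) (σ : W →ₗ[k] W) (x : V) (y : W) :
    superAct t ρ σ (x ⊗ₜ y) = x ⊗ₜ σ y + ρ x ⊗ₜ twist k t y := rfl

end SuperAct

section SuperAct₃

variable {k : Type v} [Field k] {V : Type u} {V' : Type u₁} {W : Type u₂}
  [AddCommGroup V] [Module k V] [AddCommGroup V'] [Module k V'] [SuperSpace k V']
  [AddCommGroup W] [Module k W] [SuperSpace k W]

lemma twist_tmul {s : ZMod 2} {x : V'} (hx : x ∈ part k V' s) (r : ZMod 2) (y : W) :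
    twist k r (x ⊗ₜ[k] y) = sgn k (r * s) • (x ⊗ₜ[k] twist k r y) := by
  refine hom_induction (k := k) (P := fun y => twist k r (x ⊗ₜ[k] y) =
    sgn k (r * s) • (x ⊗ₜ[k] twist k r y)) ?_ ?_ y
  · intro y z hy hz
    rw [tmul_add, map_add, map_add, tmul_add, smul_add, hy, hz]
  · intro t y hy
    rw [twist_of_mem (tmul_mem hx hy), twist_of_mem hy, tmul_smul, smul_smul, mul_add, sgn_add]

lemma superAct_tmul₃ (t : ZMod 2) (ρ : V →ₗ[k] V) (ρ' : V' →ₗ[k] V') (σ : W →ₗ[k] W) (x : V)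
    {s : ZMod 2} {y : V'} (hy : y ∈ part k V' s) (z : W) :
    superAct t ρ (superAct t ρ' σ) (x ⊗ₜ (y ⊗ₜ z)) =
      x ⊗ₜ (y ⊗ₜ σ z) + x ⊗ₜ (ρ' y ⊗ₜ twist k t z) +
        sgn k (t * s) • (ρ x ⊗ₜ (y ⊗ₜ twist k t z)) := by
  rw [superAct_tmul, superAct_tmul, twist_tmul hy, tmul_add, tmul_smul]

end SuperAct₃

section TensorMaps

variable {k : Type v} [Field k] {V : Type u} {V' : Type u₁} {W : Type u₂} {U : Type w}
  [AddCommGroup V] [Module k V] [SuperSpace k V] [AddCommGroup V'] [Module k V'] [SuperSpace k V']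
  [AddCommGroup W] [Module k W] [AddCommGroup U] [Module k U]

lemma tensor_hom_ext₃ {f g : V ⊗[k] (V' ⊗[k] W) →ₗ[k] U}
    (h : ∀ r, ∀ x ∈ part k V r, ∀ s, ∀ y ∈ part k V' s, ∀ z,
      f (x ⊗ₜ (y ⊗ₜ z)) = g (x ⊗ₜ (y ⊗ₜ z))) : f = g := by
  refine tensor_hom_ext fun r x hx z => ?_
  have e : f ∘ₗ TensorProduct.mk k V (V' ⊗[k] W) x = g ∘ₗ TensorProduct.mk k V (V' ⊗[k] W) x :=
    tensor_hom_ext fun s y hy z => h r x hx s y hy z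
  exact LinearMap.congr_fun e z

variable (k V V' W) in
/-- The superflip `x ⊗ y ⊗ z ↦ (-1)^{x̄ ȳ} y ⊗ x ⊗ z` of the first two tensor factors
(see `flipLin_tmul`). -/
def flipLin : V ⊗[k] (V' ⊗[k] W) →ₗ[k] V' ⊗[k] (V ⊗[k] W) :=
  ∑ r, (TensorProduct.leftComm k V V' W).toLinearMap ∘ₗ
    TensorProduct.map (proj k r) ((twist k r).rTensor W)

lemma flipLin_tmul {r s : ZMod 2} {x : V} (hx : x ∈ part k V r) {y : V'} (hy : y ∈ part k V' s)
    (z : W) : flipLin k V V' W (x ⊗ₜ (y ⊗ₜ z)) = sgn k (r * s) • (y ⊗ₜ (x ⊗ₜ z)) := by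
  have h := sum_proj_of_mem hx
    (fun r x => (twist k r y : V') ⊗ₜ[k] (x ⊗ₜ[k] z)) (fun s => by simp)
  simp only [flipLin, LinearMap.sum_apply, LinearMap.comp_apply, TensorProduct.map_tmul,
    LinearMap.rTensor_tmul, LinearEquiv.coe_coe, TensorProduct.leftComm_tmul]
  rw [h, twist_of_mem hy, smul_tmul']

variable [SuperSpace k W]

lemma linPart_of_tmul [SuperSpace k U] {f : V ⊗[k] W →ₗ[k] U} {r : ZMod 2}
    (h : ∀ s, ∀ x ∈ part k V s, ∀ t, ∀ y ∈ part k W t, f (x ⊗ₜ y) ∈ part k U (s + t + r)) :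
    f ∈ linPart k (V ⊗[k] W) U r := by
  intro s z hz
  change z ∈ tensorPart k V W s at hz
  induction hz using Submodule.span_induction with
  | mem z hz =>
    obtain ⟨a, b, rfl, x, hx, y, hy, rfl⟩ := hz
    exact h a x hx b y hy
  | zero => simp
  | add x y _ _ hx hy => rw [map_add]; exact add_mem hx hy
  | smul c x _ hx => rw [map_smul]; exact Submodule.smul_mem _ c hx

lemma linPart_of_tmul₃ [SuperSpace k U] {f : V ⊗[k] (V' ⊗[k] W) →ₗ[k] U} {r : ZMod 2}
    (h : ∀ s, ∀ x ∈ part k V s, ∀ t, ∀ y ∈ part k V' t, ∀ a, ∀ z ∈ part k W a,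
      f (x ⊗ₜ (y ⊗ₜ z)) ∈ part k U (s + t + a + r)) :
    f ∈ linPart k (V ⊗[k] (V' ⊗[k] W)) U r := by
  refine linPart_of_tmul fun s x hx t z hz => ?_
  have e : f ∘ₗ TensorProduct.mk k V (V' ⊗[k] W) x ∈ linPart k (V' ⊗[k] W) U (s + r) :=
    linPart_of_tmul fun a y hy b z hz => by
      have := h s x hx a y hy b z hz
      rwa [show s + a + b + r = a + b + (s + r) by ring] at this
  have := e t z hz
  rwa [show t + (s + r) = s + t + r by ring] at this

/-- Maps of parity `t` commute with the sign maps up to a sign. -/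
lemma twist_apply_of_linPart {t : ZMod 2} {f : V →ₗ[k] W} (hf : f ∈ linPart k V W t) (s : ZMod 2)
    (x : V) : twist k s (f x) = sgn k (s * t) • f (twist k s x) := by
  refine hom_induction (k := k)
    (P := fun x => twist k s (f x) = sgn k (s * t) • f (twist k s x)) ?_ ?_ x
  · intro x y hx hy
    simp only [map_add, hx, hy, smul_add]
  · intro d y hy
    rw [twist_of_mem (hf d y hy), twist_of_mem hy, map_smul, smul_smul, mul_add, sgn_add, mul_comm]

section SuperTensor

variable [SuperSpace k U]

variable (V) in
/-- The map `1 ⊗ f` with its signs, `x ⊗ y ↦ (-1)^{f̄ x̄} x ⊗ f(y)`, for arbitrary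
superspaces (see `superLTensor_tmul`); `tensorLeftMap` is the case of carriers of supermodules. -/
def superLTensor (f : W →ₗ[k] U) : V ⊗[k] W →ₗ[k] V ⊗[k] U :=
  ∑ s, TensorProduct.map (proj k s) (twist k s ∘ₗ f ∘ₗ twist k s)

lemma superLTensor_tmul {a r : ZMod 2} {f : W →ₗ[k] U} (hf : f ∈ linPart k W U a) {x : V}
    (hx : x ∈ part k V r) (y : W) :
    superLTensor V f (x ⊗ₜ y) = sgn k (a * r) • (x ⊗ₜ f y) := by
  have h := sum_proj_of_mem hx
    (fun s x => x ⊗ₜ[k] (twist k s (f (twist k s y)) : U)) (fun s => by simp)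
  simp only [superLTensor, LinearMap.sum_apply, TensorProduct.map_tmul, LinearMap.comp_apply]
  rw [h, twist_apply_of_linPart hf, twist_twist, tmul_smul, mul_comm]

/-- For even maps the signs disappear. -/
lemma superLTensor_even {f : W →ₗ[k] U} (hf : f ∈ linPart k W U 0) :
    superLTensor V f = f.lTensor V :=
  tensor_hom_ext fun r x hx y => by
    rw [superLTensor_tmul hf hx, zero_mul, sgn_zero, one_smul, LinearMap.lTensor_tmul]

lemma superLTensor_mem {a : ZMod 2} {f : W →ₗ[k] U} (hf : f ∈ linPart k W U a) :
    superLTensor V f ∈ linPart k (V ⊗[k] W) (V ⊗[k] U) a :=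
  linPart_of_tmul fun s x hx t y hy => by
    rw [superLTensor_tmul hf hx, add_assoc]
    exact Submodule.smul_mem _ _ (tmul_mem hx (hf t y hy))

lemma superLTensor_tmul₃ {a r s : ZMod 2} {f : W →ₗ[k] U} (hf : f ∈ linPart k W U a) {x : V}
    (hx : x ∈ part k V r) {y : V'} (hy : y ∈ part k V' s) (z : W) :
    superLTensor V (superLTensor V' f) (x ⊗ₜ (y ⊗ₜ z)) =
      sgn k (a * (r + s)) • (x ⊗ₜ (y ⊗ₜ f z)) := by
  rw [superLTensor_tmul (superLTensor_mem hf) hx, superLTensor_tmul hf hy, tmul_smul, smul_smul,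
    mul_add, sgn_add]

end SuperTensor

lemma flipLin_act {t : ZMod 2} {ρ : V →ₗ[k] V} {ρ' : V' →ₗ[k] V'} (hρ : ρ ∈ linPart k V V t)
    (hρ' : ρ' ∈ linPart k V' V' t) (σ : W →ₗ[k] W) :
    flipLin k V V' W ∘ₗ superAct t ρ (superAct t ρ' σ) =
      superAct t ρ' (superAct t ρ σ) ∘ₗ flipLin k V V' W :=
  tensor_hom_ext₃ fun r x hx s y hy z => by
    rw [LinearMap.comp_apply, LinearMap.comp_apply, superAct_tmul₃ _ _ _ _ _ hy,
      flipLin_tmul hx hy, map_smul, superAct_tmul₃ _ _ _ _ _ hx, map_add, map_add, map_smul,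
      flipLin_tmul hx hy, flipLin_tmul hx (hρ' s y hy), flipLin_tmul (hρ r x hx) hy]
    simp only [smul_add, smul_smul, ← sgn_add]
    rw [show r * (s + t) = r * s + t * r by ring, add_right_comm,
      show t * s + (r + t) * s = r * s + (t * s + t * s) by ring, zmod2_add_self, add_zero]

lemma flipLin_mem : flipLin k V V' W ∈ linPart k (V ⊗[k] (V' ⊗[k] W)) (V' ⊗[k] (V ⊗[k] W)) 0 :=
  linPart_of_tmul₃ fun r x hx s y hy a z hz => by
    rw [flipLin_tmul hx hy]
    exact Submodule.smul_mem _ _ (tmul_mem_tensorPart hy (tmul_mem hx hz) (by ring))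

lemma flipLin_natural [SuperSpace k U] {a : ZMod 2} {f : W →ₗ[k] U} (hf : f ∈ linPart k W U a) :
    superLTensor V' (superLTensor V f) ∘ₗ flipLin k V V' W =
      flipLin k V V' U ∘ₗ superLTensor V (superLTensor V' f) :=
  tensor_hom_ext₃ fun r x hx s y hy z => by
    rw [LinearMap.comp_apply, LinearMap.comp_apply, flipLin_tmul hx hy, map_smul,
      superLTensor_tmul₃ hf hy hx, superLTensor_tmul₃ hf hx hy, map_smul, flipLin_tmul hx hy,
      smul_smul, smul_smul, mul_comm, add_comm s r]

end TensorMaps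

section CupsAndCaps

variable {k : Type v} [Field k] {V : Type u} {V' : Type u₁} {W : Type u₂} {U : Type w}
  [AddCommGroup V] [Module k V] [AddCommGroup V'] [Module k V']
  [AddCommGroup W] [Module k W] [AddCommGroup U] [Module k U]

variable (W) in
/-- The map `x ⊗ y ⊗ z ↦ β(x, y) z` attached to a bilinear form. -/
def capLin (β : V →ₗ[k] V' →ₗ[k] k) : V ⊗[k] (V' ⊗[k] W) →ₗ[k] W :=
  (TensorProduct.lid k W).toLinearMap ∘ₗ (TensorProduct.lift β).rTensor W ∘ₗ
    (TensorProduct.assoc k V V' W).symm.toLinearMap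

@[simp] lemma capLin_tmul (β : V →ₗ[k] V' →ₗ[k] k) (x : V) (y : V') (z : W) :
    capLin W β (x ⊗ₜ (y ⊗ₜ z)) = β x y • z := by
  simp [capLin]

variable (W) in
/-- The map `z ↦ ∑ x_i ⊗ y_i ⊗ z` attached to the tensor `∑ x_i ⊗ y_i`. -/
def cupLin {I : Type} [Fintype I] (x : I → V) (y : I → V') : W →ₗ[k] V ⊗[k] (V' ⊗[k] W) :=
  ∑ i, TensorProduct.mk k V (V' ⊗[k] W) (x i) ∘ₗ TensorProduct.mk k V' W (y i)

lemma cupLin_apply {I : Type} [Fintype I] (x : I → V) (y : I → V') (z : W) :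
    cupLin (k := k) W x y z = ∑ i, x i ⊗ₜ (y i ⊗ₜ z) := by
  simp [cupLin]

lemma cupLin_smul_apply {I : Type} [Fintype I] (c : I → k) (x : I → V) (y : I → V') (z : W) :
    cupLin (k := k) W (fun i => c i • x i) y z = ∑ i, c i • (x i ⊗ₜ[k] (y i ⊗ₜ[k] z)) := by
  simp only [cupLin_apply, smul_tmul']

variable [SuperSpace k V'] [SuperSpace k W]

variable {I : Type} [Fintype I] {p : I → ZMod 2} {x : I → V} {y : I → V'}

lemma cupLin_act (hy : ∀ i, y i ∈ part k V' (p i)) {t : ZMod 2} {ρ : V →ₗ[k] V}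
    {ρ' : V' →ₗ[k] V'}
    (h : ∑ i, (x i ⊗ₜ[k] ρ' (y i) + sgn k (t * p i) • (ρ (x i) ⊗ₜ[k] y i)) = 0)
    (σ : W →ₗ[k] W) :
    cupLin (k := k) W x y ∘ₗ σ = superAct t ρ (superAct t ρ' σ) ∘ₗ cupLin W x y :=
  LinearMap.ext fun z => by
    have h' := congrArg (fun q : V ⊗[k] V' => TensorProduct.assoc k V V' W (q ⊗ₜ twist k t z)) h
    simp only [sum_tmul, add_tmul, map_sum, map_add, ← smul_tmul', map_smul,
      TensorProduct.assoc_tmul, zero_tmul, map_zero] at h'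
    simp only [LinearMap.comp_apply, cupLin_apply, map_sum, superAct_tmul₃ _ _ _ _ _ (hy _),
      add_assoc, Finset.sum_add_distrib (f := fun i => x i ⊗ₜ[k] (y i ⊗ₜ[k] σ z)), h', add_zero]

variable [SuperSpace k V]

/-- A bilinear form is even if it vanishes on pairs of homogeneous vectors of different parity. -/
def EvenForm (β : V →ₗ[k] V' →ₗ[k] k) : Prop :=
  ∀ r, ∀ x ∈ part k V r, ∀ s, ∀ y ∈ part k V' s, r ≠ s → β x y = 0

/-- Parities on both sides of an even form may be exchanged. -/
lemma EvenForm.congr_parity {β : V →ₗ[k] V' →ₗ[k] k} (hβ : EvenForm β) {r s : ZMod 2} {x : V}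
    (hx : x ∈ part k V r) {y : V'} (hy : y ∈ part k V' s) (g : ZMod 2 → k) :
    g r * β x y = g s * β x y := by
  by_cases h : r = s
  · rw [h]
  · rw [hβ r x hx s y hy h, mul_zero, mul_zero]

lemma capLin_act {β : V →ₗ[k] V' →ₗ[k] k} {t : ZMod 2} {ρ : V →ₗ[k] V} {ρ' : V' →ₗ[k] V'}
    (h : ∀ x, ∀ s, ∀ y ∈ part k V' s, β x (ρ' y) + sgn k (t * s) * β (ρ x) y = 0)
    (σ : W →ₗ[k] W) :
    capLin W β ∘ₗ superAct t ρ (superAct t ρ' σ) = σ ∘ₗ capLin W β :=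
  tensor_hom_ext₃ fun r x hx s y hy z => by
    rw [LinearMap.comp_apply, LinearMap.comp_apply, superAct_tmul₃ _ _ _ _ _ hy, map_add, map_add,
      map_smul]
    simp only [capLin_tmul, map_smul]
    rw [smul_smul, add_assoc, ← add_smul, h x s y hy, zero_smul, add_zero]

lemma capLin_mem {β : V →ₗ[k] V' →ₗ[k] k} (hβ : EvenForm β) :
    capLin W β ∈ linPart k (V ⊗[k] (V' ⊗[k] W)) W 0 :=
  linPart_of_tmul₃ fun r x hx s y hy a z hz => by
    rw [capLin_tmul, add_zero]
    by_cases h : r = s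
    · rw [h, zmod2_add_self, zero_add]
      exact Submodule.smul_mem _ _ hz
    · rw [hβ r x hx s y hy h, zero_smul]
      exact zero_mem _

lemma capLin_natural [SuperSpace k U] {β : V →ₗ[k] V' →ₗ[k] k} (hβ : EvenForm β) {a : ZMod 2}
    {f : W →ₗ[k] U} (hf : f ∈ linPart k W U a) :
    f ∘ₗ capLin W β = capLin U β ∘ₗ superLTensor V (superLTensor V' f) :=
  tensor_hom_ext₃ fun r x hx s y hy z => by
    rw [LinearMap.comp_apply, LinearMap.comp_apply, superLTensor_tmul₃ hf hx hy, map_smul,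
      capLin_tmul, capLin_tmul, map_smul, smul_smul,
      hβ.congr_parity hx hy fun r => sgn k (a * (r + s)), zmod2_add_self, mul_zero, sgn_zero,
      one_mul]

lemma cupLin_mem (hx : ∀ i, x i ∈ part k V (p i)) (hy : ∀ i, y i ∈ part k V' (p i)) :
    cupLin (k := k) W x y ∈ linPart k W (V ⊗[k] (V' ⊗[k] W)) 0 := fun s z hz => by
  rw [cupLin_apply]
  refine sum_mem fun i _ => tmul_mem_tensorPart (hx i) (tmul_mem (hy i) hz) ?_
  rw [← add_assoc, zmod2_add_self, zero_add, add_zero]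

lemma cupLin_natural [SuperSpace k U] (hx : ∀ i, x i ∈ part k V (p i))
    (hy : ∀ i, y i ∈ part k V' (p i)) {a : ZMod 2} {f : W →ₗ[k] U}
    (hf : f ∈ linPart k W U a) :
    superLTensor V (superLTensor V' f) ∘ₗ cupLin W x y = cupLin U x y ∘ₗ f :=
  LinearMap.ext fun z => by
    rw [LinearMap.comp_apply, LinearMap.comp_apply, cupLin_apply, cupLin_apply, map_sum]
    refine Finset.sum_congr rfl fun i _ => ?_
    rw [superLTensor_tmul₃ hf (hx i) (hy i), zmod2_add_self, mul_zero, sgn_zero, one_smul]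

end CupsAndCaps

section InfinitesimalBraiding

variable {k : Type v} [Field k] {V : Type u} {V' : Type u₁} {W : Type u₂} {U : Type w}
  [AddCommGroup V] [Module k V] [AddCommGroup V'] [Module k V'] [AddCommGroup W] [Module k W]
  [SuperSpace k W] [AddCommGroup U] [Module k U] [SuperSpace k U]

lemma rTensor_act {t : ZMod 2} {φ : V →ₗ[k] V'} {ρ : V →ₗ[k] V} {ρ' : V' →ₗ[k] V'}
    (h : φ ∘ₗ ρ = ρ' ∘ₗ φ) (σ : W →ₗ[k] W) :
    φ.rTensor W ∘ₗ superAct t ρ σ = superAct t ρ' σ ∘ₗ φ.rTensor W :=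
  TensorProduct.ext' fun x y => by
    have e : φ (ρ x) = ρ' (φ x) := LinearMap.congr_fun h x
    simp only [LinearMap.comp_apply, superAct_tmul, map_add, LinearMap.rTensor_tmul, e]

variable {I : Type} [Fintype I]

/-- The operator `x ⊗ y ↦ ∑ (-1)^{p_i ȳ} ρ_i(x) ⊗ σ_i(y)` on `V ⊗ W` through which the tensor
`∑ M_i ⊗ N_i` acts, where `M_i` has parity `p_i` and acts by `ρ_i`, and `N_i` acts by `σ_i`. -/
def omegaLin (p : I → ZMod 2) (ρ : I → V →ₗ[k] V) (σ : I → W →ₗ[k] W) :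
    V ⊗[k] W →ₗ[k] V ⊗[k] W :=
  ∑ i, TensorProduct.map (ρ i) (σ i ∘ₗ twist k (p i))

lemma omegaLin_tmul (p : I → ZMod 2) (ρ : I → V →ₗ[k] V) (σ : I → W →ₗ[k] W) (x : V) (y : W) :
    omegaLin p ρ σ (x ⊗ₜ y) = ∑ i, ρ i x ⊗ₜ σ i (twist k (p i) y) := by
  simp [omegaLin]

variable [SuperSpace k V] [SuperSpace k V']

lemma rTensor_mem {a : ZMod 2} {φ : V →ₗ[k] V'} (hφ : φ ∈ linPart k V V' a) :
    φ.rTensor W ∈ linPart k (V ⊗[k] W) (V' ⊗[k] W) a :=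
  linPart_of_tmul fun s x hx t y hy => by
    rw [LinearMap.rTensor_tmul, add_right_comm]
    exact tmul_mem (hφ s x hx) hy

lemma rTensor_natural {a s : ZMod 2} {φ : V →ₗ[k] V'} (hφ : φ ∈ linPart k V V' a)
    {f : W →ₗ[k] U} (hf : f ∈ linPart k W U s) :
    superLTensor V' f ∘ₗ φ.rTensor W = sgn k (a * s) • (φ.rTensor U ∘ₗ superLTensor V f) :=
  tensor_hom_ext fun r x hx y => by
    rw [LinearMap.smul_apply, LinearMap.comp_apply, LinearMap.comp_apply, LinearMap.rTensor_tmul,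
      superLTensor_tmul hf (hφ r x hx), superLTensor_tmul hf hx, map_smul, LinearMap.rTensor_tmul,
      smul_smul, ← sgn_add]
    ring_nf

variable {p : I → ZMod 2} {ρ : I → V →ₗ[k] V} {σ : I → W →ₗ[k] W}

lemma omegaLin_mem (hρ : ∀ i, ρ i ∈ linPart k V V (p i)) (hσ : ∀ i, σ i ∈ linPart k W W (p i)) :
    omegaLin p ρ σ ∈ linPart k (V ⊗[k] W) (V ⊗[k] W) 0 :=
  linPart_of_tmul fun s x hx t y hy => by
    rw [omegaLin_tmul]
    refine sum_mem fun i _ => tmul_mem_tensorPart (hρ i s x hx)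
      (hσ i t _ (twist_mem hy (p i))) ?_
    linear_combination zmod2_add_self (p i)

lemma omegaLin_natural (hρ : ∀ i, ρ i ∈ linPart k V V (p i)) {σ' : I → U →ₗ[k] U} {a : ZMod 2}
    {f : W →ₗ[k] U} (hf : f ∈ linPart k W U a) (h : ∀ i y, f (σ i y) = σ' i (f y)) :
    superLTensor V f ∘ₗ omegaLin p ρ σ = omegaLin p ρ σ' ∘ₗ superLTensor V f :=
  tensor_hom_ext fun r x hx y => by
    rw [LinearMap.comp_apply, LinearMap.comp_apply, superLTensor_tmul hf hx, map_smul,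
      omegaLin_tmul, omegaLin_tmul, map_sum, Finset.smul_sum]
    refine Finset.sum_congr rfl fun i _ => ?_
    rw [superLTensor_tmul hf (hρ i r x hx), twist_apply_of_linPart hf, h, map_smul, tmul_smul,
      smul_smul, ← sgn_add]
    ring_nf

/-- The action of `∑ M_i ⊗ N_i` on the first two and on the first and third tensor factors. -/
lemma omegaLin_tmul₃ {ρ' : I → V' →ₗ[k] V'} (x : V) {s : ZMod 2} {y : V'}
    (hy : y ∈ part k V' s) (z : W) :
    omegaLin p ρ (fun i => superAct (p i) (ρ' i) (σ i)) (x ⊗ₜ (y ⊗ₜ z)) =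
      ∑ i, (sgn k (p i * s) • (ρ i x ⊗ₜ (y ⊗ₜ σ i (twist k (p i) z))) +
        sgn k (p i * s) • (ρ i x ⊗ₜ (ρ' i y ⊗ₜ z))) := by
  rw [omegaLin_tmul]
  refine Finset.sum_congr rfl fun i _ => ?_
  rw [twist_tmul hy, map_smul, superAct_tmul, twist_twist, tmul_smul, tmul_add, smul_add]

end InfinitesimalBraiding

/-! ### Flips, caps, cups and invariant tensors as supernatural transformations -/

section GeneralTransformations

variable {k : Type v} [Field k] {G : Type w} [Ring G] [Algebra k G] [Superalgebra k G]

lemma SMod.rmul_mem (V : SMod.{w, v, u} k G) {t : ZMod 2} {M : G} (hM : M ∈ part k G t) :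
    V.rmul M ∈ linPart k V.carrier V.carrier t := fun _ _ hx => V.act_mem hx hM

lemma SMod.rmul_tensor (V W : SMod.{w, v, u} k G) {t : ZMod 2} {M : G} (hM : M ∈ part k G t) :
    (V.tensor W).rmul M = superAct t (V.rmul M) (W.rmul M) :=
  TensorProduct.ext' fun x y => SMod.tensorAct_tmul V W hM x y

lemma SMod.rmul_tensor₃ (V V' W : SMod.{w, v, u} k G) {t : ZMod 2} {M : G}
    (hM : M ∈ part k G t) : (V.tensor (V'.tensor W)).rmul M =
      superAct t (V.rmul M) (superAct t (V'.rmul M) (W.rmul M)) :=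
  (SMod.rmul_tensor V (V'.tensor W) hM).trans
    (congrArg (superAct (W := V'.carrier ⊗[k] W.carrier) t (V.rmul M))
      (SMod.rmul_tensor V' W hM))

/-- The superflip as an even supernatural transformation. -/
def flipTrans (V V' : SMod.{w, v, u} k G) :
    superComp (tensorLeft V) (tensorLeft V') ⟶ superComp (tensorLeft V') (tensorLeft V) :=
  evenTrans (fun W => flipLin k V.carrier V'.carrier W.carrier)
    (fun W _ _ hM => (congrArg (flipLin k V.carrier V'.carrier W.carrier ∘ₗ ·)
      (SMod.rmul_tensor₃ V V' W hM)).trans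
      ((flipLin_act (V.rmul_mem hM) (V'.rmul_mem hM) _).trans
        (congrArg (· ∘ₗ flipLin k V.carrier V'.carrier W.carrier)
          (SMod.rmul_tensor₃ V' V W hM)).symm))
    (fun _ => flipLin_mem)
    (fun _ _ _ _ hf => flipLin_natural hf)

/-- The cap attached to an invariant even bilinear form. -/
def capTrans {V V' : SMod.{w, v, u} k G} (β : V.carrier →ₗ[k] V'.carrier →ₗ[k] k)
    (hβ : EvenForm β)
    (h : ∀ t, ∀ M ∈ part k G t, ∀ x, ∀ s, ∀ y ∈ part k V'.carrier s,
      β x (V'.act y M) + sgn k (t * s) * β (V.act x M) y = 0) :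
    superComp (tensorLeft V) (tensorLeft V') ⟶ (superId : SEnd k (SMod.{w, v, u} k G)) :=
  evenTrans (fun W => capLin W.carrier β)
    (fun W t M hM => (congrArg (capLin W.carrier β ∘ₗ ·) (SMod.rmul_tensor₃ V V' W hM)).trans
      (capLin_act (h t M hM) _))
    (fun _ => capLin_mem hβ)
    (fun _ _ _ _ hf => capLin_natural hβ hf)

/-- The cup attached to an invariant even tensor `∑ x_i ⊗ y_i`. -/
def cupTrans {V V' : SMod.{w, v, u} k G} {I : Type} [Fintype I] {p : I → ZMod 2}
    (x : I → V.carrier) (y : I → V'.carrier) (hx : ∀ i, x i ∈ part k V.carrier (p i))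
    (hy : ∀ i, y i ∈ part k V'.carrier (p i))
    (h : ∀ t, ∀ M ∈ part k G t,
      ∑ i, (x i ⊗ₜ[k] V'.act (y i) M + sgn k (t * p i) • (V.act (x i) M ⊗ₜ[k] y i)) = 0) :
    (superId : SEnd k (SMod.{w, v, u} k G)) ⟶ superComp (tensorLeft V) (tensorLeft V') :=
  evenTrans (fun W => cupLin (k := k) W.carrier x y)
    (fun W t M hM => (cupLin_act (ρ := V.rmul M) (ρ' := V'.rmul M) hy (h t M hM)
      (W.rmul M)).trans (congrArg (· ∘ₗ cupLin W.carrier x y) (SMod.rmul_tensor₃ V V' W hM)).symm)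
    (fun _ => cupLin_mem hx hy)
    (fun _ _ _ _ hf => cupLin_natural hx hy hf)

end GeneralTransformations

section GeneralTransformations

variable {k : Type v} [Field k] {G : Type w} [Ring G] [Algebra k G] [Superalgebra k G]

/-- The components of the transformation `φ ⊗ 1` from `V ⊗ -` to `V' ⊗ -`. -/
def whiskerApp {V V' : SMod.{w, v, u} k G} (φ : V ⟶ V') (W : SMod.{w, v, u} k G) :
    (tensorLeft V).obj W ⟶ (tensorLeft V').obj W :=
  SMod.homOfHomogeneous ((SMod.toLin φ).rTensor W.carrier) fun _ M hM =>
    (congrArg ((SMod.toLin φ).rTensor W.carrier ∘ₗ ·) (SMod.rmul_tensor V W hM)).trans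
      ((rTensor_act (ρ' := V'.rmul M) (LinearMap.ext fun x => φ.2 x M) (W.rmul M)).trans
        (congrArg (· ∘ₗ (SMod.toLin φ).rTensor W.carrier) (SMod.rmul_tensor V' W hM)).symm)

lemma whiskerApp_mem {V V' : SMod.{w, v, u} k G} {φ : V ⟶ V'} {r : ZMod 2}
    (hφ : φ ∈ Supercategory.homPart (k := k) V V' r) :
    whiskerApp φ ∈ supernat (tensorLeft V) (tensorLeft V') r :=
  ⟨fun W => rTensor_mem (W := W.carrier) hφ, fun W W' f _ hf => Subtype.ext
    (rTensor_natural (W := W.carrier) (U := W'.carrier) (φ := SMod.toLin φ) (f := SMod.toLin f)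
      hφ hf)⟩

lemma whiskerApp_add {V V' : SMod.{w, v, u} k G} (φ ψ : V ⟶ V') :
    whiskerApp (φ + ψ) = whiskerApp φ + whiskerApp ψ :=
  funext fun W => Subtype.ext (LinearMap.rTensor_add W.carrier (SMod.toLin φ) (SMod.toLin ψ))

lemma whiskerApp_mem_superNatTrans {V V' : SMod.{w, v, u} k G} (φ : V ⟶ V') :
    whiskerApp φ ∈ SuperNatTrans (tensorLeft V) (tensorLeft V') := by
  have h : φ ∈ Supercategory.homPart (k := k) V V' 0 ⊔ Supercategory.homPart V V' 1 := by
    rw [(Supercategory.homPart_isCompl V V').sup_eq_top]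
    trivial
  obtain ⟨φ₀, h₀, φ₁, h₁, rfl⟩ := Submodule.mem_sup.1 h
  exact Submodule.mem_sup.2
    ⟨_, whiskerApp_mem h₀, _, whiskerApp_mem h₁, (whiskerApp_add φ₀ φ₁).symm⟩

/-- The transformation `φ ⊗ 1` from `V ⊗ -` to `V' ⊗ -` attached to a (not necessarily
homogeneous) morphism `φ` of supermodules. -/
def whisker {V V' : SMod.{w, v, u} k G} : (V ⟶ V') →ₗ[k] (tensorLeft V ⟶ tensorLeft V') where
  toFun φ := ⟨whiskerApp φ, whiskerApp_mem_superNatTrans φ⟩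
  map_add' φ ψ := Subtype.ext (whiskerApp_add φ ψ)
  map_smul' c φ := Subtype.ext (funext fun W =>
    Subtype.ext (LinearMap.rTensor_smul W.carrier c (SMod.toLin φ)))

lemma rmulTensor_tmul' (V W : SMod.{w, v, u} k G) {r : ZMod 2} {M : G} (hM : M ∈ part k G r)
    (N : G) (x : V.carrier) (y : W.carrier) :
    rmulTensor V W (M ⊗ₜ N) (x ⊗ₜ y) = V.act x M ⊗ₜ W.act (twist k r y) N := by
  have h := sum_proj_of_mem hM
    (fun s X => (V.act x X) ⊗ₜ[k] (W.act (twist k s y) N)) (fun s => by simp)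
  simp only [rmulTensor, TensorProduct.lift.tmul, LinearMap.sum_apply, LinearMap.compl₁₂_apply,
    LinearMap.comp_apply, TensorProduct.mapBilinear_apply, TensorProduct.map_tmul, SMod.rmul,
    LinearMap.lcomp_apply, LinearMap.flip_apply]
  exact h

variable {I : Type} [Fintype I] {p : I → ZMod 2}

lemma rmulTensor_eq_omegaLin (V W : SMod.{w, v, u} k G) {M : I → G}
    (hM : ∀ i, M i ∈ part k G (p i)) (N : I → G) :
    rmulTensor V W (∑ i, M i ⊗ₜ N i) =
      omegaLin p (fun i => V.rmul (M i)) (fun i => W.rmul (N i)) := by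
  rw [map_sum]
  exact Finset.sum_congr rfl fun i _ => TensorProduct.ext' fun x y =>
    rmulTensor_tmul' V W (hM i) (N i) x y

/-- A tensor `∑ M_i ⊗ N_i` which is invariant under the adjoint action acts by morphisms of
supermodules. -/
lemma omegaLin_act (V W : SMod.{w, v, u} k G) {M N : I → G} (hM : ∀ i, M i ∈ part k G (p i))
    (hN : ∀ i, N i ∈ part k G (p i)) {t : ZMod 2} {X : G} (hX : X ∈ part k G t)
    (h : ∑ i, (M i ⊗ₜ[k] superBracket k G (N i) X +
      sgn k (p i * t) • (superBracket k G (M i) X ⊗ₜ[k] N i)) = 0) :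
    omegaLin p (fun i => V.rmul (M i)) (fun i => W.rmul (N i)) ∘ₗ
        superAct t (V.rmul X) (W.rmul X) =
      superAct t (V.rmul X) (W.rmul X) ∘ₗ
        omegaLin p (fun i => V.rmul (M i)) (fun i => W.rmul (N i)) := by
  have hB (i : I) : superBracket k G (M i) X ∈ part k G (p i + t) := by
    rw [superBracket_of_mem (hM i) hX]
    refine sub_mem (Superalgebra.mul_mem (hM i) hX) (Submodule.smul_mem _ _ ?_)
    rw [add_comm]
    exact Superalgebra.mul_mem hX (hM i)
  refine TensorProduct.ext' fun x y => ?_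
  rw [LinearMap.comp_apply, LinearMap.comp_apply, superAct_tmul, map_add, omegaLin_tmul,
    omegaLin_tmul, omegaLin_tmul, map_sum, ← Finset.sum_add_distrib, eq_comm, ← sub_eq_zero,
    ← Finset.sum_sub_distrib]
  have h1 := congrArg (fun q => rmulTensor V W q (x ⊗ₜ y)) h
  simp only [map_sum, LinearMap.sum_apply, map_zero, LinearMap.zero_apply] at h1
  refine (Finset.sum_congr rfl fun i _ => ?_).trans h1
  rw [map_add, map_smul, LinearMap.add_apply, LinearMap.smul_apply, rmulTensor_tmul' V W (hM i),
    rmulTensor_tmul' V W (hB i), V.act_bracket _ (hM i) hX, W.act_bracket _ (hN i) hX,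
    superAct_tmul]
  simp only [SMod.rmul, LinearMap.flip_apply]
  rw [twist_act W t (hN i), twist_act W (p i) hX, add_comm (p i) t, twist_add, ← twist_add k (p i),
    add_comm (p i) t, twist_add]
  simp only [map_smul, LinearMap.smul_apply, tmul_sub, sub_tmul, tmul_smul, ← smul_tmul', smul_sub,
    smul_smul, sgn_mul_self, mul_comm t, one_smul]
  abel

/-- The transformation of `V ⊗ -` given by the action of an even tensor `∑ M_i ⊗ N_i` which is
invariant under the adjoint action. -/
def omegaTrans (V : SMod.{w, v, u} k G) {M N : I → G} (hM : ∀ i, M i ∈ part k G (p i))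
    (hN : ∀ i, N i ∈ part k G (p i))
    (h : ∀ t, ∀ X ∈ part k G t, ∑ i, (M i ⊗ₜ[k] superBracket k G (N i) X +
      sgn k (p i * t) • (superBracket k G (M i) X ⊗ₜ[k] N i)) = 0) :
    tensorLeft V ⟶ tensorLeft V :=
  evenTrans
    (fun W => omegaLin (W := W.carrier) p (fun i => V.rmul (M i)) (fun i => W.rmul (N i)))
    (fun W t X hX => by
      have e := omegaLin_act V W hM hN hX (h t X hX)
      rw [← SMod.rmul_tensor V W hX] at e
      exact e)
    (fun W => omegaLin_mem (W := W.carrier) (fun i => V.rmul_mem (hM i))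
      (fun i => W.rmul_mem (hN i)))
    (fun W W' f s hf => omegaLin_natural (W := W.carrier) (U := W'.carrier)
      (fun i => V.rmul_mem (hM i)) hf (fun i y => f.2 y (N i)))

end GeneralTransformations

/-! ### Dual pairs of superspaces and the resulting identities of string diagrams -/

section DualFamilies

variable {k : Type v} [Field k] {V : Type u} {V' : Type u₁} {W : Type u₂}
  [AddCommGroup V] [Module k V] [SuperSpace k V] [AddCommGroup V'] [Module k V'] [SuperSpace k V']
  [AddCommGroup W] [Module k W]

lemma flipLin_mul_self : flipLin k V' V W ∘ₗ flipLin k V V' W = LinearMap.id :=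
  tensor_hom_ext₃ fun r x hx s y hy z => by
    rw [LinearMap.comp_apply, flipLin_tmul hx hy, map_smul, flipLin_tmul hy hx, smul_smul,
      mul_comm s r, sgn_mul_self, one_smul, LinearMap.id_apply]

/-- The bilinear form `(x, y) ↦ (-1)^{x̄ ȳ} β(y, x)` (see `superFlip_of_mem`). -/
def superFlip (β : V' →ₗ[k] V →ₗ[k] k) : V →ₗ[k] V' →ₗ[k] k :=
  ∑ r, β.flip.compl₁₂ (proj k r) (twist k r)

lemma superFlip_of_mem (β : V' →ₗ[k] V →ₗ[k] k) {r s : ZMod 2} {x : V} (hx : x ∈ part k V r)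
    {y : V'} (hy : y ∈ part k V' s) : superFlip β x y = sgn k (r * s) * β y x := by
  have h := sum_proj_of_mem hx (fun r x => β (twist k r y) x) (fun s => by simp)
  simp only [superFlip, LinearMap.sum_apply, LinearMap.compl₁₂_apply, LinearMap.flip_apply]
  rw [h, twist_of_mem hy, map_smul, LinearMap.smul_apply, smul_eq_mul]

lemma capLin_superFlip_tmul (β : V' →ₗ[k] V →ₗ[k] k) {r s : ZMod 2} {x : V}
    (hx : x ∈ part k V r) {y : V'} (hy : y ∈ part k V' s) (z : W) :
    capLin W (superFlip β) (x ⊗ₜ (y ⊗ₜ z)) = (sgn k (r * s) * β y x) • z := by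
  rw [capLin_tmul, superFlip_of_mem β hx hy]

variable [SuperSpace k W]

lemma EvenForm.superFlip {β : V' →ₗ[k] V →ₗ[k] k} (hβ : EvenForm β) :
    EvenForm (superFlip β) := fun r x hx s y hy h => by
  rw [superFlip_of_mem β hx hy, hβ s y hy r x hx h.symm, mul_zero]

/-- On even forms only the parity of one argument matters. -/
lemma EvenForm.superFlip_apply {β : V' →ₗ[k] V →ₗ[k] k} (hβ : EvenForm β) {s : ZMod 2} (x : V)
    {y : V'} (hy : y ∈ part k V' s) : FrobeniusBrauer.superFlip β x y = sgn k s * β y x := by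
  refine hom_induction (k := k)
    (P := fun x => FrobeniusBrauer.superFlip β x y = sgn k s * β y x) ?_ ?_ x
  · intro x x' h h'
    simp only [map_add, LinearMap.add_apply, h, h', mul_add]
  · intro r x hx
    rw [superFlip_of_mem β hx hy, ← hβ.congr_parity hy hx fun r => sgn k (r * s)]
    rcases zmod2_cases s with rfl | rfl <;> simp

/-- Dual families of homogeneous vectors for an even bilinear form `β` on `V' × V`: the vectors `x_i`
of `V` and `x'_i` of `V'` have the parity `p_i`, and `∑ β(x'_i, w) x_i = w`,
`∑ β(u, x_i) x'_i = u` for all `w` and `u`. -/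
structure DualFamilies (β : V' →ₗ[k] V →ₗ[k] k) {I : Type} [Fintype I] (p : I → ZMod 2)
    (x : I → V) (x' : I → V') : Prop where
  even : EvenForm β
  mem : ∀ i, x i ∈ part k V (p i)
  mem' : ∀ i, x' i ∈ part k V' (p i)
  sum : ∀ w, ∑ i, β (x' i) w • x i = w
  sum' : ∀ u, ∑ i, β u (x i) • x' i = u

variable {β : V' →ₗ[k] V →ₗ[k] k} {I : Type} [Fintype I] {p : I → ZMod 2} {x : I → V}
  {x' : I → V'}

lemma flipLin_braid : flipLin k V V (V ⊗[k] W) ∘ₗ superLTensor V (flipLin k V V W) ∘ₗ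
      flipLin k V V (V ⊗[k] W) =
    superLTensor V (flipLin k V V W) ∘ₗ flipLin k V V (V ⊗[k] W) ∘ₗ
      superLTensor V (flipLin k V V W) := by
  rw [superLTensor_even flipLin_mem]
  refine tensor_hom_ext fun r x hx q => ?_
  have e : (flipLin k V V (V ⊗[k] W) ∘ₗ (flipLin k V V W).lTensor V ∘ₗ
        flipLin k V V (V ⊗[k] W)) ∘ₗ TensorProduct.mk k V (V ⊗[k] (V ⊗[k] W)) x =
      ((flipLin k V V W).lTensor V ∘ₗ flipLin k V V (V ⊗[k] W) ∘ₗ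
        (flipLin k V V W).lTensor V) ∘ₗ TensorProduct.mk k V (V ⊗[k] (V ⊗[k] W)) x :=
    tensor_hom_ext₃ fun s y hy t z hz a => by
      simp only [LinearMap.comp_apply, TensorProduct.mk_apply, flipLin_tmul hx hy,
        flipLin_tmul hx hz, flipLin_tmul hy hz, LinearMap.lTensor_tmul, map_smul, tmul_smul,
        smul_smul]
      ring_nf
  exact LinearMap.congr_fun e q

lemma DualFamilies.zigzag_up (h : DualFamilies β p x x') :
    capLin (V ⊗[k] W) (superFlip β) ∘ₗ
      superLTensor V (cupLin (k := k) W (fun i => sgn k (p i) • x' i) x) = LinearMap.id := by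
  rw [superLTensor_even (cupLin_mem (fun i => Submodule.smul_mem _ _ (h.mem' i)) h.mem)]
  refine TensorProduct.ext' fun v y => ?_
  rw [LinearMap.comp_apply, LinearMap.lTensor_tmul, cupLin_apply, tmul_sum, map_sum]
  simp only [capLin_tmul, map_smul, h.even.superFlip_apply _ (h.mem' _), smul_eq_mul, ← mul_assoc,
    sgn_mul_self, one_mul, smul_tmul', ← sum_tmul, h.sum]
  rfl

lemma DualFamilies.zigzag_down (h : DualFamilies β p x x') :
    superLTensor V' (capLin W (superFlip β)) ∘ₗ
      cupLin (k := k) (V' ⊗[k] W) (fun i => sgn k (p i) • x' i) x = LinearMap.id := by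
  rw [superLTensor_even (capLin_mem h.even.superFlip)]
  refine tensor_hom_ext fun r u hu y => ?_
  rw [LinearMap.comp_apply, LinearMap.id_apply, cupLin_apply, map_sum]
  conv_rhs => rw [← h.sum' u, sum_tmul]
  refine Finset.sum_congr rfl fun i _ => ?_
  rw [LinearMap.lTensor_tmul, capLin_tmul, superFlip_of_mem β (h.mem i) hu, tmul_smul,
    ← smul_tmul', ← smul_tmul', smul_smul]
  congr 1
  rw [h.even.congr_parity hu (h.mem i) fun s => sgn k (p i * s), mul_right_comm, ← sgn_add]
  rcases zmod2_cases (p i) with h | h <;> simp [h]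

lemma DualFamilies.left_curl (h : DualFamilies β p x x') :
    capLin (V ⊗[k] W) β ∘ₗ superLTensor V' (flipLin k V V W) ∘ₗ
      cupLin (k := k) (V ⊗[k] W) (fun i => sgn k (p i) • x' i) x = LinearMap.id := by
  rw [superLTensor_even flipLin_mem]
  refine tensor_hom_ext fun r v hv y => ?_
  rw [LinearMap.comp_apply, LinearMap.comp_apply, LinearMap.id_apply, cupLin_apply, map_sum,
    map_sum]
  conv_rhs => rw [← h.sum v, sum_tmul]
  refine Finset.sum_congr rfl fun i _ => ?_
  rw [LinearMap.lTensor_tmul, flipLin_tmul (h.mem i) hv, tmul_smul, map_smul, capLin_tmul,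
    map_smul, LinearMap.smul_apply, smul_eq_mul, ← smul_tmul', smul_smul, ← mul_assoc, ← sgn_add]
  congr 1
  rw [h.even.congr_parity (h.mem' i) hv fun s => sgn k (s * r + s)]
  rcases zmod2_cases r with h | h <;> simp [h]

lemma DualFamilies.right_curl (h : DualFamilies β p x x') :
    superLTensor V (capLin W (superFlip β)) ∘ₗ flipLin k V V (V' ⊗[k] W) ∘ₗ
      superLTensor V (cupLin (k := k) W x x') = LinearMap.id := by
  rw [superLTensor_even (capLin_mem h.even.superFlip),
    superLTensor_even (cupLin_mem h.mem h.mem')]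
  refine tensor_hom_ext fun r v hv y => ?_
  rw [LinearMap.comp_apply, LinearMap.comp_apply, LinearMap.id_apply, LinearMap.lTensor_tmul,
    cupLin_apply, tmul_sum, map_sum, map_sum]
  conv_rhs => rw [← h.sum v, sum_tmul]
  refine Finset.sum_congr rfl fun i _ => ?_
  rw [flipLin_tmul hv (h.mem i), map_smul, LinearMap.lTensor_tmul, capLin_tmul,
    superFlip_of_mem β hv (h.mem' i), tmul_smul, smul_smul, ← mul_assoc, sgn_mul_self, one_mul,
    smul_tmul']

/-- The right crossing is the superflip. -/
lemma DualFamilies.right_cross (h : DualFamilies β p x x') :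
    superLTensor V' (superLTensor V (capLin W (superFlip β))) ∘ₗ
      superLTensor V' (flipLin k V V (V' ⊗[k] W)) ∘ₗ
        cupLin (k := k) (V ⊗[k] (V' ⊗[k] W)) (fun i => sgn k (p i) • x' i) x =
      flipLin k V V' W := by
  have hc := capLin_mem (W := W) h.even.superFlip
  rw [superLTensor_even (superLTensor_mem hc), superLTensor_even hc, superLTensor_even flipLin_mem]
  refine tensor_hom_ext₃ fun r v hv s u hu y => ?_
  rw [LinearMap.comp_apply, LinearMap.comp_apply, flipLin_tmul hv hu, cupLin_apply, map_sum,
    map_sum]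
  conv_rhs => rw [← h.sum' u, sum_tmul, Finset.smul_sum]
  refine Finset.sum_congr rfl fun i _ => ?_
  rw [LinearMap.lTensor_tmul, flipLin_tmul (h.mem i) hv, tmul_smul, map_smul,
    LinearMap.lTensor_tmul, LinearMap.lTensor_tmul, capLin_tmul, superFlip_of_mem β (h.mem i) hu,
    tmul_smul, tmul_smul, ← smul_tmul', ← smul_tmul', smul_smul, smul_smul, smul_smul]
  congr 1
  have e1 := h.even.congr_parity hu (h.mem i) fun t => sgn k (r * t)
  have e2 := h.even.congr_parity hu (h.mem i) fun t => sgn k (p i * t)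
  have e3 : sgn k (p i * p i) = sgn k (p i) := by
    rcases zmod2_cases (p i) with h | h <;> simp [h]
  rw [mul_comm (p i) r]
  linear_combination (sgn k (p i) * sgn k (r * p i)) * e2 - e1 +
    (sgn k (p i) * sgn k (r * p i) * β u (x i)) * e3 +
    (sgn k (r * p i) * β u (x i)) * sgn_mul_self k (p i)

/-- The left crossing is the superflip. -/
lemma DualFamilies.left_cross (h : DualFamilies β p x x') :
    capLin (V ⊗[k] (V' ⊗[k] W)) β ∘ₗ superLTensor V' (flipLin k V V (V' ⊗[k] W)) ∘ₗ
      superLTensor V' (superLTensor V (cupLin (k := k) W x x')) = flipLin k V' V W := by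
  have hc := cupLin_mem (k := k) (W := W) h.mem h.mem'
  rw [superLTensor_even (superLTensor_mem hc), superLTensor_even hc, superLTensor_even flipLin_mem]
  refine tensor_hom_ext₃ fun r u hu s v hv y => ?_
  rw [LinearMap.comp_apply, LinearMap.comp_apply, flipLin_tmul hu hv, LinearMap.lTensor_tmul,
    LinearMap.lTensor_tmul, LinearMap.lTensor_tmul, cupLin_apply, tmul_sum, map_sum, tmul_sum,
    map_sum]
  conv_rhs => rw [← h.sum' u, sum_tmul, tmul_sum, Finset.smul_sum]
  refine Finset.sum_congr rfl fun i _ => ?_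
  rw [flipLin_tmul hv (h.mem i), tmul_smul, map_smul, capLin_tmul, ← smul_tmul', tmul_smul,
    smul_smul, smul_smul]
  congr 1
  rw [mul_comm s, h.even.congr_parity hu (h.mem i) fun r => sgn k (r * s)]

section Slides

variable {U : Type w} [AddCommGroup U] [Module k U] [SuperSpace k U]

lemma superLTensor_add (f g : W →ₗ[k] U) :
    superLTensor V (f + g) = superLTensor V f + superLTensor V g := by
  simp only [superLTensor, LinearMap.add_comp, LinearMap.comp_add, TensorProduct.map_add_right,
    Finset.sum_add_distrib]

end Slides

/-- Homogeneous endomorphisms slide through the superflip. -/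
lemma flipLin_comp_rTensor {a : ZMod 2} {φ : V →ₗ[k] V} (hφ : φ ∈ linPart k V V a) :
    flipLin k V V' W ∘ₗ φ.rTensor (V' ⊗[k] W) =
      superLTensor V' (φ.rTensor W) ∘ₗ flipLin k V V' W :=
  tensor_hom_ext₃ fun r x hx s y hy z => by
    rw [LinearMap.comp_apply, LinearMap.comp_apply, LinearMap.rTensor_tmul,
      flipLin_tmul (hφ r x hx) hy, flipLin_tmul hx hy, map_smul,
      superLTensor_tmul (rTensor_mem hφ) hy, LinearMap.rTensor_tmul, smul_smul, add_mul, sgn_add]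

/-- The difference of the two ways of combining the superflip with `∑ M_i ⊗ N_i` is the action on
the two factors that are flipped. -/
lemma omegaLin_comp_flipLin_sub {ρ : I → V →ₗ[k] V} {σ : I → W →ₗ[k] W}
    (hρ : ∀ i, ρ i ∈ linPart k V V (p i)) (hσ : ∀ i, σ i ∈ linPart k W W (p i))
    {J : Type} [Fintype J] {q : J → ZMod 2} {φ ψ : J → V →ₗ[k] V}
    (hψ : ∀ j, ψ j ∈ linPart k V V (q j)) (ρ' : I → V →ₗ[k] V)
    (h : ∀ r, ∀ v ∈ part k V r, ∀ s, ∀ w ∈ part k V s,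
      ∑ i, sgn k (r * s + p i * r) • (ρ i w ⊗ₜ[k] ρ' i v) =
        ∑ j, sgn k (q j * r) • (φ j v ⊗ₜ[k] ψ j w)) :
    omegaLin p ρ (fun i => superAct (p i) (ρ' i) (σ i)) ∘ₗ flipLin k V V W -
        flipLin k V V W ∘ₗ superLTensor V (omegaLin p ρ σ) =
      ∑ j, (φ j).rTensor (V ⊗[k] W) ∘ₗ superLTensor V ((ψ j).rTensor W) := by
  rw [superLTensor_even (omegaLin_mem hρ hσ)]
  refine tensor_hom_ext₃ fun r v hv s w hw z => ?_
  have h' := congrArg (fun q : V ⊗[k] V => TensorProduct.assoc k V V W (q ⊗ₜ z)) (h r v hv s w hw)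
  simp only [sum_tmul, map_sum, ← smul_tmul', map_smul, TensorProduct.assoc_tmul] at h'
  rw [LinearMap.sub_apply, LinearMap.comp_apply, LinearMap.comp_apply, flipLin_tmul hv hw,
    map_smul, omegaLin_tmul₃ _ hv, LinearMap.lTensor_tmul, omegaLin_tmul, tmul_sum, map_sum,
    LinearMap.sum_apply, Finset.smul_sum, ← Finset.sum_sub_distrib]
  refine Eq.trans (Finset.sum_congr rfl fun i _ => ?_) (h'.trans
    (Finset.sum_congr rfl fun j _ => ?_))
  · rw [flipLin_tmul hv (hρ i s w hw), smul_add, smul_smul, smul_smul, ← sgn_add, mul_add r,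
      mul_comm r (p i), add_sub_cancel_left]
  · rw [LinearMap.comp_apply, superLTensor_tmul (rTensor_mem (hψ j)) hv, map_smul,
      LinearMap.rTensor_tmul, LinearMap.rTensor_tmul]

end DualFamilies

/-! ### Invariant forms and invariant tensors -/

section DualModules

variable {k : Type v} [Field k] {G : Type w} [Ring G] [Algebra k G] [Superalgebra k G]
  {V V' : SMod.{w, v, u} k G}

/-- A bilinear form on a pair of supermodules is invariant if
`β(x, y M) + (-1)^{ȳ M̄} β(x M, y) = 0`. -/
def InvariantForm (β : V.carrier →ₗ[k] V'.carrier →ₗ[k] k) : Prop :=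
  ∀ t, ∀ M ∈ part k G t, ∀ x, ∀ s, ∀ y ∈ part k V'.carrier s,
    β x (V'.act y M) + sgn k (t * s) * β (V.act x M) y = 0

lemma InvariantForm.superFlip {β : V'.carrier →ₗ[k] V.carrier →ₗ[k] k}
    (hβ : InvariantForm β) : InvariantForm (superFlip β) := by
  intro t M hM x s y hy
  refine hom_induction (k := k) (P := fun x => FrobeniusBrauer.superFlip β x (V'.act y M) +
    sgn k (t * s) * FrobeniusBrauer.superFlip β (V.act x M) y = 0) ?_ ?_ x
  · intro x x' h h'
    simp only [map_add, LinearMap.add_apply, mul_add]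
    linear_combination h + h'
  · intro r x hx
    rw [superFlip_of_mem β hx (V'.act_mem hy hM), superFlip_of_mem β (V.act_mem hx hM) hy,
      mul_add, add_mul, sgn_add, sgn_add]
    have h := hβ t M hM y r x hx
    rw [mul_comm t r] at h
    linear_combination (sgn k (r * s)) * h +
      (sgn k (r * s) * β y (V.act x M)) * sgn_mul_self k (t * s)

variable {β : V'.carrier →ₗ[k] V.carrier →ₗ[k] k} {I : Type} [Fintype I] {p : I → ZMod 2}
  {x : I → V.carrier} {x' : I → V'.carrier}

/-- The tensor `∑ x_i ⊗ x'_i` is invariant. -/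
lemma DualFamilies.sum_act (h : DualFamilies β p x x') (hβ : InvariantForm β) {t : ZMod 2} {M : G}
    (hM : M ∈ part k G t) :
    ∑ i, (x i ⊗ₜ[k] V'.act (x' i) M + sgn k (t * p i) • (V.act (x i) M ⊗ₜ[k] x' i)) = 0 := by
  have e (i : I) : x i ⊗ₜ[k] V'.act (x' i) M =
      ∑ j, -sgn k (t * p j) • ((β (x' i) (V.act (x j) M) • x i) ⊗ₜ[k] x' j) := by
    rw [← h.sum' (V'.act (x' i) M), tmul_sum]
    refine Finset.sum_congr rfl fun j _ => ?_
    have hj := hβ t M hM (x' i) (p j) (x j) (h.mem j)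
    rw [tmul_smul, ← smul_tmul', smul_smul]
    congr 1
    linear_combination (sgn k (t * p j)) * hj -
      (β (V'.act (x' i) M) (x j)) * sgn_mul_self k (t * p j)
  rw [Finset.sum_add_distrib, Finset.sum_congr rfl fun i _ => e i, Finset.sum_comm,
    ← Finset.sum_add_distrib]
  refine Finset.sum_eq_zero fun j _ => ?_
  rw [← Finset.smul_sum, ← sum_tmul, h.sum, neg_smul, neg_add_cancel]

/-- The tensor `∑ (-1)^{x̄_i} x'_i ⊗ x_i` is invariant. -/
lemma DualFamilies.sum_act' (h : DualFamilies β p x x') (hβ : InvariantForm β) {t : ZMod 2}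
    {M : G} (hM : M ∈ part k G t) :
    ∑ i, ((sgn k (p i) • x' i) ⊗ₜ[k] V.act (x i) M +
      sgn k (t * p i) • (V'.act (sgn k (p i) • x' i) M ⊗ₜ[k] x i)) = 0 := by
  have e (i : I) : (sgn k (p i) • x' i) ⊗ₜ[k] V.act (x i) M =
      ∑ j, -(sgn k (p j) * sgn k (t * p j)) •
        ((β (V'.act (x' j) M) (x i) • x' i) ⊗ₜ[k] x j) := by
    rw [← h.sum (V.act (x i) M), tmul_sum]
    refine Finset.sum_congr rfl fun j _ => ?_
    have hj := hβ t M hM (x' j) (p i) (x i) (h.mem i)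
    rw [tmul_smul, ← smul_tmul', ← smul_tmul', smul_smul, smul_smul]
    congr 1
    have e1 := h.even.congr_parity (V'.act_mem (h.mem' j) hM) (h.mem i)
      fun s => sgn k (s + t * s)
    have e2 : p j + t + t * (p j + t) = p j + t * p j := by
      rcases zmod2_cases t with h | h <;> rcases zmod2_cases (p j) with h' | h' <;>
        simp [h, h']
    rw [e2] at e1
    rw [← sgn_add]
    rw [sgn_add k (p i)] at e1
    linear_combination (sgn k (p i)) * hj + e1
  rw [Finset.sum_add_distrib, Finset.sum_congr rfl fun i _ => e i, Finset.sum_comm,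
    ← Finset.sum_add_distrib]
  refine Finset.sum_eq_zero fun j _ => ?_
  rw [← Finset.smul_sum, ← sum_tmul, h.sum', map_smul, LinearMap.smul_apply, ← smul_tmul',
    smul_smul, mul_comm (sgn k (t * p j)), neg_smul, neg_add_cancel]

end DualModules

/-! ### The representation attached to a dual pair of supermodules -/

section Assembly

variable {k : Type v} [Field k] {A : Type u₁} [Ring A] [Algebra k A] [Superalgebra k A]
  {G : Type w} [Ring G] [Algebra k G] [Superalgebra k G]

lemma SMod.toLin_sum {V W : SMod.{w, v, u} k G} {ι : Type} [Fintype ι] (f : ι → (V ⟶ W)) :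
    SMod.toLin (∑ i, f i) = ∑ i, SMod.toLin (f i) := by
  let e : (V ⟶ W) →+ (V.carrier →ₗ[k] W.carrier) :=
    { toFun := SMod.toLin, map_zero' := rfl, map_add' := fun _ _ => rfl }
  exact map_sum e f Finset.univ

section Transformations

variable {V V' : SMod.{w, v, u} k G} {β : V'.carrier →ₗ[k] V.carrier →ₗ[k] k} {I : Type}
  [Fintype I] {p : I → ZMod 2} {x : I → V.carrier} {x' : I → V'.carrier}
  (h : DualFamilies β p x x') (hβ : InvariantForm β)

/-- The right cup `y ↦ ∑ (-1)^{x̄_i} x'_i ⊗ x_i ⊗ y` of a dual pair. -/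
abbrev DualFamilies.rcup :
    (superId : SEnd k (SMod.{w, v, u} k G)) ⟶ superComp (tensorLeft V') (tensorLeft V) :=
  cupTrans (fun i => sgn k (p i) • x' i) x
    (fun i => Submodule.smul_mem _ _ (h.mem' i)) h.mem fun _ _ hM => h.sum_act' hβ hM

/-- The right cap `v ⊗ u ⊗ y ↦ (-1)^{v̄ ū} β(u, v) y` of a dual pair. -/
abbrev DualFamilies.rcap :
    superComp (tensorLeft V) (tensorLeft V') ⟶ (superId : SEnd k (SMod.{w, v, u} k G)) :=
  capTrans (superFlip β) h.even.superFlip hβ.superFlip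

/-- The left cup `y ↦ ∑ x_i ⊗ x'_i ⊗ y` of a dual pair. -/
abbrev DualFamilies.lcup :
    (superId : SEnd k (SMod.{w, v, u} k G)) ⟶ superComp (tensorLeft V) (tensorLeft V') :=
  cupTrans x x' h.mem h.mem' fun _ _ hM => h.sum_act hβ hM

/-- The left cap `u ⊗ v ⊗ y ↦ β(u, v) y` of a dual pair. -/
abbrev DualFamilies.lcap :
    superComp (tensorLeft V') (tensorLeft V) ⟶ (superId : SEnd k (SMod.{w, v, u} k G)) :=
  capTrans β h.even hβ

lemma DualFamilies.right_crossing (W : SMod.{w, v, u} k G) :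
    SEnd.app (h.rcup hβ) ((tensorLeft V).obj ((tensorLeft V').obj W)) ≫
        (tensorLeft V').map (SEnd.app (flipTrans V V) ((tensorLeft V').obj W)) ≫
          (tensorLeft V').map ((tensorLeft V).map (SEnd.app (h.rcap hβ) W)) =
      SEnd.app (flipTrans V V') W := by
  have e := h.right_cross (W := W.carrier)
  refine Subtype.ext (Eq.trans ?_ e)
  rfl

lemma DualFamilies.left_crossing (W : SMod.{w, v, u} k G) :
    (tensorLeft V').map ((tensorLeft V).map (SEnd.app (h.lcup hβ) W)) ≫
        (tensorLeft V').map (SEnd.app (flipTrans V V) ((tensorLeft V').obj W)) ≫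
          SEnd.app (h.lcap hβ) ((tensorLeft V).obj ((tensorLeft V').obj W)) =
      SEnd.app (flipTrans V' V) W := by
  have e := h.left_cross (W := W.carrier)
  refine Subtype.ext (Eq.trans ?_ e)
  rfl

lemma DualFamilies.app_left_curl (W : SMod.{w, v, u} k G) :
    SEnd.app (h.rcup hβ) ((tensorLeft V).obj W) ≫ (tensorLeft V').map (SEnd.app (flipTrans V V) W) ≫
      SEnd.app (h.lcap hβ) ((tensorLeft V).obj W) = 𝟙 ((tensorLeft V).obj W) := by
  have e := h.left_curl (W := W.carrier)
  refine Subtype.ext (Eq.trans ?_ e)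
  rfl

lemma DualFamilies.app_right_curl (W : SMod.{w, v, u} k G) :
    (tensorLeft V).map (SEnd.app (h.lcup hβ) W) ≫
      SEnd.app (flipTrans V V) ((tensorLeft V').obj W) ≫
        (tensorLeft V).map (SEnd.app (h.rcap hβ) W) = 𝟙 ((tensorLeft V).obj W) := by
  have e := h.right_curl (W := W.carrier)
  refine Subtype.ext (Eq.trans ?_ e)
  rfl

lemma DualFamilies.app_zigzag_up (W : SMod.{w, v, u} k G) :
    (tensorLeft V).map (SEnd.app (h.rcup hβ) W) ≫
      SEnd.app (h.rcap hβ) ((tensorLeft V).obj W) = 𝟙 ((tensorLeft V).obj W) := by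
  have e := h.zigzag_up (W := W.carrier)
  refine Subtype.ext (Eq.trans ?_ e)
  rfl

lemma DualFamilies.app_zigzag_down (W : SMod.{w, v, u} k G) :
    SEnd.app (h.rcup hβ) ((tensorLeft V').obj W) ≫
      (tensorLeft V').map (SEnd.app (h.rcap hβ) W) = 𝟙 ((tensorLeft V').obj W) := by
  have e := h.zigzag_down (W := W.carrier)
  refine Subtype.ext (Eq.trans ?_ e)
  rfl

lemma flipTrans_braid (V W : SMod.{w, v, u} k G) :
    SEnd.app (flipTrans V V) ((tensorLeft V).obj W) ≫
        (tensorLeft V).map (SEnd.app (flipTrans V V) W) ≫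
          SEnd.app (flipTrans V V) ((tensorLeft V).obj W) =
      (tensorLeft V).map (SEnd.app (flipTrans V V) W) ≫
        SEnd.app (flipTrans V V) ((tensorLeft V).obj W) ≫
          (tensorLeft V).map (SEnd.app (flipTrans V V) W) := by
  have e := flipLin_braid (k := k) (V := V.carrier) (W := W.carrier)
  refine Subtype.ext (Eq.trans ?_ (e.trans ?_))
  · rfl
  · rfl

lemma flipTrans_comp_flipTrans (V V' W : SMod.{w, v, u} k G) :
    SEnd.app (flipTrans V V') W ≫ SEnd.app (flipTrans V' V) W =
      𝟙 ((tensorLeft V).obj ((tensorLeft V').obj W)) := by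
  refine Subtype.ext ?_
  exact flipLin_mul_self (V := V.carrier) (V' := V'.carrier) (W := W.carrier)

/-- The morphisms in a linear family with homogeneous members slide through the superflip. -/
lemma whisker_comp_flipTrans {φ : A →ₗ[k] (V ⟶ V)}
    (hφ : ∀ {r : ZMod 2} {a : A}, a ∈ part k A r →
      φ a ∈ Supercategory.homPart (k := k) V V r) (a : A) (W : SMod.{w, v, u} k G) :
    whiskerApp (φ a) ((tensorLeft V).obj W) ≫ SEnd.app (flipTrans V V) W =
      SEnd.app (flipTrans V V) W ≫ (tensorLeft V).map (whiskerApp (φ a) W) := by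
  have e : flipLin k V.carrier V.carrier W.carrier ∘ₗ
        (SMod.toLin (φ a)).rTensor (V.carrier ⊗[k] W.carrier) =
      superLTensor V.carrier ((SMod.toLin (φ a)).rTensor W.carrier) ∘ₗ
        flipLin k V.carrier V.carrier W.carrier := by
    refine hom_induction (k := k) (P := fun a => flipLin k V.carrier V.carrier W.carrier ∘ₗ
        (SMod.toLin (φ a)).rTensor (V.carrier ⊗[k] W.carrier) =
      superLTensor V.carrier ((SMod.toLin (φ a)).rTensor W.carrier) ∘ₗ
        flipLin k V.carrier V.carrier W.carrier) ?_ ?_ a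
    · intro a b ha hb
      have e : SMod.toLin (φ (a + b)) = SMod.toLin (φ a) + SMod.toLin (φ b) :=
        congrArg SMod.toLin (map_add φ a b)
      rw [e, LinearMap.rTensor_add, LinearMap.rTensor_add, superLTensor_add, LinearMap.comp_add,
        LinearMap.add_comp, ha, hb]
    · intro r a ha
      exact flipLin_comp_rTensor (hφ ha)
  exact Subtype.ext e

variable {J : Type} [Fintype J] {q : J → ZMod 2} {M N : J → G} (hM : ∀ j, M j ∈ part k G (q j))
  (hN : ∀ j, N j ∈ part k G (q j))
  (hΩ : ∀ t, ∀ X ∈ part k G t, ∑ j, (M j ⊗ₜ[k] superBracket k G (N j) X +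
    sgn k (q j * t) • (superBracket k G (M j) X ⊗ₜ[k] N j)) = 0)

lemma omegaTrans_comp_whisker (φ : V ⟶ V) (W : SMod.{w, v, u} k G) :
    SEnd.app (omegaTrans V hM hN hΩ) W ≫ whiskerApp φ W =
      whiskerApp φ W ≫ SEnd.app (omegaTrans V hM hN hΩ) W := by
  have e : (SMod.toLin φ).rTensor W.carrier ∘ₗ
        omegaLin q (fun j => V.rmul (M j)) (fun j => W.rmul (N j)) =
      omegaLin q (fun j => V.rmul (M j)) (fun j => W.rmul (N j)) ∘ₗ
        (SMod.toLin φ).rTensor W.carrier :=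
    TensorProduct.ext' fun v w => by
      rw [LinearMap.comp_apply, LinearMap.comp_apply, LinearMap.rTensor_tmul, omegaLin_tmul,
        omegaLin_tmul, map_sum]
      exact Finset.sum_congr rfl fun j _ => congrArg (· ⊗ₜ[k] _) (φ.2 v (M j))
  exact Subtype.ext e

/-- The difference of the two ways of combining the superflip with the action of `∑ M_j ⊗ N_j` is
the action of this tensor on the two factors that are flipped. -/
lemma flipTrans_omegaTrans (F : SymmetricFrobenius k A) {φ : A →ₗ[k] (V ⟶ V)}
    (hφ : ∀ {r : ZMod 2} {a : A}, a ∈ part k A r →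
      φ a ∈ Supercategory.homPart (k := k) V V r)
    (hcross : ∀ r, ∀ v ∈ part k V.carrier r, ∀ s, ∀ w ∈ part k V.carrier s,
      ∑ j, sgn k (r * s + q j * r) • (V.act w (M j) ⊗ₜ[k] V.act v (N j)) =
        ∑ b, sgn k (F.parity b * r) •
          (SMod.toLin (φ (F.basis b)) v ⊗ₜ[k] SMod.toLin (φ (F.dual b)) w))
    (W : SMod.{w, v, u} k G) :
    (SEnd.app (flipTrans V V) W ≫ SEnd.app (omegaTrans V hM hN hΩ) ((tensorLeft V).obj W) :
        (tensorLeft V).obj ((tensorLeft V).obj W) ⟶ (tensorLeft V).obj ((tensorLeft V).obj W)) -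
      ((tensorLeft V).map (SEnd.app (omegaTrans V hM hN hΩ) W) ≫ SEnd.app (flipTrans V V) W :
        (tensorLeft V).obj ((tensorLeft V).obj W) ⟶ (tensorLeft V).obj ((tensorLeft V).obj W)) =
    ∑ b, (tensorLeft V).map (whiskerApp (φ (F.dual b)) W) ≫
      whiskerApp (φ (F.basis b)) ((tensorLeft V).obj W) := by
  have e : omegaLin q (fun j => V.rmul (M j)) (fun j => (V.tensor W).rmul (N j)) =
      omegaLin (V := V.carrier) (W := V.carrier ⊗[k] W.carrier) q (fun j => V.rmul (M j))
        (fun j => superAct (q j) (V.rmul (N j)) (W.rmul (N j))) :=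
    congrArg (omegaLin (V := V.carrier) (W := V.carrier ⊗[k] W.carrier) q
      fun j => V.rmul (M j)) (funext fun j => SMod.rmul_tensor V W (hN j))
  have e' := omegaLin_comp_flipLin_sub (W := W.carrier) (fun j => V.rmul_mem (hM j))
    (fun j => W.rmul_mem (hN j)) (φ := fun b => SMod.toLin (φ (F.basis b)))
    (ψ := fun b => SMod.toLin (φ (F.dual b)))
    (fun b => hφ (F.dual_mem b)) (fun j => V.rmul (N j)) hcross
  rw [← e] at e'
  have e'' := SMod.toLin_sum (fun b => (tensorLeft V).map (whiskerApp (φ (F.dual b)) W) ≫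
      whiskerApp (φ (F.basis b)) ((tensorLeft V).obj W))
  refine Subtype.ext (Eq.trans ?_ (e'.trans e''.symm))
  rfl

end Transformations

/-- A pair of dual supermodules, an action of `A` on one of them and an invariant tensor
`∑ M_j ⊗ N_j` whose action on the tensor square is the superflip followed by the teleporter
`∑ b ⊗ b^∨` give a representation of the relations of `AOB(A)`. -/
def dualPairRep (F : SymmetricFrobenius k A) {V V' : SMod.{w, v, u} k G}
    {β : V'.carrier →ₗ[k] V.carrier →ₗ[k] k} {I : Type} [Fintype I] {p : I → ZMod 2}
    {x : I → V.carrier} {x' : I → V'.carrier} (h : DualFamilies β p x x')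
    (hβ : InvariantForm β) (φ : A →ₗ[k] (V ⟶ V))
    (hφ : ∀ {r : ZMod 2} {a : A}, a ∈ part k A r →
      φ a ∈ Supercategory.homPart (k := k) V V r)
    (φ_one : φ 1 = 𝟙 V) (φ_mul : ∀ a b, φ b ≫ φ a = φ (a * b))
    {J : Type} [Fintype J] {q : J → ZMod 2} {M N : J → G} (hM : ∀ j, M j ∈ part k G (q j))
    (hN : ∀ j, N j ∈ part k G (q j))
    (hΩ : ∀ t, ∀ X ∈ part k G t, ∑ j, (M j ⊗ₜ[k] superBracket k G (N j) X +
      sgn k (q j * t) • (superBracket k G (M j) X ⊗ₜ[k] N j)) = 0)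
    (hcross : ∀ r, ∀ v ∈ part k V.carrier r, ∀ s, ∀ w ∈ part k V.carrier s,
      ∑ j, sgn k (r * s + q j * r) • (V.act w (M j) ⊗ₜ[k] V.act v (N j)) =
        ∑ b, sgn k (F.parity b * r) •
          (SMod.toLin (φ (F.basis b)) v ⊗ₜ[k] SMod.toLin (φ (F.dual b)) w)) :
    AOBRep F (tensorLeft V) (tensorLeft V') where
  cross := flipTrans V V
  token := whisker ∘ₗ φ
  rcup := h.rcup hβ
  rcap := h.rcap hβ
  lcup := h.lcup hβ
  lcap := h.lcap hβ
  dot := omegaTrans V hM hN hΩ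
  cross_mem := evenTrans_mem _ _ _ _
  token_mem ha := whiskerApp_mem (hφ ha)
  rcup_mem := evenTrans_mem _ _ _ _
  rcap_mem := evenTrans_mem _ _ _ _
  lcup_mem := evenTrans_mem _ _ _ _
  lcap_mem := evenTrans_mem _ _ _ _
  dot_mem := evenTrans_mem _ _ _ _
  token_one W := Subtype.ext (by
    have h : SMod.toLin (φ 1) = LinearMap.id := congrArg SMod.toLin φ_one
    exact (congrArg (LinearMap.rTensor W.carrier) h).trans
      (LinearMap.rTensor_id W.carrier V.carrier))
  token_mul a b W := Subtype.ext (by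
    have h : SMod.toLin (φ a) ∘ₗ SMod.toLin (φ b) = SMod.toLin (φ (a * b)) :=
      congrArg SMod.toLin (φ_mul a b)
    exact (LinearMap.rTensor_comp W.carrier (SMod.toLin (φ a)) (SMod.toLin (φ b))).symm.trans
      (congrArg (LinearMap.rTensor W.carrier) h))
  cross_cross := flipTrans_comp_flipTrans V V
  braid := flipTrans_braid V
  token_cross a W := whisker_comp_flipTrans hφ a W
  right_left W := (congrArg₂ (· ≫ ·) (h.right_crossing hβ W) (h.left_crossing hβ W)).trans
    (flipTrans_comp_flipTrans V V' W)
  left_right W := (congrArg₂ (· ≫ ·) (h.left_crossing hβ W) (h.right_crossing hβ W)).trans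
    (flipTrans_comp_flipTrans V' V W)
  left_curl := h.app_left_curl hβ
  right_curl := h.app_right_curl hβ
  zigzag_up := h.app_zigzag_up hβ
  zigzag_down := h.app_zigzag_down hβ
  dot_cross := flipTrans_omegaTrans hM hN hΩ F hφ hcross
  dot_token a W := omegaTrans_comp_whisker hM hN hΩ (φ a) W

end Assembly

/-! ### The Casimir element of a symmetric Frobenius superalgebra -/

section Casimir

variable {k : Type v} [Field k] {A : Type u} [Ring A] [Algebra k A] [Superalgebra k A]
  (F : SymmetricFrobenius k A)

namespace SymmetricFrobenius

lemma sum_tr_dual_mul (x : A) : ∑ b, F.tr (F.dual b * x) • F.basis b = x := by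
  have h (b : F.ι) : F.tr (F.dual b * x) = F.basis.repr x b := by
    conv_lhs => rw [← F.basis.sum_repr x]
    simp [-Module.Basis.sum_repr, Finset.mul_sum, F.tr_dual_mul]
  simp only [h, F.basis.sum_repr]

/-- The trace form is nondegenerate. -/
lemma eq_zero_of_tr_mul_basis {x : A} (hx : ∀ b, F.tr (x * F.basis b) = 0) : x = 0 := by
  have hfin : Module.Finite k A := Module.Finite.of_basis F.basis
  let Φ : A →ₗ[k] (F.ι → k) := LinearMap.pi fun c => F.tr ∘ₗ LinearMap.mulRight k (F.basis c)
  have hsurj : Function.Surjective Φ := fun g => ⟨∑ c, g c • F.dual c, funext fun d => by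
    change F.tr ((∑ c, g c • F.dual c) * F.basis d) = g d
    simp [Finset.sum_mul, F.tr_dual_mul]⟩
  have hinj : Function.Injective Φ :=
    (LinearMap.injective_iff_surjective_of_finrank_eq_finrank
      (by rw [Module.finrank_eq_card_basis F.basis]; simp)).2 hsurj
  exact hinj ((funext hx : Φ x = 0).trans (map_zero Φ).symm)

lemma sum_tr_mul_basis (x : A) : ∑ b, F.tr (x * F.basis b) • F.dual b = x := by
  refine sub_eq_zero.1 (F.eq_zero_of_tr_mul_basis fun c => ?_)
  simp [sub_mul, Finset.sum_mul, F.tr_dual_mul]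

lemma tr_eq_zero {r : ZMod 2} {x : A} (hx : x ∈ part k A r) (hr : r ≠ 0) : F.tr x = 0 := by
  rcases zmod2_cases r with rfl | rfl
  · exact absurd rfl hr
  · exact F.tr_odd x hx

/-- A homogeneous element moves from the left of `b` to the right of `b^∨` in `∑ b ⊗ b^∨`.  The
weight `g` depends on the parity of `b`, which is shifted by the parity of the element. -/
lemma sum_mul_basis_tmul_dual (g : ZMod 2 → k) {t : ZMod 2} {x : A} (hx : x ∈ part k A t) :
    ∑ b, g (F.parity b) • ((x * F.basis b) ⊗ₜ[k] F.dual b) =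
      ∑ c, g (F.parity c + t) • (F.basis c ⊗ₜ[k] (F.dual c * x)) := by
  have h (b : F.ι) : g (F.parity b) • ((x * F.basis b) ⊗ₜ[k] F.dual b) =
      ∑ c, g (F.parity c + t) • (F.tr (F.dual c * x * F.basis b) •
        (F.basis c ⊗ₜ[k] F.dual b)) := by
    conv_lhs => rw [← F.sum_tr_dual_mul (x * F.basis b), sum_tmul, Finset.smul_sum]
    refine Finset.sum_congr rfl fun c _ => ?_
    rw [← smul_tmul', mul_assoc]
    -- the coefficient vanishes unless the parities match, as the trace is even
    by_cases hc : F.parity b = F.parity c + t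
    · rw [hc]
    · have h0 : F.tr (F.dual c * (x * F.basis b)) = 0 :=
        F.tr_eq_zero (Superalgebra.mul_mem (F.dual_mem c)
          (Superalgebra.mul_mem hx (F.basis_mem b))) fun h => hc (by
            linear_combination h - zmod2_add_self (F.parity c) - zmod2_add_self t)
      rw [h0, zero_smul, smul_zero, smul_zero]
  rw [Finset.sum_congr rfl fun b _ => h b, Finset.sum_comm]
  refine Finset.sum_congr rfl fun c _ => ?_
  rw [← Finset.smul_sum]
  conv_rhs => rw [← F.sum_tr_mul_basis (F.dual c * x), tmul_sum]
  simp only [tmul_smul]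

/-- A homogeneous element moves from the right of `b` to the left of `b^∨` in `∑ b ⊗ b^∨`; here the
supersymmetry of the trace contributes a sign. -/
lemma sum_basis_mul_tmul_dual (g : ZMod 2 → k) {t : ZMod 2} {x : A} (hx : x ∈ part k A t) :
    ∑ b, g (F.parity b) • ((F.basis b * x) ⊗ₜ[k] F.dual b) =
      ∑ c, (sgn k t * g (F.parity c + t)) • (F.basis c ⊗ₜ[k] (x * F.dual c)) := by
  have h (b : F.ι) : g (F.parity b) • ((F.basis b * x) ⊗ₜ[k] F.dual b) =
      ∑ c, (sgn k t * g (F.parity c + t)) • (F.tr (x * F.dual c * F.basis b) •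
        (F.basis c ⊗ₜ[k] F.dual b)) := by
    conv_lhs => rw [← F.sum_tr_dual_mul (F.basis b * x), sum_tmul, Finset.smul_sum]
    refine Finset.sum_congr rfl fun c _ => ?_
    have hcb := Superalgebra.mul_mem (F.dual_mem c) (F.basis_mem b)
    rw [← smul_tmul', ← mul_assoc, mul_assoc x, F.tr_symm hcb hx, smul_smul, smul_smul]
    congr 1
    by_cases hc : F.parity b = F.parity c + t
    · rw [hc, ← add_assoc, zmod2_add_self, zero_add]
      rcases zmod2_cases t with rfl | rfl <;> simp
    · have h0 : F.tr (x * (F.dual c * F.basis b)) = 0 :=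
        F.tr_eq_zero (Superalgebra.mul_mem hx hcb) fun h => hc (by
            linear_combination h - zmod2_add_self (F.parity c) - zmod2_add_self t)
      rw [h0, mul_zero, mul_zero, mul_zero]
  rw [Finset.sum_congr rfl fun b _ => h b, Finset.sum_comm]
  refine Finset.sum_congr rfl fun c _ => ?_
  rw [← Finset.smul_sum]
  conv_rhs => rw [← F.sum_tr_mul_basis (x * F.dual c), tmul_sum]
  simp only [tmul_smul]

/-- The Casimir element `∑ b ⊗ b^∨` is invariant under the superbracket. -/
lemma casimir_invariant (t : ZMod 2) (x : A) (hx : x ∈ part k A t) :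
    ∑ b, (F.basis b ⊗ₜ[k] superBracket k A (F.dual b) x +
      sgn k (F.parity b * t) • (superBracket k A (F.basis b) x ⊗ₜ[k] F.dual b)) = 0 := by
  have h₁ := F.sum_mul_basis_tmul_dual (fun _ => 1) hx
  have h₂ := F.sum_basis_mul_tmul_dual (fun r => sgn k (r * t)) hx
  have h₃ : ∑ b, sgn k (F.parity b * t) • ((F.basis b * x) ⊗ₜ[k] F.dual b) =
      ∑ b, sgn k (F.parity b * t) • (F.basis b ⊗ₜ[k] (x * F.dual b)) :=
    h₂.trans (Finset.sum_congr rfl fun b _ => by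
      congr 1
      rcases zmod2_cases t with rfl | rfl <;> simp [sgn_add])
  simp only [one_smul] at h₁
  simp only [superBracket_of_mem (F.basis_mem _) hx, superBracket_of_mem (F.dual_mem _) hx,
    tmul_sub, sub_tmul, tmul_smul, ← smul_tmul', smul_sub, smul_smul, sgn_mul_self, one_smul,
    Finset.sum_add_distrib, Finset.sum_sub_distrib, h₁, h₃]
  abel

end SymmetricFrobenius

end Casimir

/-! ### The general linear Lie superalgebra and its natural modules -/

lemma rowMul_single {k : Type v} [Field k] {A : Type u} [Ring A] [Algebra k A] {m n : ℕ}
    (x : Fin m ⊕ Fin n → A) (i j : Fin m ⊕ Fin n) (a : A) :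
    rowMul k A m n x (Matrix.single i j a) = Pi.single j (x i * a) := by
  refine funext fun l => ?_
  change ∑ i', x i' * Matrix.single i j a i' l = _
  rw [Finset.sum_eq_single i]
  · by_cases h : l = j
    · subst h
      rw [Matrix.single_apply_same, Pi.single_eq_same]
    · have e : Matrix.single i j a i l = 0 := if_neg fun h' => h h'.2.symm
      rw [e, mul_zero, Pi.single_eq_of_ne h]
  · intro i' _ h
    have e : Matrix.single i j a i' l = 0 := if_neg fun h' => h h'.1.symm
    rw [e, mul_zero]
  · simp

section GeneralLinearData

variable {k : Type v} [Field k] {A : Type u} [Ring A] [Algebra k A] [Superalgebra k A]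
  (F : SymmetricFrobenius k A) {m n : ℕ}

lemma matrixSingle_mem {r : ZMod 2} {a : A} (ha : a ∈ part k A r) (i j : Fin m ⊕ Fin n) :
    Matrix.single i j a ∈ part k (Matrix (Fin m ⊕ Fin n) (Fin m ⊕ Fin n) A)
      (r + idxParity i + idxParity j) := by
  intro i' j'
  by_cases h : i = i' ∧ j = j'
  · obtain ⟨rfl, rfl⟩ := h
    rw [Matrix.single_apply_same, add_assoc, add_assoc, add_assoc r,
      show idxParity i + (idxParity j + (idxParity i + idxParity j)) =
        (idxParity i + idxParity i) + (idxParity j + idxParity j) by ring, zmod2_add_self,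
      zmod2_add_self, add_zero, add_zero]
    exact ha
  · have e : Matrix.single i j a i' j' = 0 := if_neg h
    rw [e]
    exact zero_mem _

variable (m n) in
/-- The supertrace `M ↦ ∑ (-1)^{p(i)} tr(M_{ii})`. -/
def SymmetricFrobenius.supertrace : Matrix (Fin m ⊕ Fin n) (Fin m ⊕ Fin n) A →ₗ[k] k :=
  ∑ i, sgn k (idxParity i) • (F.tr ∘ₗ Matrix.entryLinearMap k A i i)

lemma SymmetricFrobenius.supertrace_apply (M : Matrix (Fin m ⊕ Fin n) (Fin m ⊕ Fin n) A) :
    F.supertrace m n M = ∑ i, sgn k (idxParity i) * F.tr (M i i) := by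
  simp only [SymmetricFrobenius.supertrace, LinearMap.sum_apply]
  rfl

lemma SymmetricFrobenius.supertrace_single (i j : Fin m ⊕ Fin n) (a : A) :
    F.supertrace m n (Matrix.single i j a) =
      if i = j then sgn k (idxParity i) * F.tr a else 0 := by
  rw [F.supertrace_apply]
  by_cases h : i = j
  · subst h
    rw [Finset.sum_eq_single i, Matrix.single_apply_same, if_pos rfl]
    · intro l _ hl
      have e : Matrix.single i i a l l = 0 := if_neg fun h => hl h.1.symm
      rw [e, map_zero, mul_zero]
    · simp
  · rw [if_neg h]
    refine Finset.sum_eq_zero fun l _ => ?_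
    have e : Matrix.single i j a l l = 0 := if_neg fun h' => h (h'.1.trans h'.2.symm)
    rw [e, map_zero, mul_zero]

lemma SymmetricFrobenius.supertrace_odd {M : Matrix (Fin m ⊕ Fin n) (Fin m ⊕ Fin n) A}
    (hM : M ∈ part k (Matrix (Fin m ⊕ Fin n) (Fin m ⊕ Fin n) A) 1) :
    F.supertrace m n M = 0 := by
  rw [F.supertrace_apply]
  refine Finset.sum_eq_zero fun i _ => ?_
  have h := hM i i
  rw [add_assoc, zmod2_add_self, add_zero] at h
  rw [F.tr_odd _ h, mul_zero]

lemma SymmetricFrobenius.supertrace_symm {r s : ZMod 2}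
    {M N : Matrix (Fin m ⊕ Fin n) (Fin m ⊕ Fin n) A}
    (hM : M ∈ part k (Matrix (Fin m ⊕ Fin n) (Fin m ⊕ Fin n) A) r)
    (hN : N ∈ part k (Matrix (Fin m ⊕ Fin n) (Fin m ⊕ Fin n) A) s) :
    F.supertrace m n (M * N) = sgn k (r * s) * F.supertrace m n (N * M) := by
  by_cases hrs : r = s
  · subst hrs
    simp only [F.supertrace_apply, Matrix.mul_apply, map_sum, Finset.mul_sum]
    rw [Finset.sum_comm]
    refine Finset.sum_congr rfl fun l _ => Finset.sum_congr rfl fun i _ => ?_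
    rw [F.tr_symm (hM i l) (hN l i), ← mul_assoc, ← mul_assoc, ← sgn_add, ← sgn_add]
    congr 2
    generalize idxParity i = a
    generalize idxParity l = b
    clear hM hN
    decide +revert
  · -- both products are odd, so that their supertraces vanish
    have h : r + s = 1 := by
      clear hM hN
      decide +revert
    have h₁ := Superalgebra.mul_mem hM hN
    have h₂ := Superalgebra.mul_mem hN hM
    rw [h] at h₁
    rw [add_comm, h] at h₂
    rw [F.supertrace_odd h₁, F.supertrace_odd h₂, mul_zero]

variable (m n) in
/-- The symmetric Frobenius superalgebra of matrices over a symmetric Frobenius superalgebra, with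
the supertrace, the basis `b_{(i,j)}` and the dual basis `(-1)^{p(j)} (b^∨)_{(j,i)}`. -/
def SymmetricFrobenius.matrix :
    SymmetricFrobenius k (Matrix (Fin m ⊕ Fin n) (Fin m ⊕ Fin n) A) where
  tr := F.supertrace m n
  tr_odd _ := F.supertrace_odd
  tr_symm := F.supertrace_symm
  ι := (Fin m ⊕ Fin n) × (Fin m ⊕ Fin n) × F.ι
  basis := F.basis.matrix (Fin m ⊕ Fin n) (Fin m ⊕ Fin n)
  parity b := F.parity b.2.2 + idxParity b.1 + idxParity b.2.1
  basis_mem b := by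
    rw [Module.Basis.matrix_apply]
    exact matrixSingle_mem (F.basis_mem b.2.2) b.1 b.2.1
  dual b := sgn k (idxParity b.2.1) • Matrix.single b.2.1 b.1 (F.dual b.2.2)
  tr_dual_mul := by
    rintro ⟨i, j, b⟩ ⟨i', j', c⟩
    rw [Module.Basis.matrix_apply, smul_mul_assoc, map_smul, smul_eq_mul]
    change sgn k (idxParity j) * F.supertrace m n
      (Matrix.single j i (F.dual b) * Matrix.single i' j' (F.basis c)) = _
    by_cases hi : i = i'
    · subst hi
      rw [Matrix.single_mul_single_same, F.supertrace_single, F.tr_dual_mul]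
      by_cases hj : j = j'
      · subst hj
        rw [if_pos rfl, ← mul_assoc, sgn_mul_self, one_mul]
        simp
      · simp [hj]
    · rw [Matrix.single_mul_single_of_ne _ _ _ _ hi]
      simp [hi]

/-- `Ω` is the Casimir element of the Frobenius superalgebra of matrices. -/
lemma SymmetricFrobenius.Omega_eq :
    F.Omega m n = ∑ b, (F.matrix m n).basis b ⊗ₜ[k] (F.matrix m n).dual b := by
  refine Eq.trans ?_ (Fintype.sum_prod_type' fun i (p : (Fin m ⊕ Fin n) × F.ι) =>
    (F.matrix m n).basis (i, p) ⊗ₜ[k] (F.matrix m n).dual (i, p)).symm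
  refine Finset.sum_congr rfl fun i _ => ?_
  refine Eq.trans ?_ (Fintype.sum_prod_type' fun j b =>
    (F.matrix m n).basis (i, j, b) ⊗ₜ[k] (F.matrix m n).dual (i, j, b)).symm
  refine Finset.sum_congr rfl fun j _ => Finset.sum_congr rfl fun b _ => ?_
  exact congrArg (· ⊗ₜ[k] _) (Module.Basis.matrix_apply F.basis i j b).symm

/-- The bilinear form is `B(x ⊗ y) = ∑ (-1)^{p(i)} tr(x_i y_i)`, for arbitrary vectors. -/
lemma formB_eq (x y : Fin m ⊕ Fin n → A) :
    F.formB m n x y = ∑ i, sgn k (idxParity i) * F.tr (x i * y i) := by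
  refine hom_induction (k := k) (P := fun x =>
    F.formB m n x y = ∑ i, sgn k (idxParity i) * F.tr (x i * y i)) ?_ ?_ x
  · intro x x' h h'
    simp only [map_add, LinearMap.add_apply, h, h', Pi.add_apply, add_mul, mul_add,
      Finset.sum_add_distrib]
  intro r x hx
  refine hom_induction (k := k) (P := fun y =>
    F.formB m n x y = ∑ i, sgn k (idxParity i) * F.tr (x i * y i)) ?_ ?_ y
  · intro y y' h h'
    simp only [map_add, h, h', Pi.add_apply, mul_add, Finset.sum_add_distrib]
  intro s y hy
  rw [formB_of_mem hx hy, dotProduct, map_sum, Finset.mul_sum]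
  refine Finset.sum_congr rfl fun i _ => ?_
  by_cases hrs : r = s
  · subst hrs
    rw [F.tr_symm (hx i) (hy i), ← mul_assoc, ← sgn_add]
    congr 2
    generalize idxParity i = a
    clear hx hy
    decide +revert
  · -- both products are odd, so that their traces vanish
    have h (a : ZMod 2) : s + a + (r + a) ≠ 0 := by
      clear hx hy
      decide +revert
    have h' (a : ZMod 2) : r + a + (s + a) ≠ 0 := by
      clear hx hy
      decide +revert
    rw [F.tr_eq_zero (Superalgebra.mul_mem (hy i) (hx i)) (h _),
      F.tr_eq_zero (Superalgebra.mul_mem (hx i) (hy i)) (h' _), mul_zero, mul_zero]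

lemma formB_even : EvenForm (k := k) (V := Fin m ⊕ Fin n → A) (V' := Fin m ⊕ Fin n → A)
    (F.formB m n) := by
  intro r x hx s y hy hrs
  rw [formB_eq]
  refine Finset.sum_eq_zero fun i _ => ?_
  have h (a : ZMod 2) : r + a + (s + a) ≠ 0 := by
    clear hx hy
    decide +revert
  rw [F.tr_eq_zero (Superalgebra.mul_mem (hx i) (hy i)) (h _), mul_zero]

/-- The bases of `V₊` and `V₋` form a dual pair. -/
lemma dualFamilies_vec : DualFamilies (k := k) (V := Fin m ⊕ Fin n → A)
    (V' := Fin m ⊕ Fin n → A) (F.formB m n) (F.vecParity m n) (F.vec m n) (F.dualVec m n) where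
  even := formB_even F
  mem p := single_mem (F.basis_mem p.2) p.1
  mem' p := Submodule.smul_mem _ _ (single_mem (F.dual_mem p.2) p.1)
  sum w := by
    have h (i : Fin m ⊕ Fin n) (b : F.ι) : F.formB m n (F.dualVec m n (i, b)) w =
        F.tr (F.dual b * w i) := by
      rw [SymmetricFrobenius.dualVec, map_smul, LinearMap.smul_apply, formB_eq, smul_eq_mul,
        Finset.sum_eq_single i, Pi.single_eq_same, ← mul_assoc, sgn_mul_self, one_mul]
      · intro l _ hl
        rw [Pi.single_eq_of_ne hl, zero_mul, map_zero, mul_zero]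
      · simp
    rw [Fintype.sum_prod_type]
    conv_rhs => rw [← Finset.univ_sum_single w]
    refine Finset.sum_congr rfl fun i _ => ?_
    conv_rhs => rw [← F.sum_tr_dual_mul (w i)]
    simp only [h, SymmetricFrobenius.vec]
    exact ((map_sum (LinearMap.single k (fun _ : Fin m ⊕ Fin n => A) i) _ _).trans
      (Finset.sum_congr rfl fun b _ => map_smul _ _ _)).symm
  sum' u := by
    have h (i : Fin m ⊕ Fin n) (b : F.ι) : F.formB m n u (F.vec m n (i, b)) =
        sgn k (idxParity i) * F.tr (u i * F.basis b) := by
      rw [SymmetricFrobenius.vec, formB_eq, Finset.sum_eq_single i, Pi.single_eq_same]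
      · intro l _ hl
        rw [Pi.single_eq_of_ne hl, mul_zero, map_zero, mul_zero]
      · simp
    rw [Fintype.sum_prod_type]
    conv_rhs => rw [← Finset.univ_sum_single u]
    refine Finset.sum_congr rfl fun i _ => ?_
    conv_rhs => rw [← F.sum_tr_mul_basis (u i)]
    simp only [h, SymmetricFrobenius.dualVec, smul_smul]
    refine Eq.symm ((map_sum (LinearMap.single k (fun _ : Fin m ⊕ Fin n => A) i) _ _).trans
      (Finset.sum_congr rfl fun b _ => (map_smul _ _ _).trans ?_))
    rw [mul_right_comm, sgn_mul_self, one_mul]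
    rfl

/-- The form `B` is invariant under the actions of matrices on `V₋` and `V₊`. -/
lemma formB_act {t s : ZMod 2} {M : Matrix (Fin m ⊕ Fin n) (Fin m ⊕ Fin n) A}
    (hM : M ∈ part k (Matrix (Fin m ⊕ Fin n) (Fin m ⊕ Fin n) A) t) (x : Fin m ⊕ Fin n → A)
    {y : Fin m ⊕ Fin n → A} (hy : y ∈ part k (Fin m ⊕ Fin n → A) s) :
    F.formB m n x (rowMul k A m n y M) +
      sgn k (t * s) * F.formB m n (colAct k A m n x M) y = 0 := by
  refine hom_induction (k := k) (P := fun x => F.formB m n x (rowMul k A m n y M) +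
    sgn k (t * s) * F.formB m n (colAct k A m n x M) y = 0) ?_ ?_ x
  · intro x x' h h'
    simp only [map_add, LinearMap.add_apply, mul_add]
    linear_combination h + h'
  intro r x hx
  have e : F.formB m n (colAct k A m n x M) y =
      -(sgn k (r * t) * (sgn k ((r + t) * s) * F.tr (y ⬝ᵥ Matrix.mulVec M x))) := by
    have e := formB_of_mem (F := F) (mulCol_mem hx hM) hy
    change F.formB m n (Matrix.mulVec M x) y =
      sgn k ((r + t) * s) * F.tr (y ⬝ᵥ Matrix.mulVec M x) at e
    rw [colAct_apply hx hM, map_neg, map_smul, LinearMap.neg_apply, LinearMap.smul_apply, e,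
      smul_eq_mul]
  rw [e, formB_of_mem hx (rowMul_mem hy hM)]
  change sgn k (r * (s + t)) * F.tr (Matrix.vecMul y M ⬝ᵥ x) + _ = 0
  rw [← Matrix.dotProduct_mulVec, mul_neg, ← mul_assoc, ← mul_assoc, ← sgn_add, ← sgn_add]
  have e' : t * s + r * t + (r + t) * s = r * (s + t) := by
    clear hM hx hy e
    decide +revert
  rw [e', add_neg_cancel]

lemma formB_invariant :
    InvariantForm (V := Vminus k A m n) (V' := Vplus k A m n) (F.formB m n) :=
  fun _ _ hM x _ _ hy => formB_act F hM x hy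

/-- Left multiplication by elements of `A` on row vectors, as endomorphisms of `V₊`. -/
def leftMul (k : Type v) [Field k] (A : Type u) [Ring A] [Algebra k A] [Superalgebra k A]
    (m n : ℕ) : A →ₗ[k] (Vplus k A m n ⟶ Vplus k A m n) where
  toFun a := ⟨LinearMap.compLeft (LinearMap.mulLeft k a) (Fin m ⊕ Fin n), fun x M => by
    refine funext fun j => ?_
    change a * ∑ i, x i * M i j = ∑ i, a * x i * M i j
    simp only [Finset.mul_sum, mul_assoc]⟩
  map_add' a b := Subtype.ext (LinearMap.ext fun x => funext fun i => add_mul a b (x i))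
  map_smul' c a := Subtype.ext (LinearMap.ext fun x => funext fun i => smul_mul_assoc c a (x i))

lemma leftMul_mem {r : ZMod 2} {a : A} (ha : a ∈ part k A r) :
    leftMul k A m n a ∈ Supercategory.homPart (k := k) (Vplus k A m n) (Vplus k A m n) r := by
  intro s x hx i
  have h := Superalgebra.mul_mem ha (hx i)
  rw [← add_assoc, add_comm r s] at h
  exact h

lemma leftMul_one : leftMul k A m n 1 = 𝟙 (Vplus k A m n) :=
  Subtype.ext (LinearMap.ext fun x => funext fun i => one_mul (x i))

lemma leftMul_comp (a b : A) : leftMul k A m n b ≫ leftMul k A m n a = leftMul k A m n (a * b) :=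
  Subtype.ext (LinearMap.ext fun x => funext fun i => (mul_assoc a b (x i)).symm)

/-- The identity of teleporters in `A ⊗ A` behind the action of `Ω` on `V₊ ⊗ V₊`. -/
lemma SymmetricFrobenius.sum_mul_basis_tmul_mul_dual {r s p q : ZMod 2} {x y : A}
    (hx : x ∈ part k A (r + q)) (hy : y ∈ part k A (s + p)) :
    ∑ b, (sgn k (r * s + (F.parity b + p + q) * r) * sgn k q) •
        ((y * F.basis b) ⊗ₜ[k] (x * F.dual b)) =
      ∑ b, sgn k (F.parity b * r) • ((F.basis b * x) ⊗ₜ[k] (F.dual b * y)) := by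
  have h₁ := congrArg (LinearMap.lTensor A (LinearMap.mulLeft k x))
    (F.sum_mul_basis_tmul_dual (fun b => sgn k (r * s + (b + p + q) * r) * sgn k q) hy)
  have h₂ := congrArg (LinearMap.lTensor A (LinearMap.mulRight k y))
    (F.sum_basis_mul_tmul_dual (fun b => sgn k (b * r)) hx)
  simp only [map_sum, map_smul, LinearMap.lTensor_tmul, LinearMap.mulLeft_apply,
    LinearMap.mulRight_apply] at h₁ h₂
  rw [h₁, h₂]
  refine Finset.sum_congr rfl fun b _ => ?_
  rw [mul_assoc, ← sgn_add, ← sgn_add]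
  congr 2
  generalize F.parity b = c
  clear hx hy h₁ h₂
  decide +revert

/-- On `V₊ ⊗ V₊` the tensor `Ω` acts as the superflip followed by the teleporter. -/
lemma sum_rowMul_tmul_rowMul {r s : ZMod 2} {x y : Fin m ⊕ Fin n → A}
    (hx : x ∈ part k (Fin m ⊕ Fin n → A) r) (hy : y ∈ part k (Fin m ⊕ Fin n → A) s) :
    ∑ j, sgn k (r * s + (F.matrix m n).parity j * r) •
        (rowMul k A m n y ((F.matrix m n).basis j) ⊗ₜ[k]
          rowMul k A m n x ((F.matrix m n).dual j)) =
      ∑ b, sgn k (F.parity b * r) •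
        ((fun i => F.basis b * x i : Fin m ⊕ Fin n → A) ⊗ₜ[k]
          (fun i => F.dual b * y i : Fin m ⊕ Fin n → A)) := by
  let S (i : Fin m ⊕ Fin n) : A →ₗ[k] Fin m ⊕ Fin n → A := LinearMap.single k (fun _ => A) i
  have h (i j : Fin m ⊕ Fin n) := congrArg (TensorProduct.map (S j) (S i))
    (F.sum_mul_basis_tmul_mul_dual (hx j) (hy i))
  simp only [map_sum, map_smul, TensorProduct.map_tmul] at h
  have hR (b : F.ι) : ((fun i => F.basis b * x i : Fin m ⊕ Fin n → A) ⊗ₜ[k]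
      (fun i => F.dual b * y i : Fin m ⊕ Fin n → A)) =
      ∑ i, ∑ j, S j (F.basis b * x j) ⊗ₜ[k] S i (F.dual b * y i) := by
    simp only [← sum_tmul, ← tmul_sum]
    exact congrArg₂ (· ⊗ₜ[k] ·) (Finset.univ_sum_single _).symm (Finset.univ_sum_single _).symm
  have hL (i j : Fin m ⊕ Fin n) (b : F.ι) :
      rowMul k A m n y ((F.matrix m n).basis (i, j, b)) ⊗ₜ[k]
          rowMul k A m n x ((F.matrix m n).dual (i, j, b)) =
        sgn k (idxParity j) • (S j (y i * F.basis b) ⊗ₜ[k] S i (x j * F.dual b)) := by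
    have e : (F.matrix m n).basis (i, j, b) = Matrix.single i j (F.basis b) :=
      Module.Basis.matrix_apply F.basis i j b
    change _ ⊗ₜ[k] rowMul k A m n x (sgn k (idxParity j) • Matrix.single j i (F.dual b)) = _
    rw [e, map_smul, rowMul_single, rowMul_single, tmul_smul]
    rfl
  simp only [hR, Finset.smul_sum]
  rw [Finset.sum_comm]
  refine (Fintype.sum_prod_type' fun i (p : (Fin m ⊕ Fin n) × F.ι) =>
    sgn k (r * s + (F.matrix m n).parity (i, p) * r) •
        (rowMul k A m n y ((F.matrix m n).basis (i, p)) ⊗ₜ[k]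
          rowMul k A m n x ((F.matrix m n).dual (i, p)))).trans ?_
  refine Finset.sum_congr rfl fun i _ => ?_
  rw [Finset.sum_comm]
  refine (Fintype.sum_prod_type' fun j b =>
    sgn k (r * s + (F.matrix m n).parity (i, j, b) * r) •
        (rowMul k A m n y ((F.matrix m n).basis (i, j, b)) ⊗ₜ[k]
          rowMul k A m n x ((F.matrix m n).dual (i, j, b)))).trans ?_
  refine Finset.sum_congr rfl fun j _ => ?_
  rw [← h i j]
  refine Finset.sum_congr rfl fun b _ => ?_
  rw [hL, smul_smul]
  rfl

variable (m n) in
/-- The representation of the generators of `AOB(A)` on the supermodules of `𝔤𝔩_{m|n}(A)`. -/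
def SymmetricFrobenius.glRep :
    AOBRep F (tensorLeft (Vplus k A m n)) (tensorLeft (Vminus k A m n)) :=
  dualPairRep F (V := Vplus k A m n) (V' := Vminus k A m n) (dualFamilies_vec F)
    (formB_invariant F) (leftMul k A m n) leftMul_mem leftMul_one leftMul_comp
    (F.matrix m n).basis_mem (F.matrix m n).dual_mem (F.matrix m n).casimir_invariant
    (fun _ _ hx _ _ hy => sum_rowMul_tmul_rowMul F hx hy)

end GeneralLinearData

end FrobeniusBrauer

end

/-! ### The superfunctor on supermodules of the general linear Lie superalgebra -/

set_option maxHeartbeats 4000000 in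
theorem theorem5p2 {k : Type v} [Field k] {A : Type u} [Ring A] [Algebra k A]
    [FrobeniusBrauer.Superalgebra k A] (F : FrobeniusBrauer.SymmetricFrobenius k A) (m n : ℕ) :
    ∃ (Ψ : FrobeniusBrauer.StrictMonoidalSuperfunctor k (FrobeniusBrauer.AOB F)
        (FrobeniusBrauer.SEnd k (FrobeniusBrauer.SMod.{u, v, u} k
          (Matrix (Fin m ⊕ Fin n) (Fin m ⊕ Fin n) A))))
      (hu : Ψ.obj (FrobeniusBrauer.AOB.up F) =
        FrobeniusBrauer.tensorLeft (FrobeniusBrauer.Vplus k A m n))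
      (hd : Ψ.obj (FrobeniusBrauer.AOB.down F) =
        FrobeniusBrauer.tensorLeft (FrobeniusBrauer.Vminus k A m n)),
      ∀ W : FrobeniusBrauer.SMod.{u, v, u} k (Matrix (Fin m ⊕ Fin n) (Fin m ⊕ Fin n) A),
        -- the crossing
        (∀ (r s : ZMod 2), ∀ v ∈ FrobeniusBrauer.part k (Fin m ⊕ Fin n → A) r,
          ∀ w ∈ FrobeniusBrauer.part k (Fin m ⊕ Fin n → A) s, ∀ x : W.carrier,
          (FrobeniusBrauer.SEnd.appLin
              (Ψ.mapAs (Ψ.tensor_eq hu hu) (Ψ.tensor_eq hu hu) (FrobeniusBrauer.AOB.cross F)) W :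
            (Fin m ⊕ Fin n → A) ⊗[k] ((Fin m ⊕ Fin n → A) ⊗[k] W.carrier) →ₗ[k]
              (Fin m ⊕ Fin n → A) ⊗[k] ((Fin m ⊕ Fin n → A) ⊗[k] W.carrier))
            (v ⊗ₜ[k] (w ⊗ₜ[k] x)) =
          FrobeniusBrauer.sgn k (r * s) • (w ⊗ₜ[k] (v ⊗ₜ[k] x))) ∧
        -- the tokens
        (∀ (a : A) (v : Fin m ⊕ Fin n → A) (x : W.carrier),
          (FrobeniusBrauer.SEnd.appLin (Ψ.mapAs hu hu (FrobeniusBrauer.AOB.token F a)) W :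
            (Fin m ⊕ Fin n → A) ⊗[k] W.carrier →ₗ[k] (Fin m ⊕ Fin n → A) ⊗[k] W.carrier)
            (v ⊗ₜ[k] x) = (fun i => a * v i) ⊗ₜ[k] x) ∧
        -- the right cup
        (∀ x : W.carrier,
          (FrobeniusBrauer.SEnd.appLin
              (Ψ.mapAs Ψ.obj_one (Ψ.tensor_eq hd hu) (FrobeniusBrauer.AOB.rcup F)) W :
            W.carrier →ₗ[k] (Fin m ⊕ Fin n → A) ⊗[k] ((Fin m ⊕ Fin n → A) ⊗[k] W.carrier)) x =
          ∑ p : (Fin m ⊕ Fin n) × F.ι, FrobeniusBrauer.sgn k (F.vecParity m n p) •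
            (F.dualVec m n p ⊗ₜ[k] (F.vec m n p ⊗ₜ[k] x))) ∧
        -- the left cup
        (∀ x : W.carrier,
          (FrobeniusBrauer.SEnd.appLin
              (Ψ.mapAs Ψ.obj_one (Ψ.tensor_eq hu hd) (FrobeniusBrauer.AOB.lcup F)) W :
            W.carrier →ₗ[k] (Fin m ⊕ Fin n → A) ⊗[k] ((Fin m ⊕ Fin n → A) ⊗[k] W.carrier)) x =
          ∑ p : (Fin m ⊕ Fin n) × F.ι, F.vec m n p ⊗ₜ[k] (F.dualVec m n p ⊗ₜ[k] x)) ∧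
        -- the right cap
        (∀ (r s : ZMod 2), ∀ v ∈ FrobeniusBrauer.part k (Fin m ⊕ Fin n → A) r,
          ∀ w ∈ FrobeniusBrauer.part k (Fin m ⊕ Fin n → A) s, ∀ x : W.carrier,
          (FrobeniusBrauer.SEnd.appLin
              (Ψ.mapAs (Ψ.tensor_eq hu hd) Ψ.obj_one (FrobeniusBrauer.AOB.rcap F)) W :
            (Fin m ⊕ Fin n → A) ⊗[k] ((Fin m ⊕ Fin n → A) ⊗[k] W.carrier) →ₗ[k] W.carrier)
            (v ⊗ₜ[k] (w ⊗ₜ[k] x)) =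
          (FrobeniusBrauer.sgn k (r * s) * F.formB m n w v) • x) ∧
        -- the left cap
        (∀ (v w : Fin m ⊕ Fin n → A) (x : W.carrier),
          (FrobeniusBrauer.SEnd.appLin
              (Ψ.mapAs (Ψ.tensor_eq hd hu) Ψ.obj_one (FrobeniusBrauer.AOB.lcap F)) W :
            (Fin m ⊕ Fin n → A) ⊗[k] ((Fin m ⊕ Fin n → A) ⊗[k] W.carrier) →ₗ[k] W.carrier)
            (v ⊗ₜ[k] (w ⊗ₜ[k] x)) = F.formB m n v w • x) ∧
        -- the dot
        (∀ z : (Fin m ⊕ Fin n → A) ⊗[k] W.carrier,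
          (FrobeniusBrauer.SEnd.appLin (Ψ.mapAs hu hu (FrobeniusBrauer.AOB.dot F)) W :
            (Fin m ⊕ Fin n → A) ⊗[k] W.carrier →ₗ[k] (Fin m ⊕ Fin n → A) ⊗[k] W.carrier) z =
          FrobeniusBrauer.rmulTensor (FrobeniusBrauer.Vplus k A m n) W (F.Omega m n) z) := by
  obtain ⟨Ψ, hu, hd, hcross, htoken, hrcup, hlcup, hrcap, hlcap, hdot⟩ :=
    (F.glRep m n).exists_functor
  refine ⟨Ψ, hu, hd, fun W => ⟨?_, ?_, ?_, ?_, ?_, ?_, ?_⟩⟩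
  · intro r s v hv w hw x
    rw [hcross]
    exact FrobeniusBrauer.flipLin_tmul hv hw x
  · intro a v x
    rw [htoken]
    rfl
  · intro x
    rw [hrcup]
    exact FrobeniusBrauer.cupLin_smul_apply _ _ _ x
  · intro x
    rw [hlcup]
    exact FrobeniusBrauer.cupLin_apply _ _ x
  · intro r s v hv w hw x
    rw [hrcap]
    exact FrobeniusBrauer.capLin_superFlip_tmul _ hv hw x
  · intro v w x
    rw [hlcap]
    exact FrobeniusBrauer.capLin_tmul _ v w x
  · intro z
    rw [hdot, F.Omega_eq, FrobeniusBrauer.rmulTensor_eq_omegaLin (FrobeniusBrauer.Vplus k A m n) W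
      (F.matrix m n).basis_mem]
    rfl
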